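/- Let $H$ be a finite-dimensional (purely even) complex vector space with basis $\{\mathcal O_\alpha\}$ and a symmetric non-degenerate pairing with matrix $g_{\alpha\beta}$ and inverse $g^{\alpha\beta}$. Let $\mathbb C^\times=\mathbb C/(z\sim z+1)$, $C=\{z\in[0,1]\}\subset\mathbb C^\times$, and consider fields $$\mu=\sum_{k\ge0,\alpha}\big(\lambda^\alpha_k\,\mathcal O_\alpha t^k+\rho^\alpha_k\,\partial_z\,\mathcal O_\alpha t^k\big),\qquad \lambda^\alpha_k,\rho^\alpha_k\in\Omega^{0,\bullet}(\mathbb C^\times),$$ where $\mu\mapsto\partial_z^m\lambda^\alpha_k$ is even and $\mu\mapsto\partial_z^m\rho^\alpha_k$ is odd. Let $R=\mathbb C[\![\partial_z^m\lambda^\alpha_k,\partial_z^m\rho^\alpha_k]\!]$ be the supercommutative ring of formal power series in these symbols having finitely many monomials in each polynomial degree, with the odd derivation $\delta$ that commutes with $\partial_z$ and satisfies $\delta\lambda^\alpha_k=\partial_z\rho^\alpha_{k-1}$ ($=0$ for $k=0$), $\delta\rho^\alpha_k=0$. For $\mathcal L\in R$ let $\mathscr J_{\mathcal L}=dz\,\mathcal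 L(\partial_z^m\lambda^\alpha_k,\partial_z^m\rho^\alpha_k)=\mathscr J^{(1)}_{\mathcal L}+\mathscr J^{(2)}_{\mathcal L}$ be split into its one-form and two-form parts. The BV bracket $\{\int_{\mathbb C^\times}\mathscr J^{(2)}_{\mathcal L},-\}_{BV}$ is the derivation of formal functions of the fields along the Hamiltonian vector field $$\lambda^\alpha_0\mapsto-\sum_\beta g^{\alpha\beta}\,\partial_z P_\beta$$ (all other components are zero), where $P_\beta\in R$ is the variational derivative of $\int_{\mathbb C^\times}\mathscr J^{(2)}_{\mathcal L}$ with respect to $\lambda_0^\beta$. Let $\mathrm{Obs}^{\oint_C}$ be the space of current observables $\oint_C\mathscr J^{(1)}_{\mathcal L}$, $\mathcal L\in R$, regarded as formal functions on the space of fields annihilated by $\bar\partial$ (that is, two of them are identified if they agree on all fields with $\bar\partial\lambda^\alpha_k=\bar\partial\rho^\alpha_k=0$), with the $\mathbb Z/2\mathbb Z$-grading by the parity of $\mathcal L$. Then $$\Big\{\oint_C\mathscr J^{(1)}_{\mathcal L_1},\oint_C\mathscr J^{(1)}_{\mathcal L_2}\Big\}_C:=\Big\{\int_{\mathbb C^\times}\mathscr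 J^{(2)}_{\mathcal L_1},\oint_C\mathscr J^{(1)}_{\mathcal L_2}\Big\}_{BV},\qquad \delta\oint_C\mathscr J^{(1)}_{\mathcal L}:=\oint_C\mathscr J^{(1)}_{\delta\mathcal L}$$ are well-defined maps $\mathrm{Obs}^{\oint_C}\times\mathrm{Obs}^{\oint_C}\to\mathrm{Obs}^{\oint_C}$ and $\mathrm{Obs}^{\oint_C}\to\mathrm{Obs}^{\oint_C}$, the first is a ($\mathbb Z/2\mathbb Z$-graded) Lie bracket, and $(\mathrm{Obs}^{\oint_C},\delta,\{-,-\}_C)$ is a differential $\mathbb Z/2\mathbb Z$-graded Lie algebra. -/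

import Mathlib

open scoped TensorProduct ContDiff

noncomputable section

namespace BCOV

/-! ### Smooth functions on the cylinder `ℂ / (z ∼ z + 1)` -/

/-- The algebra of smooth complex functions on `ℂˣ ≅ ℂ / (z ∼ z + 1)`, as smooth functions on `ℂ`
of period one. -/
def Smooth : Subalgebra ℂ (ℂ → ℂ) where
  carrier := {f | ContDiff ℝ ∞ f ∧ ∀ z, f (z + 1) = f z}
  mul_mem' := fun {f g} hf hg => ⟨hf.1.mul hg.1, fun z => by
    simp only [Pi.mul_apply, hf.2 z, hg.2 z]⟩
  add_mem' := fun {f g} hf hg => ⟨hf.1.add hg.1, fun z => by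
    simp only [Pi.add_apply, hf.2 z, hg.2 z]⟩
  algebraMap_mem' := fun r => ⟨contDiff_const, fun _ => rfl⟩

theorem differentiable_smooth (f : Smooth) : Differentiable ℝ (f : ℂ → ℂ) :=
  f.2.1.differentiable (by simp)

theorem contDiff_dir (f : Smooth) (v : ℂ) :
    ContDiff ℝ ∞ (fun z => fderiv ℝ (f : ℂ → ℂ) z v) :=
  (f.2.1.fderiv_right (m := ∞) (by simp)).clm_apply contDiff_const

theorem periodic_dir (f : Smooth) (v z : ℂ) :
    fderiv ℝ (f : ℂ → ℂ) (z + 1) v = fderiv ℝ (f : ℂ → ℂ) z v := by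
  have h : (fun w => (f : ℂ → ℂ) (w + 1)) = (f : ℂ → ℂ) := funext f.2.2
  rw [← fderiv_comp_add_right, h]

/-- The directional derivative in the real direction `v`. -/
def dirDeriv (v : ℂ) : Smooth →ₗ[ℂ] Smooth where
  toFun f := ⟨fun z => fderiv ℝ (f : ℂ → ℂ) z v, contDiff_dir f v, periodic_dir f v⟩
  map_add' f g := by
    refine Subtype.ext (funext fun z => ?_)
    change fderiv ℝ ((f : ℂ → ℂ) + (g : ℂ → ℂ)) z v = _
    rw [fderiv_add (differentiable_smooth f z) (differentiable_smooth g z)]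
    rfl
  map_smul' c f := by
    refine Subtype.ext (funext fun z => ?_)
    change fderiv ℝ (c • (f : ℂ → ℂ)) z v = _
    rw [fderiv_const_smul (differentiable_smooth f z)]
    rfl

/-- `∂_z = (∂_x - i ∂_y) / 2`. -/
def delz : Smooth →ₗ[ℂ] Smooth :=
  (1 / 2 : ℂ) • (dirDeriv 1 - Complex.I • dirDeriv Complex.I)

/-- `∂_{z̄} = (∂_x + i ∂_y) / 2`. -/
def delzbar : Smooth →ₗ[ℂ] Smooth :=
  (1 / 2 : ℂ) • (dirDeriv 1 + Complex.I • dirDeriv Complex.I)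

/-- `f ↦ ∮_C f dz`, where `C = {z ∈ [0,1]}`. -/
def circleInt : Smooth →ₗ[ℂ] ℂ where
  toFun f := ∫ x in (0 : ℝ)..1, (f : ℂ → ℂ) (x : ℂ)
  map_add' f g := intervalIntegral.integral_add
    ((f.2.1.continuous.comp Complex.continuous_ofReal).intervalIntegrable _ _)
    ((g.2.1.continuous.comp Complex.continuous_ofReal).intervalIntegrable _ _)
  map_smul' c _ := intervalIntegral.integral_smul c _

/-- `f ↦ ∫_{ℂˣ} f dz ∧ dz̄`, with `dz ∧ dz̄ = -2i dx ∧ dy`; it is only applied to functions `f` of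
compact support. -/
def cylinderInt (f : Smooth) : ℂ :=
  (-2 * Complex.I) * ∫ y : ℝ, ∫ x in (0 : ℝ)..1, (f : ℂ → ℂ) (x + y * Complex.I)

/-- Functions on the cylinder that vanish for `|Im z| > R`. -/
def suppIn (R : ℝ) : Submodule ℂ Smooth where
  carrier := {f | ∀ z : ℂ, R < |z.im| → (f : ℂ → ℂ) z = 0}
  add_mem' := fun {f g} hf hg z hz => by
    change (f : ℂ → ℂ) z + (g : ℂ → ℂ) z = 0
    rw [hf z hz, hg z hz, add_zero]
  zero_mem' := fun _ _ => rfl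
  smul_mem' := fun c f hf z hz => by
    change c • (f : ℂ → ℂ) z = 0
    rw [hf z hz, smul_zero]

/-! ### Grassmann parameters and Dolbeault forms

Functions on the super vector space of fields are described by their values on points with
coordinates in the Grassmann algebra on countably many odd parameters. -/

/-- The Grassmann algebra on the odd parameters `θ₀, θ₁, …`. -/
abbrev Param : Type := ExteriorAlgebra ℂ (ℕ →₀ ℂ)

/-- The Grassmann algebra on `dz̄` and the odd parameters `θ₀, θ₁, …`. -/
abbrev FormParam : Type := ExteriorAlgebra ℂ (ℂ × (ℕ →₀ ℂ))

/-- The generator `dz̄`. -/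
def dzbar : FormParam := ExteriorAlgebra.ι ℂ ((1 : ℂ), (0 : ℕ →₀ ℂ))

/-- The inclusion of the parameters. -/
def inclParam : Param →ₐ[ℂ] FormParam := ExteriorAlgebra.map (LinearMap.inr ℂ ℂ (ℕ →₀ ℂ))

/-- Setting `dz̄ = 0`: if `F = F₀ + dz̄ F₁` with `F₀, F₁` free of `dz̄`, this is `F ↦ F₀`. -/
def functionPart : FormParam →ₐ[ℂ] Param := ExteriorAlgebra.map (LinearMap.snd ℂ ℂ (ℕ →₀ ℂ))

/-- If `F = F₀ + dz̄ F₁` with `F₀, F₁` free of `dz̄`, this is `F ↦ F₁`. -/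
def formPart : FormParam →ₗ[ℂ] Param :=
  functionPart.toLinearMap ∘ₗ
    CliffordAlgebra.contractLeft (Q := (0 : QuadraticForm ℂ (ℂ × (ℕ →₀ ℂ))))
      (LinearMap.fst ℂ ℂ (ℕ →₀ ℂ))

/-- The supercommutative algebra `Ω^{0,•}(ℂˣ) ⊗ ℂ[θ₀, θ₁, …]` of Dolbeault forms with Grassmann
parameters; `dz̄` and the `θ`s anticommute. -/
abbrev Form : Type := Smooth ⊗[ℂ] FormParam

instance : Ring Form := Algebra.TensorProduct.instRing
instance : AddCommGroup Form := Ring.toAddCommGroup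
instance : AddGroup Form := AddCommGroup.toAddGroup
instance : SubtractionMonoid Form := AddGroup.toSubtractionMonoid

/-- The parity operator: `1` on even elements and `-1` on odd elements. -/
def formParity : Form →ₐ[ℂ] Form :=
  Algebra.TensorProduct.map (AlgHom.id ℂ Smooth)
    (CliffordAlgebra.involute (Q := (0 : QuadraticForm ℂ (ℂ × (ℕ →₀ ℂ)))))

/-- Homogeneous parameters of parity `p`. -/
def Param.IsHomog (p : ZMod 2) (η : Param) : Prop :=
  CliffordAlgebra.involute (Q := (0 : QuadraticForm ℂ (ℕ →₀ ℂ))) η = ((-1 : ℂ) ^ p.val) • η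

/-- A parameter, as a constant form. -/
def constForm (η : Param) : Form := (1 : Smooth) ⊗ₜ[ℂ] inclParam η

/-- `∂_z` on forms. -/
def formDelz : Form →ₗ[ℂ] Form := LinearMap.rTensor FormParam delz

/-- `∂̄ = dz̄ ∂_{z̄}` on forms. -/
def formDelbar : Form →ₗ[ℂ] Form :=
  LinearMap.mulLeft ℂ ((1 : Smooth) ⊗ₜ[ℂ] dzbar) ∘ₗ LinearMap.rTensor FormParam delzbar

/-- `F ↦ ∮_C (dz F)^{(1)}`: the integral over `C` of the one-form part of `dz F`. -/
def formCircleInt : Form →ₗ[ℂ] Param :=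
  (TensorProduct.lid ℂ Param).toLinearMap ∘ₗ
    TensorProduct.map circleInt functionPart.toLinearMap

/-- `F ↦ ∫_{ℂˣ} (dz F)^{(2)}`: the integral over `ℂˣ` of the two-form part of `dz F`, for `F` of
compact support. The result is a Grassmann number, given by its value under each linear form `ℓ`. -/
def formCylinderInt (F : Form) (l : Param →ₗ[ℂ] ℂ) : ℂ :=
  cylinderInt ((TensorProduct.rid ℂ Smooth)
    (TensorProduct.map LinearMap.id (l ∘ₗ formPart) F))

/-- Forms that vanish for `|Im z| > R`. -/
def formSuppIn (R : ℝ) : Submodule ℂ Form :=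
  LinearMap.range (LinearMap.rTensor FormParam (suppIn R).subtype)

/-! ### Supercommutativity of the algebra of forms -/

section Supercomm

variable {M : Type*} [AddCommGroup M] [Module ℂ M]

theorem mul_add_involute (y x : ExteriorAlgebra ℂ M) :
    y * (x + CliffordAlgebra.involute x) = (x + CliffordAlgebra.involute x) * y := by
  have key : ∀ (v : M) (x : ExteriorAlgebra ℂ M),
      ExteriorAlgebra.ι ℂ v * x = CliffordAlgebra.involute x * ExteriorAlgebra.ι ℂ v := by
    intro v x
    induction x using ExteriorAlgebra.induction with
    | algebraMap r => simp [Algebra.commutes]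
    | ι w =>
      have h := ExteriorAlgebra.ι_add_mul_swap (R := ℂ) v w
      have h2 : CliffordAlgebra.involute (ExteriorAlgebra.ι ℂ w) = -ExteriorAlgebra.ι ℂ w :=
        CliffordAlgebra.involute_ι w
      rw [h2, neg_mul]
      exact eq_neg_of_add_eq_zero_left h
    | mul a b ha hb => rw [← mul_assoc, ha, mul_assoc, hb, ← mul_assoc, map_mul]
    | add a b ha hb => rw [mul_add, ha, hb, map_add, add_mul]
  induction y using ExteriorAlgebra.induction with
  | algebraMap r => exact Algebra.commutes r _
  | ι v => rw [key]; simp [add_comm]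
  | mul a b ha hb => rw [mul_assoc, hb, ← mul_assoc, ha, mul_assoc]
  | add a b ha hb => rw [add_mul, ha, hb, mul_add]

theorem mul_sub_involute (y x : ExteriorAlgebra ℂ M) :
    y * (x - CliffordAlgebra.involute x) =
      (x - CliffordAlgebra.involute x) * CliffordAlgebra.involute y := by
  have key : ∀ (v : M) (x : ExteriorAlgebra ℂ M),
      ExteriorAlgebra.ι ℂ v * x = CliffordAlgebra.involute x * ExteriorAlgebra.ι ℂ v := by
    intro v x
    induction x using ExteriorAlgebra.induction with
    | algebraMap r => simp [Algebra.commutes]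
    | ι w =>
      have h := ExteriorAlgebra.ι_add_mul_swap (R := ℂ) v w
      have h2 : CliffordAlgebra.involute (ExteriorAlgebra.ι ℂ w) = -ExteriorAlgebra.ι ℂ w :=
        CliffordAlgebra.involute_ι w
      rw [h2, neg_mul]
      exact eq_neg_of_add_eq_zero_left h
    | mul a b ha hb => rw [← mul_assoc, ha, mul_assoc, hb, ← mul_assoc, map_mul]
    | add a b ha hb => rw [mul_add, ha, hb, map_add, add_mul]
  induction y using ExteriorAlgebra.induction with
  | algebraMap r => rw [AlgHom.commutes]; exact Algebra.commutes r _
  | ι v =>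
    have h2 : CliffordAlgebra.involute (ExteriorAlgebra.ι ℂ v) = -ExteriorAlgebra.ι ℂ v :=
      CliffordAlgebra.involute_ι v
    rw [key, h2, map_sub, CliffordAlgebra.involute_involute, mul_neg, ← neg_mul, neg_sub]
  | mul a b ha hb => rw [mul_assoc, hb, ← mul_assoc, ha, mul_assoc, map_mul]
  | add a b ha hb => rw [add_mul, ha, hb, map_add, mul_add]

end Supercomm

theorem form_mul_add (G F : Form) :
    G * (F + formParity F) = (F + formParity F) * G := by
  induction F using TensorProduct.induction_on with
  | zero => simp
  | add a b ha hb =>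
    rw [map_add, add_add_add_comm, mul_add, ha, hb, ← add_mul]
  | tmul a x =>
    induction G using TensorProduct.induction_on with
    | zero => simp
    | add c d hc hd => rw [add_mul, hc, hd, mul_add]
    | tmul c y =>
      have h : a ⊗ₜ[ℂ] x + formParity (a ⊗ₜ[ℂ] x) =
          a ⊗ₜ[ℂ] (x + CliffordAlgebra.involute x) := by
        rw [TensorProduct.tmul_add]; rfl
      rw [h, Algebra.TensorProduct.tmul_mul_tmul, Algebra.TensorProduct.tmul_mul_tmul,
        mul_add_involute, mul_comm]

theorem form_mul_sub (G F : Form) :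
    G * (F - formParity F) = (F - formParity F) * formParity G := by
  induction F using TensorProduct.induction_on with
  | zero => simp
  | add a b ha hb =>
    rw [map_add, add_sub_add_comm, mul_add, ha, hb, ← add_mul]
  | tmul a x =>
    induction G using TensorProduct.induction_on with
    | zero => simp
    | add c d hc hd => rw [add_mul, hc, hd, map_add, mul_add]
    | tmul c y =>
      have h : a ⊗ₜ[ℂ] x - formParity (a ⊗ₜ[ℂ] x) =
          a ⊗ₜ[ℂ] (x - CliffordAlgebra.involute x) := by
        rw [TensorProduct.tmul_sub]; rfl
      have h2 : formParity (c ⊗ₜ[ℂ] y) = c ⊗ₜ[ℂ] CliffordAlgebra.involute y := rfl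
      rw [h, h2, Algebra.TensorProduct.tmul_mul_tmul, Algebra.TensorProduct.tmul_mul_tmul,
        mul_sub_involute, mul_comm]

/-- Even forms are central. -/
theorem form_comm_of_even {F : Form} (hF : formParity F = F) (G : Form) : G * F = F * G := by
  have h := form_mul_add G F
  rw [hF, ← two_smul ℂ F, mul_smul_comm, smul_mul_assoc] at h
  exact smul_right_injective Form (two_ne_zero (α := ℂ)) h

/-- Odd forms anticommute. -/
theorem form_anticomm_of_odd {F G : Form} (hF : formParity F = -F) (hG : formParity G = -G) :
    G * F = -(F * G) := by
  have h := form_mul_sub G F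
  rw [hF, hG, sub_neg_eq_add, ← two_smul ℂ F, mul_smul_comm, smul_mul_assoc, mul_neg] at h
  exact smul_right_injective Form (two_ne_zero (α := ℂ)) h

theorem formParity_formDelz (F : Form) : formParity (formDelz F) = formDelz (formParity F) := by
  induction F using TensorProduct.induction_on with
  | zero => simp
  | add a b ha hb => simp only [map_add, ha, hb]
  | tmul a x => rfl

theorem formParity_iterate (F : Form) (m : ℕ) :
    formParity (formDelz^[m] F) = formDelz^[m] (formParity F) := by
  induction m generalizing F with
  | zero => rfl
  | succ m ih => rw [Function.iterate_succ_apply, ih, formParity_formDelz,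
      Function.iterate_succ_apply]

theorem formDelz_iterate_neg (F : Form) (m : ℕ) : formDelz^[m] (-F) = -(formDelz^[m] F) := by
  induction m generalizing F with
  | zero => rfl
  | succ m ih => rw [Function.iterate_succ_apply, map_neg, ih, Function.iterate_succ_apply]

/-! ### The formal differential ring `ℂ⟦∂_z^m λ^α_k, ∂_z^m ρ^α_k⟧` -/

/-- The symbols `lam α k m = ∂_z^m λ^α_k` (even) and `rho α k m = ∂_z^m ρ^α_k` (odd). -/
inductive Gen (I : Type*)
  | lam (α : I) (k m : ℕ)
  | rho (α : I) (k m : ℕ)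

/-- The parity of a symbol. -/
def Gen.parity {I : Type*} : Gen I → ZMod 2
  | .lam _ _ _ => 0
  | .rho _ _ _ => 1

/-- The Koszul sign `(-1)^{pq}`. -/
def koszul (p q : ZMod 2) : ℂ := (-1) ^ (p.val * q.val)

/-- Graded commutativity of the symbols. -/
inductive SuperRel (I : Type*) : FreeAlgebra ℂ (Gen I) → FreeAlgebra ℂ (Gen I) → Prop
  | comm (a b : Gen I) : SuperRel I (FreeAlgebra.ι ℂ a * FreeAlgebra.ι ℂ b)
      (koszul a.parity b.parity • (FreeAlgebra.ι ℂ b * FreeAlgebra.ι ℂ a))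

/-- The free supercommutative algebra of polynomials in the symbols. -/
abbrev SuperPoly (I : Type*) : Type _ := RingQuot (SuperRel I)

section SuperPoly

variable {I : Type*}

/-- A symbol, as a polynomial. -/
def gen (a : Gen I) : SuperPoly I := RingQuot.mkAlgHom ℂ (SuperRel I) (FreeAlgebra.ι ℂ a)

/-- A monomial. -/
def monom (w : List (Gen I)) : SuperPoly I := (w.map gen).prod

theorem gen_comm (a b : Gen I) :
    gen a * gen b = koszul a.parity b.parity • (gen b * gen a) := by
  have h := RingQuot.mkAlgHom_rel ℂ (SuperRel.comm a b)
  rwa [map_mul, map_smul, map_mul] at h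

/-- The universal property of the polynomial algebra. -/
def liftGen {B : Type*} [Ring B] [Algebra ℂ B] (f : Gen I → B)
    (hf : ∀ a b, f a * f b = koszul a.parity b.parity • (f b * f a)) : SuperPoly I →ₐ[ℂ] B :=
  RingQuot.liftAlgHom ℂ ⟨FreeAlgebra.lift ℂ f, by
    rintro _ _ ⟨a, b⟩
    simpa only [map_mul, map_smul, FreeAlgebra.lift_ι_apply] using hf a b⟩

theorem liftGen_gen {B : Type*} [Ring B] [Algebra ℂ B] (f : Gen I → B)
    (hf : ∀ a b, f a * f b = koszul a.parity b.parity • (f b * f a)) (a : Gen I) :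
    liftGen f hf (gen a) = f a := by
  rw [liftGen, gen, RingQuot.liftAlgHom_mkAlgHom_apply, FreeAlgebra.lift_ι_apply]

/-- Homogeneous polynomials of degree `d`. -/
def homog (I : Type*) (d : ℕ) : Submodule ℂ (SuperPoly I) :=
  Submodule.span ℂ {x | ∃ w : List (Gen I), w.length = d ∧ x = monom w}

/-- Polynomials of parity `p`. -/
def parityPart (I : Type*) (p : ZMod 2) : Submodule ℂ (SuperPoly I) :=
  Submodule.span ℂ {x | ∃ w : List (Gen I), (w.map Gen.parity).sum = p ∧ x = monom w}

/-- The values of the derivation `δ` on symbols: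
`δ (∂_z^m λ^α_k) = ∂_z^{m+1} ρ^α_{k-1}` (zero for `k = 0`) and `δ (∂_z^m ρ^α_k) = 0`. -/
def deltaGen : Gen I → SuperPoly I
  | .lam _ 0 _ => 0
  | .lam α (k + 1) m => gen (.rho α k (m + 1))
  | .rho _ _ _ => 0

theorem deltaGen_comm (a b : Gen I) :
    deltaGen a * gen b = koszul (a.parity + 1) b.parity • (gen b * deltaGen a) := by
  rcases a with ⟨α, _ | k, m⟩ | ⟨α, k, m⟩
  · simp [deltaGen]
  · exact gen_comm (.rho α k (m + 1)) b
  · simp [deltaGen]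

theorem deltaGen_leibniz (a b : Gen I) :
    ((-1 : ℂ) ^ a.parity.val) • gen a * deltaGen b + deltaGen a * gen b =
      koszul a.parity b.parity •
        (((-1 : ℂ) ^ b.parity.val) • gen b * deltaGen a + deltaGen b * gen a) := by
  rw [deltaGen_comm a b, deltaGen_comm b a]
  generalize gen a = x
  generalize gen b = y
  generalize deltaGen a = x1
  generalize deltaGen b = y1
  have h2 : (1 + 1 : ZMod 2) = 0 := rfl
  rcases a with ⟨α, k, m⟩ | ⟨α, k, m⟩ <;> rcases b with ⟨β, l, n⟩ | ⟨β, l, n⟩ <;>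
    (simp [Gen.parity, koszul, ZMod.val_one, h2, add_comm]; try module)

/-- The algebra map `x ↦ (ε x, δ x; 0, x)` into upper triangular matrices, where
`ε x = (-1)^{|x|} x`. Its multiplicativity expresses the graded Leibniz rule
`δ (x y) = (δ x) y + (-1)^{|x|} x (δ y)`. -/
def deltaMatrix : SuperPoly I →ₐ[ℂ] Matrix (Fin 2) (Fin 2) (SuperPoly I) :=
  liftGen (fun a => !![((-1 : ℂ) ^ a.parity.val) • gen a, deltaGen a; 0, gen a]) (by
    intro a b
    have h1 := gen_comm a b
    have h2 := deltaGen_leibniz a b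
    rw [Matrix.mul_fin_two, Matrix.mul_fin_two, Matrix.smul_of]
    simp only [Matrix.smul_cons, Matrix.smul_empty, mul_zero, zero_mul, add_zero, zero_add,
      smul_zero]
    rw [h2, h1, smul_mul_smul_comm, smul_mul_smul_comm, h1, smul_comm (koszul _ _),
      mul_comm ((-1 : ℂ) ^ a.parity.val)])

/-- The odd derivation `δ`. -/
def deltaPoly : SuperPoly I →ₗ[ℂ] SuperPoly I where
  toFun x := deltaMatrix x 0 1
  map_add' x y := by simp
  map_smul' c x := by simp

theorem deltaMatrix_gen (a : Gen I) : deltaMatrix (gen a) =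
    !![((-1 : ℂ) ^ a.parity.val) • gen a, deltaGen a; 0, gen a] := liftGen_gen _ _ a

theorem deltaMatrix_lower (x : SuperPoly I) : deltaMatrix x 1 0 = 0 := by
  obtain ⟨y, rfl⟩ := RingQuot.mkAlgHom_surjective ℂ (SuperRel I) x
  induction y using FreeAlgebra.induction with
  | grade0 r => simp [Matrix.algebraMap_eq_diagonal]
  | grade1 a =>
    change deltaMatrix (gen a) 1 0 = 0
    rw [deltaMatrix_gen]
    rfl
  | mul a b ha hb => simp [Matrix.mul_apply, Fin.sum_univ_two, ha, hb]
  | add a b ha hb => simp [ha, hb]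

theorem deltaMatrix_diag (x : SuperPoly I) : deltaMatrix x 1 1 = x := by
  obtain ⟨y, rfl⟩ := RingQuot.mkAlgHom_surjective ℂ (SuperRel I) x
  induction y using FreeAlgebra.induction with
  | grade0 r => simp [Matrix.algebraMap_eq_diagonal]
  | grade1 a =>
    change deltaMatrix (gen a) 1 1 = gen a
    rw [deltaMatrix_gen]
    rfl
  | mul a b ha hb => simp [Matrix.mul_apply, Fin.sum_univ_two, ha, hb, deltaMatrix_lower]
  | add a b ha hb => simp [ha, hb]

/-- The graded Leibniz rule on a product of a symbol and a polynomial. -/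
theorem deltaPoly_gen_mul (a : Gen I) (x : SuperPoly I) :
    deltaPoly (gen a * x) =
      deltaGen a * x + ((-1 : ℂ) ^ a.parity.val) • (gen a * deltaPoly x) := by
  change deltaMatrix (gen a * x) 0 1 = _
  rw [map_mul, Matrix.mul_apply, Fin.sum_univ_two, deltaMatrix_gen, deltaMatrix_diag, add_comm]
  simp [deltaPoly]

theorem deltaPoly_one : deltaPoly (1 : SuperPoly I) = 0 := by
  change deltaMatrix (1 : SuperPoly I) 0 1 = 0
  rw [map_one]
  simp

theorem gen_mul_mem_homog (a : Gen I) {x : SuperPoly I} {d : ℕ} (hx : x ∈ homog I d) :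
    gen a * x ∈ homog I (d + 1) := by
  induction hx using Submodule.span_induction with
  | mem x hx =>
    obtain ⟨w, hw, rfl⟩ := hx
    exact Submodule.subset_span ⟨a :: w, by simp [hw], by simp [monom]⟩
  | zero => rw [mul_zero]; exact Submodule.zero_mem _
  | add x y _ _ hx hy => rw [mul_add]; exact Submodule.add_mem _ hx hy
  | smul c x _ hx => rw [mul_smul_comm]; exact Submodule.smul_mem _ c hx

theorem deltaGen_mul_mem_homog (a : Gen I) {x : SuperPoly I} {d : ℕ} (hx : x ∈ homog I d) :
    deltaGen a * x ∈ homog I (d + 1) := by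
  rcases a with ⟨α, _ | k, m⟩ | ⟨α, k, m⟩
  · rw [deltaGen, zero_mul]; exact Submodule.zero_mem _
  · exact gen_mul_mem_homog _ hx
  · rw [deltaGen, zero_mul]; exact Submodule.zero_mem _

theorem deltaPoly_mem_homog {x : SuperPoly I} {d : ℕ} (hx : x ∈ homog I d) :
    deltaPoly x ∈ homog I d := by
  induction hx using Submodule.span_induction with
  | mem x hx =>
    obtain ⟨w, hw, rfl⟩ := hx
    induction w generalizing d with
    | nil => rw [monom, List.map_nil, List.prod_nil, deltaPoly_one]; exact Submodule.zero_mem _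
    | cons a w ih =>
      subst hw
      have h : monom (a :: w) = gen a * monom w := by simp [monom]
      rw [h, deltaPoly_gen_mul]
      exact Submodule.add_mem _
        (deltaGen_mul_mem_homog a (Submodule.subset_span ⟨w, rfl, rfl⟩))
        (Submodule.smul_mem _ _ (gen_mul_mem_homog a (ih rfl)))
  | zero => rw [map_zero]; exact Submodule.zero_mem _
  | add x y _ _ hx hy => rw [map_add]; exact Submodule.add_mem _ hx hy
  | smul c x _ hx => rw [map_smul]; exact Submodule.smul_mem _ c hx

/-- The formal differential ring `ℂ⟦∂_z^m λ^α_k, ∂_z^m ρ^α_k⟧`: formal sums `∑_d L d` with `L d` a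
homogeneous polynomial of degree `d` in the symbols. -/
def SuperSeries (I : Type*) : Submodule ℂ (ℕ → SuperPoly I) where
  carrier := {L | ∀ d, L d ∈ homog I d}
  add_mem' := fun hL hM d => Submodule.add_mem _ (hL d) (hM d)
  zero_mem' := fun _ => Submodule.zero_mem _
  smul_mem' := fun c _ hL d => Submodule.smul_mem _ c (hL d)

/-- The series of parity `p`. -/
def seriesParity (I : Type*) (p : ZMod 2) : Submodule ℂ (SuperSeries I) where
  carrier := {L | ∀ d, (L : ℕ → SuperPoly I) d ∈ parityPart I p}
  add_mem' := fun hL hM d => Submodule.add_mem _ (hL d) (hM d)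
  zero_mem' := fun _ => Submodule.zero_mem _
  smul_mem' := fun c _ hL d => Submodule.smul_mem _ c (hL d)

/-- The differential `δ` on the formal differential ring. -/
def delta : SuperSeries I →ₗ[ℂ] SuperSeries I where
  toFun L := ⟨fun d => deltaPoly ((L : ℕ → SuperPoly I) d), fun d => deltaPoly_mem_homog (L.2 d)⟩
  map_add' _ _ := Subtype.ext (funext fun _ => map_add deltaPoly _ _)
  map_smul' c _ := Subtype.ext (funext fun _ => map_smul deltaPoly c _)

/-! ### Fields -/

/-- The (Grassmann-valued points of the) space of fields
`μ = ∑ λ^α_k O_α t^k + ρ^α_k ∂_z O_α t^k` on `ℂˣ`: a pair `(λ, ρ)` of families of Dolbeault forms,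
`λ^α_k` of total parity zero and `ρ^α_k` of total parity one. -/
def SuperField (I : Type*) : Submodule ℂ ((I → ℕ → Form) × (I → ℕ → Form)) where
  carrier := {μ | (∀ α k, formParity (μ.1 α k) = μ.1 α k) ∧
    ∀ α k, formParity (μ.2 α k) = -μ.2 α k}
  add_mem' := fun {μ ν} hμ hν => ⟨fun α k => by
      change formParity (μ.1 α k + ν.1 α k) = μ.1 α k + ν.1 α k
      rw [map_add, hμ.1, hν.1], fun α k => by
      change formParity (μ.2 α k + ν.2 α k) = -(μ.2 α k + ν.2 α k)
      rw [map_add, hμ.2, hν.2, neg_add]⟩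
  zero_mem' := ⟨fun _ _ => map_zero _, fun _ _ => by
    change formParity 0 = -0
    rw [map_zero, neg_zero]⟩
  smul_mem' := fun c μ hμ => ⟨fun α k => by
      change formParity (c • μ.1 α k) = c • μ.1 α k
      rw [map_smul, hμ.1], fun α k => by
      change formParity (c • μ.2 α k) = -(c • μ.2 α k)
      rw [map_smul, hμ.2, smul_neg]⟩

/-- The value of a symbol on a field. -/
def symbolValue (μ : SuperField I) : Gen I → Form
  | .lam α k m => formDelz^[m] (μ.1.1 α k)
  | .rho α k m => formDelz^[m] (μ.1.2 α k)

theorem symbolValue_comm (μ : SuperField I) (a b : Gen I) :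
    symbolValue μ a * symbolValue μ b =
      koszul a.parity b.parity • (symbolValue μ b * symbolValue μ a) := by
  have he : ∀ α k m, formParity (symbolValue μ (.lam α k m)) = symbolValue μ (.lam α k m) :=
    fun α k m => by rw [symbolValue, formParity_iterate, μ.2.1]
  have ho : ∀ α k m, formParity (symbolValue μ (.rho α k m)) = -symbolValue μ (.rho α k m) :=
    fun α k m => by rw [symbolValue, formParity_iterate, μ.2.2, formDelz_iterate_neg]
  rcases a with ⟨α, k, m⟩ | ⟨α, k, m⟩
  · have h : koszul (Gen.lam α k m).parity b.parity = 1 := by simp [koszul, Gen.parity]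
    rw [h, one_smul, form_comm_of_even (he α k m)]
  · rcases b with ⟨β, l, n⟩ | ⟨β, l, n⟩
    · have h : koszul (Gen.rho α k m).parity (Gen.lam β l n).parity = 1 := by
        simp [koszul, Gen.parity]
      rw [h, one_smul, form_comm_of_even (he β l n)]
    · have h : koszul (Gen.rho α k m).parity (Gen.rho β l n).parity = -1 := by
        simp [koszul, Gen.parity, ZMod.val_one]
      rw [h, neg_smul, one_smul, form_anticomm_of_odd (ho β l n) (ho α k m)]

/-- Substitution of a field into a polynomial in the symbols: `𝓛(∂_z^m λ^α_k, ∂_z^m ρ^α_k)`. -/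
def evalField (μ : SuperField I) : SuperPoly I →ₐ[ℂ] Form :=
  liftGen (symbolValue μ) (symbolValue_comm μ)

/-- Fields annihilated by `∂̄`. -/
def IsOnShell (μ : SuperField I) : Prop :=
  (∀ α k, formDelbar (μ.1.1 α k) = 0) ∧ ∀ α k, formDelbar (μ.1.2 α k) = 0

/-- Fields of compact support. -/
def IsCompactlySupported (μ : SuperField I) : Prop :=
  ∃ R : ℝ, (∀ α k, μ.1.1 α k ∈ formSuppIn R) ∧ ∀ α k, μ.1.2 α k ∈ formSuppIn R

/-! ### Observables and the BV bracket -/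

/-- Formal functions on the space of fields: `O n` is the Taylor component of degree `n`. -/
abbrev Obs (I : Type*) : Type _ := ℕ → SuperField I → Param

/-- The restriction of formal functions to the fields annihilated by `∂̄`. -/
abbrev OnShellObs (I : Type*) : Type _ := ℕ → {μ : SuperField I // IsOnShell μ} → Param

/-- Restriction to the fields annihilated by `∂̄`. -/
def restrict : Obs I →ₗ[ℂ] OnShellObs I where
  toFun O n μ := O n μ.1
  map_add' _ _ := rfl
  map_smul' _ _ := rfl

/-- `∮_C 𝒥_L^{(1)}`, where `𝒥_L = dz L(∂_z^m λ^α_k, ∂_z^m ρ^α_k)`. -/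
def currentObs : SuperSeries I →ₗ[ℂ] Obs I where
  toFun L n μ := formCircleInt (evalField μ ((L : ℕ → SuperPoly I) n))
  map_add' L M := funext fun n => funext fun μ => by
    change formCircleInt (evalField μ ((L : ℕ → SuperPoly I) n + (M : ℕ → SuperPoly I) n)) = _
    rw [map_add, map_add]
    rfl
  map_smul' c L := funext fun n => funext fun μ => by
    change formCircleInt (evalField μ (c • (L : ℕ → SuperPoly I) n)) = _
    rw [map_smul, map_smul]
    rfl

/-- The Taylor components of the local functional `∫_{ℂˣ} 𝒥_L^{(2)}` on compactly supported
fields. -/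
def localFunctional (L : SuperSeries I) (n : ℕ) (μ : SuperField I) : (Param →ₗ[ℂ] ℂ) → ℂ :=
  formCylinderInt (evalField μ ((L : ℕ → SuperPoly I) n))

/-- `P α` is the variational derivative of `S = ∫_{ℂˣ} 𝒥_L^{(2)}` with respect to `λ^α_0`: the local
expression such that `dS(μ)[ν] = ∫_{ℂˣ} dz ∑_α ν^α P_α(μ)` for all compactly supported fields `μ`
and all compactly supported variations `λ^α_0 ↦ λ^α_0 + s ν^α`. In terms of Taylor components,
`S_{n+1}` corresponds to the component of degree `n` of `P`. -/
def IsVariationalDerivative [Fintype I] (L : SuperSeries I) (P : I → SuperSeries I) : Prop :=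
  ∀ (n : ℕ) (μ ν : SuperField I), IsCompactlySupported μ → IsCompactlySupported ν →
    (∀ α k, 0 < k → ν.1.1 α k = 0) → (∀ α k, ν.1.2 α k = 0) → ∀ l : Param →ₗ[ℂ] ℂ,
    HasDerivAt (fun s : ℂ => localFunctional L (n + 1) (μ + s • ν) l)
      (formCylinderInt (∑ α, ν.1.1 α 0 * evalField μ ((P α : ℕ → SuperPoly I) n)) l) 0

/-- The component of degree `n` of the Hamiltonian vector field of a local functional with
variational derivative `P`, for the BV kernel `∑ g^{αβ} O_α ⊗ O_β ∂_z δ(z - w) (dz̄ - dw̄)`. The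
kernel only pairs the fields `λ^α_0` with each other, so that the vector field is
`λ^α_0 ↦ -∑_β g^{αβ} ∂_z P_β`, with all other components zero. -/
def hamiltonianField [Fintype I] [DecidableEq I] (g : Matrix I I ℂ) (P : I → SuperSeries I)
    (n : ℕ) (μ : SuperField I) (α : I) : Form :=
  -∑ β, g⁻¹ α β • formDelz (evalField μ ((P β : ℕ → SuperPoly I) n))

/-- `y` is the derivative of the function `O` at `μ` in the direction `ν`. -/
def HasDirDeriv (O : SuperField I → Param) (μ ν : SuperField I) (y : Param) : Prop :=
  ∀ l : Param →ₗ[ℂ] ℂ, HasDerivAt (fun s : ℂ => l (O (μ + s • ν))) (l y) 0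

/-- `O'` is the image of `O` under the derivation given by the formal vector field
`λ^α_0 ↦ ∑_e X e μ α` of parity `p`. It is determined by
`η O'(μ) = dO(μ)[η X(μ)]` for all parameters `η` of parity `p` (so that `η X` is even); in degree
`n` this reads `η O'_n(μ) = ∑_{d + e = n + 1} dO_d(μ)[η X_e(μ)]`. -/
def IsDerivationAlong (p : ZMod 2) (X : ℕ → SuperField I → I → Form) (O O' : Obs I) : Prop :=
  ∀ (n : ℕ) (μ : SuperField I) (η : Param), η.IsHomog p →
    ∃ (ν : ℕ → SuperField I) (y : ℕ × ℕ → Param),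
      (∀ e α k, (ν e).1.1 α k = if k = 0 then constForm η * X e μ α else 0) ∧
      (∀ e α k, (ν e).1.2 α k = 0) ∧
      (∀ x ∈ Finset.HasAntidiagonal.antidiagonal (n + 1), HasDirDeriv (O x.1) μ (ν x.2) (y x)) ∧
      η * O' n μ = ∑ x ∈ Finset.HasAntidiagonal.antidiagonal (n + 1), y x

/-- `O' = {∫_{ℂˣ} 𝒥_L^{(2)}, O}_BV`: the derivation along the Hamiltonian vector field, taken for the
even and the odd part of `L` separately. -/
def IsBVBracket [Fintype I] [DecidableEq I] (g : Matrix I I ℂ) (L : SuperSeries I)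
    (O O' : Obs I) : Prop :=
  ∃ (Lp : ZMod 2 → SuperSeries I) (P : ZMod 2 → I → SuperSeries I) (Op : ZMod 2 → Obs I),
    (∀ p, Lp p ∈ seriesParity I p) ∧ L = ∑ p, Lp p ∧
    (∀ p, IsVariationalDerivative (Lp p) (P p)) ∧
    (∀ p, IsDerivationAlong p (hamiltonianField g (P p)) O (Op p)) ∧ O' = ∑ p, Op p

/-! ### Current observables -/

/-- The space of current observables `∮_C 𝒥_L^{(1)}`, as formal functions on the fields annihilated
by `∂̄`. -/
def CurrentSpace (I : Type*) : Submodule ℂ (OnShellObs I) :=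
  LinearMap.range (restrict ∘ₗ currentObs (I := I))

/-- The current observable of `L`. -/
def current : SuperSeries I →ₗ[ℂ] CurrentSpace I :=
  LinearMap.rangeRestrict (restrict ∘ₗ currentObs)

/-- The current observables of parity `p`. -/
def currentParity (I : Type*) (p : ZMod 2) : Submodule ℂ (CurrentSpace I) :=
  (seriesParity I p).map current

/-- `D` is the map `∮_C 𝒥_L^{(1)} ↦ ∮_C 𝒥_{δL}^{(1)}`. -/
def IsInducedDifferential (D : CurrentSpace I → CurrentSpace I) : Prop :=
  ∀ L : SuperSeries I, D (current L) = current (delta L)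

/-- `br` is the map
`(∮_C 𝒥_{L₁}^{(1)}, ∮_C 𝒥_{L₂}^{(1)}) ↦ {∫_{ℂˣ} 𝒥_{L₁}^{(2)}, ∮_C 𝒥_{L₂}^{(1)}}_BV`. -/
def IsInducedBracket [Fintype I] [DecidableEq I] (g : Matrix I I ℂ)
    (br : CurrentSpace I → CurrentSpace I → CurrentSpace I) : Prop :=
  ∀ L₁ L₂ : SuperSeries I, ∃ O : Obs I, IsBVBracket g L₁ (currentObs L₂) O ∧
    (br (current L₁) (current L₂) : OnShellObs I) = restrict O

end SuperPoly

/-- Differential `ℤ/2`-graded Lie algebras over `ℂ`. -/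
structure IsDGLieSuperalgebra {V : Type*} [AddCommGroup V] [Module ℂ V]
    (par : ZMod 2 → Submodule ℂ V) (D : V → V) (br : V → V → V) : Prop where
  isInternal : DirectSum.IsInternal par
  isLinearMap_D : IsLinearMap ℂ D
  isLinearMap_left : ∀ b, IsLinearMap ℂ fun a => br a b
  isLinearMap_right : ∀ a, IsLinearMap ℂ (br a)
  D_mem : ∀ p, ∀ a ∈ par p, D a ∈ par (p + 1)
  br_mem : ∀ p q, ∀ a ∈ par p, ∀ b ∈ par q, br a b ∈ par (p + q)
  D_D : ∀ a, D (D a) = 0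
  skew : ∀ p q, ∀ a ∈ par p, ∀ b ∈ par q, br a b = -(koszul p q • br b a)
  jacobi : ∀ p q, ∀ a ∈ par p, ∀ b ∈ par q, ∀ c,
    br a (br b c) = br (br a b) c + koszul p q • br b (br a c)
  leibniz : ∀ p, ∀ a ∈ par p, ∀ b,
    D (br a b) = br (D a) b + ((-1 : ℂ) ^ p.val) • br a (D b)

end BCOV

/-! ### Algebra of the symbols: derivations, variational derivative, parity and degree. -/

namespace BCOV

variable {I : Type*}

/-! ### Derivations of the polynomial algebra -/

/-! The bracket is computed by an explicit operation on the differential ring, its identities are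
proved there modulo `∂_z`-exact elements, and everything is then pushed down to current observables.

Representation. Integration by parts on compactly supported fields shows that the Euler operator `∑
(-∂_z)^m ∂/∂(∂_z^m λ^α_0)` gives a variational derivative (`isVariationalDerivative_eulerSeries`).
Any other one has the same values on all fields, by nondegeneracy of the integration pairing and a
cutoff argument (`IsVariationalDerivative.evalField_eq`). Hence the BV bracket of a local functional
with a current is a single well-defined function, namely the current of `seriesBracket g⁻¹ L M`,
where `M` is differentiated along the evolutionary vector field `X_L = -g⁻¹ ∂_z E(L)`
(`isInducedBracket_iff`).

Lie identities. A total derivative has zero current on fields annihilated by `∂̄`, because `∂_z =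
∂_x - ∂_{z̄}` and the period of `∂_x f` is zero. It therefore suffices to work modulo total
derivatives. There, `{x, y}` becomes `∑ X_x E(y)`, and skew symmetry says that `g⁻¹ ∂_z` is
skew-adjoint. For the Jacobi identity each double bracket is a difference of two second variations,
`{x,{y,z}} ≡ Hess_z(X_x, X_y) ∓ Hess_y(X_z, X_x)` (`polyBracket_polyBracket`), and the six terms
cancel because Hessians are graded symmetric. The differential commutes with `∂_z` and with all
`∂/∂(∂_z^m λ^α_0)`, so it is a derivation of the bracket on the nose (`deltaPoly_polyBracket`).

Descent. The kernel of `L ↦ ∮ L` is handled directly, without identifying it with the total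
derivatives. Both `δ` and the bracket in its second argument are first variations along vector
fields that preserve the linear space of fields annihilated by `∂̄`; a function vanishing on that
space has zero variation there (`formCircleInt_variation`). For the first argument, varying `λ^α_0`
by `e^{2πikz}` shows that every Fourier coefficient of the holomorphic function `E_α(L)` is zero on
the circle, so `E_α(L)` vanishes modulo `dz̄` by the identity theorem (`bodyPart_euler`), and with
it the Hamiltonian vector field.

Odd vector fields are made even by a factor `η` of Grassmann parameters. Nothing is lost, since an
element of the Grassmann algebra involves finitely many of the infinitely many `θ_j` and can be
recovered from its product with an unused one. -/

theorem zmod_two_cases (p : ZMod 2) : p = 0 ∨ p = 1 := by revert p; decide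

theorem neg_one_pow_val_add (p q : ZMod 2) :
    (-1 : ℂ) ^ (p + q).val = (-1) ^ p.val * (-1) ^ q.val := by
  have h2 : (1 + 1 : ZMod 2) = 0 := rfl
  rcases zmod_two_cases p with rfl | rfl <;> rcases zmod_two_cases q with rfl | rfl <;>
    simp [ZMod.val_one, h2]

theorem koszul_swap (p q : ZMod 2) : koszul p q = koszul q p := by
  rw [koszul, koszul, mul_comm]

theorem koszul_mul_self (p q : ZMod 2) : koszul p q * koszul p q = 1 := by
  rw [koszul, ← mul_pow, neg_one_mul, neg_neg, one_pow]

theorem koszul_zero_left (p : ZMod 2) : koszul 0 p = 1 := by simp [koszul]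

theorem koszul_zero_right (p : ZMod 2) : koszul p 0 = 1 := by simp [koszul]

theorem koszul_add_left (p q r : ZMod 2) : koszul (p + q) r = koszul p r * koszul q r := by
  have h2 : (1 + 1 : ZMod 2) = 0 := rfl
  rcases zmod_two_cases p with rfl | rfl <;> rcases zmod_two_cases q with rfl | rfl <;>
    rcases zmod_two_cases r with rfl | rfl <;> simp [koszul, ZMod.val_one, h2]

theorem koszul_add_right (p q r : ZMod 2) : koszul p (q + r) = koszul p q * koszul p r := by
  rw [koszul_swap, koszul_add_left, koszul_swap q, koszul_swap r]

theorem SuperPoly.induction {C : SuperPoly I → Prop} (algebraMap : ∀ r : ℂ, C (algebraMap ℂ _ r))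
    (gen : ∀ a, C (gen a)) (mul : ∀ x y, C x → C y → C (x * y))
    (add : ∀ x y, C x → C y → C (x + y)) (x : SuperPoly I) : C x := by
  obtain ⟨y, rfl⟩ := RingQuot.mkAlgHom_surjective ℂ (SuperRel I) x
  induction y using FreeAlgebra.induction with
  | grade0 r => rw [AlgHom.commutes]; exact algebraMap r
  | grade1 a => exact gen a
  | mul a b ha hb => rw [map_mul]; exact mul _ _ ha hb
  | add a b ha hb => rw [map_add]; exact add _ _ ha hb

theorem SuperPoly.algHom_ext {B : Type*} [Ring B] [Algebra ℂ B] {f g : SuperPoly I →ₐ[ℂ] B}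
    (h : ∀ a, f (gen a) = g (gen a)) : f = g := by
  refine AlgHom.ext fun x => ?_
  induction x using SuperPoly.induction with
  | algebraMap r => rw [AlgHom.commutes, AlgHom.commutes]
  | gen a => exact h a
  | mul x y hx hy => rw [map_mul, map_mul, hx, hy]
  | add x y hx hy => rw [map_add, map_add, hx, hy]

theorem monom_nil : monom ([] : List (Gen I)) = 1 := rfl

theorem monom_cons (a : Gen I) (w : List (Gen I)) : monom (a :: w) = gen a * monom w := by
  simp [monom]

theorem monom_append (v w : List (Gen I)) : monom (v ++ w) = monom v * monom w := by
  simp [monom]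

theorem span_monom : Submodule.span ℂ (Set.range (monom (I := I))) = ⊤ := by
  refine Submodule.eq_top_iff'.2 fun x => ?_
  induction x using SuperPoly.induction with
  | algebraMap r =>
    rw [Algebra.algebraMap_eq_smul_one]
    exact Submodule.smul_mem _ _ (Submodule.subset_span ⟨[], rfl⟩)
  | gen a => exact Submodule.subset_span ⟨[a], by simp [monom]⟩
  | add x y hx hy => exact Submodule.add_mem _ hx hy
  | mul x y hx hy =>
    refine Submodule.span_induction₂ (p := fun x y _ _ => x * y ∈ Submodule.span ℂ _)
      ?_ ?_ ?_ ?_ ?_ ?_ ?_ hx hy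
    · rintro _ _ ⟨v, rfl⟩ ⟨w, rfl⟩
      exact Submodule.subset_span ⟨v ++ w, monom_append v w⟩
    · intro y _; rw [zero_mul]; exact Submodule.zero_mem _
    · intro y _; rw [mul_zero]; exact Submodule.zero_mem _
    · intro x y z _ _ _ h h'; rw [add_mul]; exact Submodule.add_mem _ h h'
    · intro x y z _ _ _ h h'; rw [mul_add]; exact Submodule.add_mem _ h h'
    · intro r x y _ _ h; rw [smul_mul_assoc]; exact Submodule.smul_mem _ _ h
    · intro r x y _ _ h; rw [mul_smul_comm]; exact Submodule.smul_mem _ _ h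

/-- Two linear maps that agree on monomials are equal. -/
theorem SuperPoly.linearMap_ext {B : Type*} [AddCommGroup B] [Module ℂ B]
    {f g : SuperPoly I →ₗ[ℂ] B} (h : ∀ w, f (monom w) = g (monom w)) : f = g :=
  LinearMap.ext_on_range span_monom h

/-- Even derivations. -/
def IsDer (d : SuperPoly I →ₗ[ℂ] SuperPoly I) : Prop :=
  ∀ x y, d (x * y) = d x * y + x * d y

namespace IsDer

variable {d e : SuperPoly I →ₗ[ℂ] SuperPoly I}

theorem map_one (hd : IsDer d) : d 1 = 0 := by
  have h := hd 1 1
  rw [mul_one, mul_one, one_mul] at h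
  exact left_eq_add.1 h

theorem ext (hd : IsDer d) (he : IsDer e) (h : ∀ a, d (gen a) = e (gen a)) : d = e := by
  refine SuperPoly.linearMap_ext fun w => ?_
  induction w with
  | nil => rw [monom_nil, hd.map_one, he.map_one]
  | cons a w ih => rw [monom_cons, hd, he, h, ih]

theorem zero : IsDer (0 : SuperPoly I →ₗ[ℂ] SuperPoly I) := fun x y => by simp

/-- Together with `IsDer.ext` this reduces every commutation relation between even derivations to a
check on symbols. -/
theorem commutator (hd : IsDer d) (he : IsDer e) : IsDer (d ∘ₗ e - e ∘ₗ d) := fun x y => by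
  simp only [LinearMap.sub_apply, LinearMap.comp_apply, he x y, hd x y, map_add, hd (e x) y,
    hd x (e y), he (d x) y, he x (d y), sub_mul, mul_sub]
  abel

end IsDer

/-- The parity-preserving maps on symbols. -/
def IsEvenMap (f : Gen I → SuperPoly I) : Prop :=
  ∀ a b, f a * gen b = koszul a.parity b.parity • (gen b * f a)

/-- The homomorphism `x ↦ x + ε d x` given by an even derivation `d`. -/
def evenDerHom (f : Gen I → SuperPoly I) (hf : IsEvenMap f) :
    SuperPoly I →ₐ[ℂ] TrivSqZeroExt (SuperPoly I) (SuperPoly I) :=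
  liftGen (fun a => TrivSqZeroExt.inl (gen a) + TrivSqZeroExt.inr (f a)) fun a b => by
    have h : gen a * f b = koszul a.parity b.parity • (f b * gen a) := by
      rw [hf b a, koszul_swap, smul_smul, koszul_mul_self, one_smul]
    refine TrivSqZeroExt.ext ?_ ?_
    · simpa using gen_comm a b
    · simp only [TrivSqZeroExt.snd_mul, TrivSqZeroExt.snd_smul, TrivSqZeroExt.fst_add,
        TrivSqZeroExt.snd_add, TrivSqZeroExt.fst_inl, TrivSqZeroExt.snd_inl,
        TrivSqZeroExt.fst_inr, TrivSqZeroExt.snd_inr, add_zero, zero_add, smul_eq_mul,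
        op_smul_eq_mul]
      rw [h, hf a b, smul_add, add_comm]

theorem evenDerHom_fst (f : Gen I → SuperPoly I) (hf : IsEvenMap f) (x : SuperPoly I) :
    (evenDerHom f hf x).fst = x := by
  have h : (TrivSqZeroExt.fstHom ℂ (SuperPoly I) (SuperPoly I)).comp (evenDerHom f hf) =
      AlgHom.id ℂ _ := SuperPoly.algHom_ext fun a => by
    change (evenDerHom f hf (gen a)).fst = gen a
    rw [evenDerHom, liftGen_gen]
    simp
  exact DFunLike.congr_fun h x

/-- The even derivation with given values on symbols. -/
def evenDer (f : Gen I → SuperPoly I) (hf : IsEvenMap f) : SuperPoly I →ₗ[ℂ] SuperPoly I  where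
  toFun x := (evenDerHom f hf x).snd
  map_add' x y := by rw [map_add, TrivSqZeroExt.snd_add]
  map_smul' c x := by rw [map_smul, TrivSqZeroExt.snd_smul, RingHom.id_apply]

theorem evenDer_gen (f : Gen I → SuperPoly I) (hf : IsEvenMap f) (a : Gen I) :
    evenDer f hf (gen a) = f a := by
  change (evenDerHom f hf (gen a)).snd = f a
  rw [evenDerHom, liftGen_gen]
  simp

theorem isDer_evenDer (f : Gen I → SuperPoly I) (hf : IsEvenMap f) : IsDer (evenDer f hf) := by
  intro x y
  change (evenDerHom f hf (x * y)).snd = _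
  rw [map_mul, TrivSqZeroExt.snd_mul, evenDerHom_fst, evenDerHom_fst, add_comm]
  rfl

/-- The values of `∂_z` on symbols. -/
def totalGen : Gen I → Gen I
  | .lam α k m => .lam α k (m + 1)
  | .rho α k m => .rho α k (m + 1)

theorem parity_totalGen (a : Gen I) : (totalGen a).parity = a.parity := by cases a <;> rfl

/-- The derivation `∂_z`. -/
def totalDer : SuperPoly I →ₗ[ℂ] SuperPoly I :=
  evenDer (fun a => gen (totalGen a)) fun a b => by rw [gen_comm, parity_totalGen]

theorem totalDer_gen (a : Gen I) : totalDer (gen a) = gen (totalGen a) := evenDer_gen _ _ a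

theorem isDer_totalDer : IsDer (totalDer (I := I)) := isDer_evenDer _ _

open Classical in
/-- The values of `∂ / ∂(∂_z^m λ^α_0)` on symbols, where `j = (α, m)`. -/
def partialGen (j : I × ℕ) (a : Gen I) : SuperPoly I := if a = .lam j.1 0 j.2 then 1 else 0

theorem isEvenMap_partialGen (j : I × ℕ) : IsEvenMap (partialGen j) := by
  intro a b
  by_cases h : a = .lam j.1 0 j.2
  · subst h
    simp [partialGen, Gen.parity, koszul]
  · simp [partialGen, h]

/-- The derivation `∂ / ∂(∂_z^m λ^α_0)`, where `j = (α, m)`. -/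
def partialDer (j : I × ℕ) : SuperPoly I →ₗ[ℂ] SuperPoly I :=
  evenDer (partialGen j) (isEvenMap_partialGen j)

theorem partialDer_gen (j : I × ℕ) (a : Gen I) : partialDer j (gen a) = partialGen j a :=
  evenDer_gen _ _ a

theorem isDer_partialDer (j : I × ℕ) : IsDer (partialDer j) := isDer_evenDer _ _

theorem IsDer.map_partialGen {d : SuperPoly I →ₗ[ℂ] SuperPoly I} (hd : IsDer d) (j : I × ℕ)
    (a : Gen I) : d (partialGen j a) = 0 := by
  rw [partialGen]
  split_ifs
  · exact hd.map_one
  · exact map_zero d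

theorem partialDer_comm (i j : I × ℕ) (x : SuperPoly I) :
    partialDer i (partialDer j x) = partialDer j (partialDer i x) := by
  have h := ((isDer_partialDer i).commutator (isDer_partialDer j)).ext IsDer.zero fun a => by
    simp [partialDer_gen, (isDer_partialDer _).map_partialGen]
  exact sub_eq_zero.1 (DFunLike.congr_fun h x)

/-- The relation `[∂/∂λ^{(m+1)}, ∂_z] = ∂/∂λ^{(m)}`: both sides are derivations, and on symbols it
says that `∂_z` sends only `λ^{(m)}` to `λ^{(m+1)}`. -/
theorem partialDer_totalDer_succ (α : I) (m : ℕ) (x : SuperPoly I) :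
    partialDer (α, m + 1) (totalDer x) =
      totalDer (partialDer (α, m + 1) x) + partialDer (α, m) x := by
  have h := ((isDer_partialDer (α, m + 1)).commutator isDer_totalDer).ext
    (isDer_partialDer (α, m)) fun a => by
      simp only [LinearMap.sub_apply, LinearMap.comp_apply, totalDer_gen, partialDer_gen,
        isDer_totalDer.map_partialGen, sub_zero]
      rcases a with ⟨β, k, n⟩ | ⟨β, k, n⟩
      · have h : totalGen (.lam β k n) = .lam α 0 (m + 1) ↔ Gen.lam β k n = .lam α 0 m := by
          simp [totalGen]
        by_cases h' : Gen.lam β k n = .lam α 0 m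
        · exact (if_pos (h.2 h')).trans (if_pos h').symm
        · exact (if_neg (mt h.1 h')).trans (if_neg h').symm
      · simp [partialGen, totalGen]
  have h2 := DFunLike.congr_fun h x
  rw [← h2]
  simp

theorem partialDer_totalDer_zero (α : I) (x : SuperPoly I) :
    partialDer (α, 0) (totalDer x) = totalDer (partialDer (α, 0) x) := by
  have h := ((isDer_partialDer (α, 0)).commutator isDer_totalDer).ext IsDer.zero fun a => by
      simp only [LinearMap.sub_apply, LinearMap.comp_apply, totalDer_gen, partialDer_gen,
        isDer_totalDer.map_partialGen, sub_zero]
      rcases a with ⟨β, k, n⟩ | ⟨β, k, n⟩ <;> simp [partialGen, totalGen]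
  exact sub_eq_zero.1 (DFunLike.congr_fun h x)

/-- A polynomial involves finitely many symbols. This turns the formally infinite sums in `evo` and
`euler` into finitely supported ones. -/
theorem partialDer_finite (x : SuperPoly I) : {j | partialDer j x ≠ 0}.Finite := by
  induction x using SuperPoly.induction with
  | algebraMap r =>
    simp [Algebra.algebraMap_eq_smul_one, (isDer_partialDer _).map_one]
  | gen a =>
    rcases a with ⟨α, k, m⟩ | ⟨α, k, m⟩
    · refine (Set.finite_singleton (α, m)).subset fun j hj => ?_
      by_contra hne
      refine hj ?_
      rw [partialDer_gen, partialGen, if_neg]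
      intro h
      injection h with h1 h2 h3
      exact hne (Prod.ext h1.symm h3.symm)
    · simp [partialDer_gen, partialGen]
  | mul x y hx hy =>
    refine (hx.union hy).subset fun j hj => ?_
    by_contra hne
    simp only [Set.mem_union, Set.mem_ofPred_eq, not_or, not_not] at hne
    exact hj (by rw [isDer_partialDer, hne.1, hne.2, zero_mul, mul_zero, add_zero])
  | add x y hx hy =>
    refine (hx.union hy).subset fun j hj => ?_
    by_contra hne
    simp only [Set.mem_union, Set.mem_ofPred_eq, not_or, not_not] at hne
    exact hj (by rw [map_add, hne.1, hne.2, add_zero])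

/-- The differential of a polynomial with respect to the symbols `∂_z^m λ^α_0`. -/
def gradient : SuperPoly I →ₗ[ℂ] (I × ℕ →₀ SuperPoly I) where
  toFun x := Finsupp.ofSupportFinite (fun j => partialDer j x) (partialDer_finite x)
  map_add' x y := Finsupp.ext fun j => map_add (partialDer j) x y
  map_smul' c x := Finsupp.ext fun j => map_smul (partialDer j) c x

/-- Pairing of the differential with a family of operators, as a finite sum. -/
theorem lsum_gradient {B : Type*} [AddCommGroup B] [Module ℂ B]
    (f : I × ℕ → SuperPoly I →ₗ[ℂ] B) {x : SuperPoly I} {s : Finset (I × ℕ)}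
    (hs : ∀ j, j ∉ s → partialDer j x = 0) :
    Finsupp.lsum ℂ f (gradient x) = ∑ j ∈ s, f j (partialDer j x) := by
  rw [Finsupp.lsum_apply]
  refine Finsupp.sum_of_support_subset _ (fun j hj => ?_) _ fun j _ => map_zero _
  by_contra h
  exact (Finsupp.mem_support_iff.1 hj) (hs j h)

theorem exists_finset_partialDer (x : SuperPoly I) :
    ∃ s : Finset (I × ℕ), ∀ j, j ∉ s → partialDer j x = 0 :=
  ⟨(partialDer_finite x).toFinset, fun j hj => by simpa using hj⟩

/-- The evolutionary derivation `∑ (∂_z^m X^α) ∂ / ∂(∂_z^m λ^α_0)`. -/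
def evo (X : I → SuperPoly I) : SuperPoly I →ₗ[ℂ] SuperPoly I :=
  Finsupp.lsum ℂ (fun j : I × ℕ => LinearMap.mulLeft ℂ ((totalDer ^ j.2) (X j.1))) ∘ₗ gradient

/-- Any index set containing the support may be used, so that sums for different polynomials can be
compared over a common one. -/
theorem evo_eq_sum (X : I → SuperPoly I) {x : SuperPoly I} {s : Finset (I × ℕ)}
    (hs : ∀ j, j ∉ s → partialDer j x = 0) :
    evo X x = ∑ j ∈ s, (totalDer ^ j.2) (X j.1) * partialDer j x := lsum_gradient _ hs

open Classical in
/-- The variational derivative `∑ (-∂_z)^m ∂ / ∂(∂_z^m λ^α_0)`. -/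
def euler (α : I) : SuperPoly I →ₗ[ℂ] SuperPoly I :=
  Finsupp.lsum ℂ (fun j : I × ℕ => if j.1 = α then (-totalDer) ^ j.2 else 0) ∘ₗ gradient

open Classical in
theorem euler_eq_sum (α : I) {x : SuperPoly I} {s : Finset (I × ℕ)}
    (hs : ∀ j, j ∉ s → partialDer j x = 0) :
    euler α x = ∑ j ∈ s, if j.1 = α then ((-totalDer) ^ j.2) (partialDer j x) else 0 := by
  refine (lsum_gradient _ hs).trans (Finset.sum_congr rfl fun j _ => ?_)
  split_ifs <;> rfl

theorem totalDer_pow_succ (m : ℕ) (x : SuperPoly I) :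
    totalDer ((totalDer ^ m) x) = (totalDer ^ (m + 1)) x := by
  rw [pow_succ']; rfl

/-- Evolutionary derivations commute with `∂_z`. -/
theorem evo_totalDer [Fintype I] (X : I → SuperPoly I) (x : SuperPoly I) :
    evo X (totalDer x) = totalDer (evo X x) := by
  classical
  obtain ⟨s, hs⟩ := exists_finset_partialDer x
  obtain ⟨N, hN⟩ : ∃ N, ∀ j ∈ s, j.2 < N :=
    ⟨s.sup Prod.snd + 1, fun j hj => Nat.lt_succ_of_le (Finset.le_sup (f := Prod.snd) hj)⟩
  have h0 : ∀ α m, N ≤ m → partialDer (α, m) x = 0 := fun α m hm =>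
    hs _ fun h => absurd (hN _ h) (not_lt.2 hm)
  have h1 : ∀ M, N ≤ M → ∀ y, (∀ α m, M ≤ m → partialDer (α, m) y = 0) →
      evo X y = ∑ α, ∑ m ∈ Finset.range M, (totalDer ^ m) (X α) * partialDer (α, m) y := by
    intro M _ y hy
    rw [evo_eq_sum X (s := Finset.univ ×ˢ Finset.range M), Finset.sum_product]
    rintro ⟨α, m⟩ hj
    exact hy α m (by simpa using hj)
  rw [h1 (N + 1) (Nat.le_succ N) (totalDer x), h1 N le_rfl x h0, map_sum]
  · refine Finset.sum_congr rfl fun α _ => ?_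
    -- Once `m = 0` is split off, the commutator of `∂/∂λ^{(m+1)}` with `∂_z` produces the two
    -- halves of the product rule, up to a shift of the range.
    rw [Finset.sum_range_succ', partialDer_totalDer_zero]
    simp only [partialDer_totalDer_succ, mul_add, Finset.sum_add_distrib, map_sum,
      isDer_totalDer _ _, totalDer_pow_succ]
    have h2 := Finset.sum_range_succ'
      (fun m => (totalDer ^ m) (X α) * totalDer (partialDer (α, m) x)) N
    -- The top term `m = N` is zero, so the shift of the range costs nothing.
    rw [Finset.sum_range_succ, h0 α N le_rfl, map_zero, mul_zero, add_zero] at h2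
    rw [h2]
    abel
  · intro α m hm
    obtain ⟨m, rfl⟩ : ∃ k, m = k + 1 := ⟨m - 1, by omega⟩
    rw [partialDer_totalDer_succ, h0 α _ (by omega), h0 α m (by omega), map_zero, add_zero]

theorem evo_totalDer_pow [Fintype I] (X : I → SuperPoly I) (m : ℕ) (x : SuperPoly I) :
    evo X ((totalDer ^ m) x) = (totalDer ^ m) (evo X x) := by
  induction m with
  | zero => rfl
  | succ m ih => rw [← totalDer_pow_succ, evo_totalDer, ih, totalDer_pow_succ]

theorem neg_totalDer_pow (m : ℕ) (x : SuperPoly I) :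
    ((-totalDer) ^ m) x = (-1 : ℂ) ^ m • (totalDer ^ m) x := by
  induction m with
  | zero => simp
  | succ m ih =>
    rw [pow_succ', Module.End.mul_apply, ih, LinearMap.neg_apply, map_smul, totalDer_pow_succ,
      pow_succ']
    module

theorem evo_neg_totalDer_pow [Fintype I] (X : I → SuperPoly I) (m : ℕ) (x : SuperPoly I) :
    evo X (((-totalDer) ^ m) x) = ((-totalDer) ^ m) (evo X x) := by
  rw [neg_totalDer_pow, neg_totalDer_pow, map_smul, evo_totalDer_pow]

theorem evo_add (X Y : I → SuperPoly I) (x : SuperPoly I) :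
    evo (X + Y) x = evo X x + evo Y x := by
  obtain ⟨s, hs⟩ := exists_finset_partialDer x
  simp only [evo_eq_sum _ hs, Pi.add_apply, map_add, add_mul, Finset.sum_add_distrib]

theorem evo_smul (c : ℂ) (X : I → SuperPoly I) (x : SuperPoly I) :
    evo (c • X) x = c • evo X x := by
  obtain ⟨s, hs⟩ := exists_finset_partialDer x
  simp only [evo_eq_sum _ hs, Pi.smul_apply, map_smul, smul_mul_assoc, Finset.smul_sum]

/-- Evolutionary derivations satisfy the Leibniz rule up to the order of the factors. -/
theorem evo_mul (X : I → SuperPoly I) {x y : SuperPoly I} {s : Finset (I × ℕ)}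
    (hy : ∀ j, j ∉ s → partialDer j y = 0) :
    evo X (x * y) = evo X x * y +
      ∑ j ∈ s, (totalDer ^ j.2) (X j.1) * (x * partialDer j y) := by
  classical
  obtain ⟨t, ht⟩ := exists_finset_partialDer x
  have h1 : ∀ j, j ∉ t ∪ s → partialDer j (x * y) = 0 := fun j hj => by
    rw [Finset.mem_union, not_or] at hj
    rw [isDer_partialDer, ht j hj.1, hy j hj.2, zero_mul, mul_zero, add_zero]
  have h2 : ∀ j, j ∉ t ∪ s → partialDer j x = 0 := fun j hj =>
    ht j fun h => hj (Finset.mem_union_left _ h)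
  have h3 : ∑ j ∈ s, (totalDer ^ j.2) (X j.1) * (x * partialDer j y) =
      ∑ j ∈ t ∪ s, (totalDer ^ j.2) (X j.1) * (x * partialDer j y) :=
    Finset.sum_subset Finset.subset_union_right fun j _ hj => by
      rw [hy j hj, mul_zero, mul_zero]
  rw [evo_eq_sum X h1, evo_eq_sum X h2, Finset.sum_mul, h3, ← Finset.sum_add_distrib]
  exact Finset.sum_congr rfl fun j _ => by rw [isDer_partialDer]; noncomm_ring

/-! ### Parity and degree -/

@[elab_as_elim]
theorem parityPart_induction {p : ZMod 2} {C : SuperPoly I → Prop} {x : SuperPoly I}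
    (hx : x ∈ parityPart I p) (zero : C 0) (add : ∀ x y, C x → C y → C (x + y))
    (smul : ∀ (c : ℂ) x, C x → C (c • x))
    (monom : ∀ w : List (Gen I), (w.map Gen.parity).sum = p → C (monom w)) : C x := by
  induction hx using Submodule.span_induction with
  | mem x hx => obtain ⟨w, hw, rfl⟩ := hx; exact monom w hw
  | zero => exact zero
  | add x y _ _ hx hy => exact add x y hx hy
  | smul c x _ hx => exact smul c x hx

@[elab_as_elim]
theorem homog_induction {d : ℕ} {C : SuperPoly I → Prop} {x : SuperPoly I}
    (hx : x ∈ homog I d) (zero : C 0) (add : ∀ x y, C x → C y → C (x + y))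
    (smul : ∀ (c : ℂ) x, C x → C (c • x))
    (monom : ∀ w : List (Gen I), w.length = d → C (monom w)) : C x := by
  induction hx using Submodule.span_induction with
  | mem x hx => obtain ⟨w, hw, rfl⟩ := hx; exact monom w hw
  | zero => exact zero
  | add x y _ _ hx hy => exact add x y hx hy
  | smul c x _ hx => exact smul c x hx

theorem monom_mem_parityPart (w : List (Gen I)) :
    monom w ∈ parityPart I (w.map Gen.parity).sum := Submodule.subset_span ⟨w, rfl, rfl⟩

theorem monom_mem_homog (w : List (Gen I)) : monom w ∈ homog I w.length :=
  Submodule.subset_span ⟨w, rfl, rfl⟩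

theorem gen_mem_parityPart (a : Gen I) : gen a ∈ parityPart I a.parity := by
  simpa [monom] using monom_mem_parityPart [a]

theorem mul_mem_parityPart {p q : ZMod 2} {x y : SuperPoly I} (hx : x ∈ parityPart I p)
    (hy : y ∈ parityPart I q) : x * y ∈ parityPart I (p + q) := by
  refine Submodule.span_induction₂ (p := fun x y _ _ => x * y ∈ parityPart I (p + q))
      ?_ ?_ ?_ ?_ ?_ ?_ ?_ hx hy
  · rintro _ _ ⟨v, rfl, rfl⟩ ⟨w, rfl, rfl⟩
    rw [← monom_append, ← List.sum_append, ← List.map_append]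
    exact monom_mem_parityPart _
  · intro y _; rw [zero_mul]; exact Submodule.zero_mem _
  · intro y _; rw [mul_zero]; exact Submodule.zero_mem _
  · intro x y z _ _ _ h h'; rw [add_mul]; exact Submodule.add_mem _ h h'
  · intro x y z _ _ _ h h'; rw [mul_add]; exact Submodule.add_mem _ h h'
  · intro r x y _ _ h; rw [smul_mul_assoc]; exact Submodule.smul_mem _ _ h
  · intro r x y _ _ h; rw [mul_smul_comm]; exact Submodule.smul_mem _ _ h

theorem mul_mem_homog {d e : ℕ} {x y : SuperPoly I} (hx : x ∈ homog I d)
    (hy : y ∈ homog I e) : x * y ∈ homog I (d + e) := by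
  refine Submodule.span_induction₂ (p := fun x y _ _ => x * y ∈ homog I (d + e))
      ?_ ?_ ?_ ?_ ?_ ?_ ?_ hx hy
  · rintro _ _ ⟨v, rfl, rfl⟩ ⟨w, rfl, rfl⟩
    rw [← monom_append, ← List.length_append]
    exact monom_mem_homog _
  · intro y _; rw [zero_mul]; exact Submodule.zero_mem _
  · intro y _; rw [mul_zero]; exact Submodule.zero_mem _
  · intro x y z _ _ _ h h'; rw [add_mul]; exact Submodule.add_mem _ h h'
  · intro x y z _ _ _ h h'; rw [mul_add]; exact Submodule.add_mem _ h h'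
  · intro r x y _ _ h; rw [smul_mul_assoc]; exact Submodule.smul_mem _ _ h
  · intro r x y _ _ h; rw [mul_smul_comm]; exact Submodule.smul_mem _ _ h

theorem monom_comm (v w : List (Gen I)) :
    monom v * monom w =
      koszul (v.map Gen.parity).sum (w.map Gen.parity).sum • (monom w * monom v) := by
  have key : ∀ (a : Gen I) (w : List (Gen I)),
      gen a * monom w = koszul a.parity (w.map Gen.parity).sum • (monom w * gen a) := by
    intro a w
    induction w with
    | nil => simp [monom, koszul]
    | cons b w ih =>
      rw [monom_cons, ← mul_assoc, gen_comm, smul_mul_assoc, mul_assoc, ih, List.map_cons,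
        List.sum_cons, koszul_add_right, mul_smul_comm, smul_smul, mul_assoc]
  induction v with
  | nil => simp [monom, koszul]
  | cons a v ih =>
    rw [monom_cons, mul_assoc, ih, mul_smul_comm, ← mul_assoc, key, smul_mul_assoc, smul_smul,
      List.map_cons, List.sum_cons, koszul_add_left, mul_assoc, mul_comm (koszul _ _)]

/-- Graded commutativity. -/
theorem superPoly_comm {p q : ZMod 2} {x y : SuperPoly I} (hx : x ∈ parityPart I p)
    (hy : y ∈ parityPart I q) : x * y = koszul p q • (y * x) := by
  refine Submodule.span_induction₂ (p := fun x y _ _ => x * y = koszul p q • (y * x))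
      ?_ ?_ ?_ ?_ ?_ ?_ ?_ hx hy
  · rintro _ _ ⟨v, rfl, rfl⟩ ⟨w, rfl, rfl⟩
    exact monom_comm v w
  · intro y _; simp
  · intro y _; simp
  · intro x y z _ _ _ h h'; rw [add_mul, mul_add, h, h', smul_add]
  · intro x y z _ _ _ h h'; rw [add_mul, mul_add, h, h', smul_add]
  · intro r x y _ _ h; rw [smul_mul_assoc, mul_smul_comm, h, smul_comm]
  · intro r x y _ _ h; rw [smul_mul_assoc, mul_smul_comm, h, smul_comm]

theorem IsDer.mem_parityPart {d : SuperPoly I →ₗ[ℂ] SuperPoly I} (hd : IsDer d)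
    (h : ∀ a, d (gen a) ∈ parityPart I a.parity) {p : ZMod 2} {x : SuperPoly I}
    (hx : x ∈ parityPart I p) : d x ∈ parityPart I p := by
  refine parityPart_induction hx ?_ ?_ ?_ ?_
  · rw [_root_.map_zero]; exact Submodule.zero_mem _
  · intro x y hx hy; rw [map_add]; exact Submodule.add_mem _ hx hy
  · intro c x hx; rw [map_smul]; exact Submodule.smul_mem _ _ hx
  · rintro w rfl
    clear hx
    induction w with
    | nil => rw [monom_nil, hd.map_one]; exact Submodule.zero_mem _
    | cons a w ih =>
      rw [monom_cons, hd, List.map_cons, List.sum_cons]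
      exact Submodule.add_mem _ (mul_mem_parityPart (h a) (monom_mem_parityPart w))
        (mul_mem_parityPart (gen_mem_parityPart a) ih)

theorem totalDer_mem_parityPart {p : ZMod 2} {x : SuperPoly I} (hx : x ∈ parityPart I p) :
    totalDer x ∈ parityPart I p :=
  isDer_totalDer.mem_parityPart (fun a => by
    rw [totalDer_gen, ← parity_totalGen]; exact gen_mem_parityPart _) hx

theorem partialDer_mem_parityPart (j : I × ℕ) {p : ZMod 2} {x : SuperPoly I}
    (hx : x ∈ parityPart I p) : partialDer j x ∈ parityPart I p :=
  (isDer_partialDer j).mem_parityPart (fun a => by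
    rw [partialDer_gen, partialGen]
    split_ifs with h
    · subst h; exact monom_mem_parityPart []
    · exact Submodule.zero_mem _) hx

theorem totalDer_pow_mem_parityPart (m : ℕ) {p : ZMod 2} {x : SuperPoly I}
    (hx : x ∈ parityPart I p) : (totalDer ^ m) x ∈ parityPart I p := by
  induction m with
  | zero => exact hx
  | succ m ih => rw [← totalDer_pow_succ]; exact totalDer_mem_parityPart ih

theorem euler_mem_parityPart (α : I) {p : ZMod 2} {x : SuperPoly I}
    (hx : x ∈ parityPart I p) : euler α x ∈ parityPart I p := by
  obtain ⟨s, hs⟩ := exists_finset_partialDer x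
  rw [euler_eq_sum α hs]
  refine Submodule.sum_mem _ fun j _ => ?_
  split_ifs
  · rw [neg_totalDer_pow]
    exact Submodule.smul_mem _ _ (totalDer_pow_mem_parityPart _ (partialDer_mem_parityPart j hx))
  · exact Submodule.zero_mem _

theorem evo_mem_parityPart {X : I → SuperPoly I} {p q : ZMod 2}
    (hX : ∀ α, X α ∈ parityPart I p) {x : SuperPoly I} (hx : x ∈ parityPart I q) :
    evo X x ∈ parityPart I (p + q) := by
  obtain ⟨s, hs⟩ := exists_finset_partialDer x
  rw [evo_eq_sum X hs]
  exact Submodule.sum_mem _ fun j _ => mul_mem_parityPart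
    (totalDer_pow_mem_parityPart _ (hX _)) (partialDer_mem_parityPart j hx)

theorem totalDer_mem_homog {d : ℕ} {x : SuperPoly I} (hx : x ∈ homog I d) :
    totalDer x ∈ homog I d := by
  refine homog_induction hx ?_ ?_ ?_ ?_
  · rw [map_zero]; exact Submodule.zero_mem _
  · intro x y hx hy; rw [map_add]; exact Submodule.add_mem _ hx hy
  · intro c x hx; rw [map_smul]; exact Submodule.smul_mem _ _ hx
  · rintro w rfl
    clear hx
    induction w with
    | nil => rw [monom_nil, isDer_totalDer.map_one]; exact Submodule.zero_mem _
    | cons a w ih =>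
      rw [monom_cons, isDer_totalDer, totalDer_gen, List.length_cons]
      exact Submodule.add_mem _ (gen_mul_mem_homog _ (monom_mem_homog w))
        (gen_mul_mem_homog _ ih)

theorem totalDer_pow_mem_homog (m : ℕ) {d : ℕ} {x : SuperPoly I}
    (hx : x ∈ homog I d) : (totalDer ^ m) x ∈ homog I d := by
  induction m with
  | zero => exact hx
  | succ m ih => rw [← totalDer_pow_succ]; exact totalDer_mem_homog ih

theorem partialDer_homog_zero (j : I × ℕ) {x : SuperPoly I} (hx : x ∈ homog I 0) :
    partialDer j x = 0 := by
  refine homog_induction hx (map_zero _) ?_ ?_ ?_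
  · intro x y hx hy; rw [map_add, hx, hy, add_zero]
  · intro c x hx; rw [map_smul, hx, smul_zero]
  · intro w hw
    rw [List.length_eq_zero_iff.1 hw, monom_nil, (isDer_partialDer j).map_one]

theorem partialDer_mem_homog (j : I × ℕ) {d : ℕ} {x : SuperPoly I} (hx : x ∈ homog I (d + 1)) :
    partialDer j x ∈ homog I d := by
  refine homog_induction hx ?_ ?_ ?_ ?_
  · rw [map_zero]; exact Submodule.zero_mem _
  · intro x y hx hy; rw [map_add]; exact Submodule.add_mem _ hx hy
  · intro c x hx; rw [map_smul]; exact Submodule.smul_mem _ _ hx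
  · clear hx
    intro w hw
    induction w generalizing d with
    | nil => simp at hw
    | cons a w ih =>
      obtain rfl : w.length = d := by simpa using hw
      rw [monom_cons, isDer_partialDer, partialDer_gen]
      refine Submodule.add_mem _ ?_ ?_
      · rw [partialGen]
        split_ifs
        · rw [one_mul]; exact monom_mem_homog w
        · rw [zero_mul]; exact Submodule.zero_mem _
      -- The induction hypothesis needs a word of positive length; on the empty word the derivative
      -- is zero.
      · cases w with
        | nil =>
          rw [monom_nil, (isDer_partialDer j).map_one, mul_zero]
          exact Submodule.zero_mem _
        | cons b w => exact gen_mul_mem_homog a (ih (by simp))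

theorem euler_homog_zero (α : I) {x : SuperPoly I} (hx : x ∈ homog I 0) : euler α x = 0 := by
  rw [euler_eq_sum α (s := ∅) fun j _ => partialDer_homog_zero j hx, Finset.sum_empty]

theorem euler_mem_homog (α : I) {d : ℕ} {x : SuperPoly I} (hx : x ∈ homog I (d + 1)) :
    euler α x ∈ homog I d := by
  obtain ⟨s, hs⟩ := exists_finset_partialDer x
  rw [euler_eq_sum α hs]
  refine Submodule.sum_mem _ fun j _ => ?_
  split_ifs
  · rw [neg_totalDer_pow]
    exact Submodule.smul_mem _ _ (totalDer_pow_mem_homog _ (partialDer_mem_homog j hx))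
  · exact Submodule.zero_mem _

/-- The parity operator on polynomials. -/
def polyParity : SuperPoly I →ₐ[ℂ] SuperPoly I :=
  liftGen (fun a => (-1 : ℂ) ^ a.parity.val • gen a) fun a b => by
    rw [smul_mul_smul_comm, smul_mul_smul_comm, gen_comm, smul_comm, mul_comm ((-1 : ℂ) ^ _)]

theorem polyParity_monom (w : List (Gen I)) :
    polyParity (monom w) = (-1 : ℂ) ^ (w.map Gen.parity).sum.val • monom w := by
  induction w with
  | nil => simp [monom]
  | cons a w ih =>
    rw [monom_cons, map_mul, ih, polyParity, liftGen_gen, smul_mul_smul_comm, List.map_cons,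
      List.sum_cons, neg_one_pow_val_add]

theorem polyParity_of_mem {p : ZMod 2} {x : SuperPoly I} (hx : x ∈ parityPart I p) :
    polyParity x = (-1 : ℂ) ^ p.val • x := by
  refine parityPart_induction hx (by simp) ?_ ?_ ?_
  · intro x y hx hy; rw [map_add, hx, hy, smul_add]
  · intro c x hx; rw [map_smul, hx, smul_comm]
  · rintro w rfl; exact polyParity_monom w

/-- The projection to the part of parity `p`. -/
def parityProj (p : ZMod 2) : SuperPoly I →ₗ[ℂ] SuperPoly I :=
  (1 / 2 : ℂ) • (LinearMap.id + (-1 : ℂ) ^ p.val • polyParity.toLinearMap)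

theorem neg_one_pow_val_eq (p q : ZMod 2) (h : q ≠ p) :
    (-1 : ℂ) ^ p.val * (-1) ^ q.val = -1 := by
  rcases zmod_two_cases p with rfl | rfl <;> rcases zmod_two_cases q with rfl | rfl <;>
    simp_all [ZMod.val_one]

theorem parityProj_of_mem {p : ZMod 2} {x : SuperPoly I} (hx : x ∈ parityPart I p) :
    parityProj p x = x := by
  change (1 / 2 : ℂ) • (x + (-1 : ℂ) ^ p.val • polyParity x) = x
  rw [polyParity_of_mem hx, smul_smul, ← mul_pow, neg_one_mul, neg_neg, one_pow]
  module

theorem parityProj_of_mem_ne {p q : ZMod 2} (hq : q ≠ p) {x : SuperPoly I}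
    (hx : x ∈ parityPart I q) : parityProj p x = 0 := by
  change (1 / 2 : ℂ) • (x + (-1 : ℂ) ^ p.val • polyParity x) = 0
  rw [polyParity_of_mem hx, smul_smul, neg_one_pow_val_eq p q hq]
  module

/-- The projection fixes or kills each monomial, so it preserves any subspace spanned by monomials,
in particular the homogeneous ones. -/
theorem parityProj_monom_mem (p : ZMod 2) (w : List (Gen I)) {S : Submodule ℂ (SuperPoly I)}
    (hS : (w.map Gen.parity).sum = p → monom w ∈ S) : parityProj p (monom w) ∈ S := by
  by_cases h : (w.map Gen.parity).sum = p
  · rw [parityProj_of_mem (h ▸ monom_mem_parityPart w)]; exact hS h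
  · rw [parityProj_of_mem_ne h (monom_mem_parityPart w)]; exact Submodule.zero_mem _

theorem parityProj_mem (p : ZMod 2) (x : SuperPoly I) : parityProj p x ∈ parityPart I p := by
  have hx : x ∈ Submodule.span ℂ (Set.range (monom (I := I))) := by
    rw [span_monom]; exact Submodule.mem_top
  induction hx using Submodule.span_induction with
  | mem x hx =>
    obtain ⟨w, rfl⟩ := hx
    exact parityProj_monom_mem p w fun h => h ▸ monom_mem_parityPart w
  | zero => rw [map_zero]; exact Submodule.zero_mem _
  | add x y _ _ hx hy => rw [map_add]; exact Submodule.add_mem _ hx hy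
  | smul c x _ hx => rw [map_smul]; exact Submodule.smul_mem _ _ hx

theorem parityProj_mem_homog (p : ZMod 2) {d : ℕ} {x : SuperPoly I} (hx : x ∈ homog I d) :
    parityProj p x ∈ homog I d := by
  refine homog_induction hx ?_ ?_ ?_ ?_
  · rw [map_zero]; exact Submodule.zero_mem _
  · intro x y hx hy; rw [map_add]; exact Submodule.add_mem _ hx hy
  · intro c x hx; rw [map_smul]; exact Submodule.smul_mem _ _ hx
  · rintro w rfl; exact parityProj_monom_mem p w fun _ => monom_mem_homog w

theorem sum_zmod_two {B : Type*} [AddCommMonoid B] (f : ZMod 2 → B) : ∑ p, f p = f 0 + f 1 :=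
  Fin.sum_univ_two f

theorem sum_parityProj (x : SuperPoly I) : ∑ p, parityProj p x = x := by
  rw [sum_zmod_two]
  change (1 / 2 : ℂ) • (x + (-1 : ℂ) ^ (0 : ZMod 2).val • polyParity x) +
    (1 / 2 : ℂ) • (x + (-1 : ℂ) ^ (1 : ZMod 2).val • polyParity x) = x
  rw [ZMod.val_zero, ZMod.val_one]
  module

end BCOV

/-! ### Lie identities modulo total derivatives, and compatibility with the differential. -/

namespace BCOV

variable {I : Type*}

/-! ### The bracket on polynomials modulo total derivatives -/

/-- The class of a polynomial modulo total derivatives. -/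
def modTotal : SuperPoly I →ₗ[ℂ] SuperPoly I ⧸ LinearMap.range (totalDer (I := I)) :=
  Submodule.mkQ _

theorem modTotal_totalDer (x : SuperPoly I) : modTotal (totalDer x) = 0 :=
  (Submodule.Quotient.mk_eq_zero _).2 ⟨x, rfl⟩

theorem modTotal_totalDer_mul (x y : SuperPoly I) :
    modTotal (totalDer x * y) = -modTotal (x * totalDer y) := by
  rw [eq_neg_iff_add_eq_zero, ← map_add, ← isDer_totalDer, modTotal_totalDer]

/-- Repeated integration by parts. No Koszul signs appear, since `∂_z` is even and the factors keep
their order. -/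
theorem modTotal_pow_mul (m : ℕ) (x y : SuperPoly I) :
    modTotal ((totalDer ^ m) x * y) = modTotal (x * ((-totalDer) ^ m) y) := by
  induction m generalizing y with
  | zero => rfl
  | succ m ih =>
    rw [← totalDer_pow_succ, modTotal_totalDer_mul, pow_succ, Module.End.mul_apply, ← ih,
      LinearMap.neg_apply, ← neg_one_smul ℂ (totalDer y), mul_smul_comm, map_smul, neg_one_smul]

/-- The second variation in two evolutionary directions. -/
def hessSum (s : Finset (I × ℕ)) (X Y : I → SuperPoly I) (x : SuperPoly I) : SuperPoly I :=
  ∑ j ∈ s, ∑ i ∈ s, (totalDer ^ i.2) (X i.1) *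
    ((totalDer ^ j.2) (Y j.1) * partialDer i (partialDer j x))

/-- Second partial derivatives commute, so the only sign comes from exchanging the coefficients of
the two directions. -/
theorem hessSum_comm (s : Finset (I × ℕ)) {X Y : I → SuperPoly I} {p q : ZMod 2}
    (hX : ∀ α, X α ∈ parityPart I p) (hY : ∀ α, Y α ∈ parityPart I q) (x : SuperPoly I) :
    hessSum s X Y x = koszul p q • hessSum s Y X x := by
  rw [hessSum, Finset.sum_comm, hessSum, Finset.smul_sum]
  refine Finset.sum_congr rfl fun i _ => ?_
  rw [Finset.smul_sum]
  refine Finset.sum_congr rfl fun j _ => ?_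
  rw [← mul_assoc, superPoly_comm (totalDer_pow_mem_parityPart _ (hX _))
    (totalDer_pow_mem_parityPart _ (hY _)), smul_mul_assoc, mul_assoc, partialDer_comm]

section

variable [Fintype I]

/-- The first variation formula: all `∂_z` are moved from `X` onto the partial derivatives, which
assembles the Euler operator. -/
theorem modTotal_evo (X : I → SuperPoly I) (x : SuperPoly I) :
    modTotal (evo X x) = ∑ α, modTotal (X α * euler α x) := by
  classical
  obtain ⟨s, hs⟩ := exists_finset_partialDer x
  simp only [evo_eq_sum X hs, euler_eq_sum _ hs, map_sum, Finset.mul_sum]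
  rw [Finset.sum_comm]
  refine Finset.sum_congr rfl fun j _ => ?_
  rw [modTotal_pow_mul, Finset.sum_eq_single j.1]
  · rw [if_pos rfl]
  · intro α _ h
    rw [if_neg h.symm, mul_zero, map_zero]
  · exact fun h => absurd (Finset.mem_univ _) h

/-- The operator `u ↦ -∑_β g_{αβ} ∂_z u_β`. -/
def hamOp (g : Matrix I I ℂ) (u : I → SuperPoly I) (α : I) : SuperPoly I :=
  ∑ β, -g α β • totalDer (u β)

/-- Skew-adjointness of the Hamiltonian operator: `∂_z` is skew-adjoint modulo total derivatives and
`g` is symmetric. -/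
theorem modTotal_hamOp_mul {g : Matrix I I ℂ} (hg : g.IsSymm) (u v : I → SuperPoly I) :
    ∑ α, modTotal (hamOp g u α * v α) = -∑ α, modTotal (u α * hamOp g v α) := by
  simp only [hamOp, Finset.sum_mul, Finset.mul_sum, map_sum, smul_mul_assoc, mul_smul_comm,
    map_smul, modTotal_totalDer_mul, ← Finset.sum_neg_distrib, smul_neg]
  rw [Finset.sum_comm]
  refine Finset.sum_congr rfl fun α _ => Finset.sum_congr rfl fun β _ => ?_
  rw [hg.apply]

/-- The Hamiltonian vector field of a polynomial. -/
def hamVec (g : Matrix I I ℂ) (x : SuperPoly I) : I → SuperPoly I :=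
  hamOp g fun β => euler β x

theorem hamVec_add (g : Matrix I I ℂ) (x y : SuperPoly I) :
    hamVec g (x + y) = hamVec g x + hamVec g y := by
  funext α
  simp only [hamVec, hamOp, Pi.add_apply, map_add, smul_add, Finset.sum_add_distrib]

theorem hamVec_smul (g : Matrix I I ℂ) (c : ℂ) (x : SuperPoly I) :
    hamVec g (c • x) = c • hamVec g x := by
  funext α
  simp only [hamVec, hamOp, Pi.smul_apply, map_smul, Finset.smul_sum, smul_comm c]

/-- The bracket on polynomials. -/
def polyBracket (g : Matrix I I ℂ) : SuperPoly I →ₗ[ℂ] SuperPoly I →ₗ[ℂ] SuperPoly I :=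
  LinearMap.mk₂ ℂ (fun x y => evo (hamVec g x) y)
    (fun x x' y => by rw [hamVec_add, evo_add])
    (fun c x y => by rw [hamVec_smul, evo_smul])
    (fun x y y' => map_add _ _ _) (fun c x y => map_smul _ _ _)

theorem polyBracket_apply (g : Matrix I I ℂ) (x y : SuperPoly I) :
    polyBracket g x y = evo (hamVec g x) y := rfl

theorem hamVec_mem_parityPart (g : Matrix I I ℂ) {p : ZMod 2} {x : SuperPoly I}
    (hx : x ∈ parityPart I p) (α : I) : hamVec g x α ∈ parityPart I p :=
  (Submodule.sum_mem _ fun β _ => Submodule.smul_mem _ _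
    (totalDer_mem_parityPart (euler_mem_parityPart β hx)))

theorem polyBracket_mem_parityPart (g : Matrix I I ℂ) {p q : ZMod 2} {x y : SuperPoly I}
    (hx : x ∈ parityPart I p) (hy : y ∈ parityPart I q) :
    polyBracket g x y ∈ parityPart I (p + q) :=
  evo_mem_parityPart (hamVec_mem_parityPart g hx) hy

theorem hamVec_homog_zero (g : Matrix I I ℂ) {x : SuperPoly I} (hx : x ∈ homog I 0) :
    hamVec g x = 0 := by
  funext α
  simp [hamVec, hamOp, euler_homog_zero _ hx]

theorem hamVec_mem_homog (g : Matrix I I ℂ) {d : ℕ} {x : SuperPoly I}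
    (hx : x ∈ homog I (d + 1)) (α : I) : hamVec g x α ∈ homog I d :=
  (Submodule.sum_mem _ fun β _ => Submodule.smul_mem _ _
    (totalDer_mem_homog (euler_mem_homog β hx)))

theorem polyBracket_homog_zero_left (g : Matrix I I ℂ) {x : SuperPoly I} (hx : x ∈ homog I 0)
    (y : SuperPoly I) : polyBracket g x y = 0 := by
  obtain ⟨s, hs⟩ := exists_finset_partialDer y
  rw [polyBracket_apply, hamVec_homog_zero g hx, evo_eq_sum _ hs]
  simp

theorem polyBracket_homog_zero_right (g : Matrix I I ℂ) (x : SuperPoly I) {y : SuperPoly I}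
    (hy : y ∈ homog I 0) : polyBracket g x y = 0 := by
  rw [polyBracket_apply, evo_eq_sum _ (s := ∅) fun j _ => partialDer_homog_zero j hy,
    Finset.sum_empty]

/-- Each argument is differentiated once, so two degrees are lost. A factor of degree zero gives
zero, which covers the cases where the subtraction would be truncated. -/
theorem polyBracket_mem_homog (g : Matrix I I ℂ) {i j n : ℕ} (h : i + j = n + 2)
    {x y : SuperPoly I} (hx : x ∈ homog I i) (hy : y ∈ homog I j) :
    polyBracket g x y ∈ homog I n := by
  rcases i with _ | i
  · rw [polyBracket_homog_zero_left g hx]; exact Submodule.zero_mem _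
  rcases j with _ | j
  · rw [polyBracket_homog_zero_right g x hy]; exact Submodule.zero_mem _
  obtain rfl : n = i + j := by omega
  obtain ⟨s, hs⟩ := exists_finset_partialDer y
  rw [polyBracket_apply, evo_eq_sum _ hs]
  exact Submodule.sum_mem _ fun k _ => mul_mem_homog
    (totalDer_pow_mem_homog _ (hamVec_mem_homog g hx _)) (partialDer_mem_homog k hy)

/-- Modulo total derivatives the bracket is the pairing of two Euler derivatives through a
skew-adjoint operator; reordering the factors gives the Koszul sign. -/
theorem polyBracket_skew {g : Matrix I I ℂ} (hg : g.IsSymm) {p q : ZMod 2} {x y : SuperPoly I}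
    (hx : x ∈ parityPart I p) (hy : y ∈ parityPart I q) :
    modTotal (polyBracket g x y) = -(koszul p q • modTotal (polyBracket g y x)) := by
  simp only [polyBracket_apply, modTotal_evo]
  rw [hamVec, modTotal_hamOp_mul hg, Finset.smul_sum]
  refine congrArg _ (Finset.sum_congr rfl fun α _ => ?_)
  change modTotal (euler α x * hamVec g y α) = _
  rw [superPoly_comm (euler_mem_parityPart α hx) (hamVec_mem_parityPart g hy α), map_smul]

/-- `X` either differentiates the coefficients of `Y`, past which it commutes with `∂_z`, or hits
the partial derivatives of `x` and yields the Hessian. -/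
theorem evo_evo (X Y : I → SuperPoly I) {x : SuperPoly I} {s : Finset (I × ℕ)}
    (hs : ∀ j, j ∉ s → partialDer j x = 0) :
    evo X (evo Y x) = evo (fun α => evo X (Y α)) x + hessSum s X Y x := by
  rw [evo_eq_sum Y hs, evo_eq_sum (fun α => evo X (Y α)) hs, map_sum, hessSum,
    ← Finset.sum_add_distrib]
  refine Finset.sum_congr rfl fun j _ => ?_
  rw [evo_mul X (s := s) fun i hi => by rw [partialDer_comm, hs i hi, map_zero],
    evo_totalDer_pow]

theorem evo_euler (X : I → SuperPoly I) (α : I) (x : SuperPoly I) {s : Finset (I × ℕ)}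
    (hs : ∀ j, j ∉ s → partialDer j x = 0) [DecidableEq I] :
    evo X (euler α x) =
      ∑ j ∈ s, if j.1 = α then ((-totalDer) ^ j.2) (evo X (partialDer j x)) else 0 := by
  rw [euler_eq_sum α hs, map_sum]
  refine Finset.sum_congr rfl fun j _ => ?_
  by_cases h : j.1 = α
  · rw [if_pos h, if_pos h, evo_neg_totalDer_pow]
  · rw [if_neg h, if_neg h, map_zero]

/-- The linearised Euler operator, paired with `Y`, is the second variation. With `hessSum_comm`
this expresses its self-adjointness. -/
theorem modTotal_mul_evo_euler (X Y : I → SuperPoly I) (x : SuperPoly I) {s : Finset (I × ℕ)}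
    (hs : ∀ j, j ∉ s → partialDer j x = 0) :
    ∑ α, modTotal (Y α * evo X (euler α x)) = modTotal (hessSum s Y X x) := by
  classical
  simp only [evo_euler X _ x hs, Finset.mul_sum, map_sum]
  have h : hessSum s Y X x = ∑ i ∈ s, ∑ j ∈ s, (totalDer ^ i.2) (Y i.1) *
    ((totalDer ^ j.2) (X j.1) * partialDer i (partialDer j x)) := Finset.sum_comm
  rw [Finset.sum_comm, h, map_sum]
  refine Finset.sum_congr rfl fun j _ => ?_
  rw [Finset.sum_eq_single j.1]
  · rw [if_pos rfl, ← modTotal_pow_mul,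
      evo_eq_sum X (s := s) fun i hi => by rw [partialDer_comm, hs i hi, map_zero],
      Finset.mul_sum]
    refine congrArg _ (Finset.sum_congr rfl fun i _ => ?_)
    rw [partialDer_comm]
  · intro α _ h
    rw [if_neg h.symm, mul_zero, map_zero]
  · exact fun h => absurd (Finset.mem_univ _) h

theorem evo_hamVec (g : Matrix I I ℂ) (X : I → SuperPoly I) (x : SuperPoly I) (α : I) :
    evo X (hamVec g x α) = hamOp g (fun β => evo X (euler β x)) α := by
  simp only [hamVec, hamOp, map_sum, map_smul, evo_totalDer]

/-- In `evo_evo` the term differentiating `X_y` is integrated by parts: skew-adjointness of the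
Hamiltonian operator moves it onto `E(z)`, leaving `E(y)` linearised along `X_x` and paired with
`X_z`. -/
theorem polyBracket_polyBracket {g : Matrix I I ℂ} (hg : g.IsSymm) {p q r : ZMod 2}
    {x y z : SuperPoly I} (hx : x ∈ parityPart I p) (hy : y ∈ parityPart I q)
    (hz : z ∈ parityPart I r) {s : Finset (I × ℕ)} (hsy : ∀ j, j ∉ s → partialDer j y = 0)
    (hsz : ∀ j, j ∉ s → partialDer j z = 0) :
    modTotal (polyBracket g x (polyBracket g y z)) =
      modTotal (hessSum s (hamVec g x) (hamVec g y) z) -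
        koszul (p + q) r • modTotal (hessSum s (hamVec g z) (hamVec g x) y) := by
  simp only [polyBracket_apply]
  rw [evo_evo _ _ hsz, map_add, modTotal_evo]
  simp only [evo_hamVec]
  rw [modTotal_hamOp_mul hg, ← modTotal_mul_evo_euler _ _ _ hsy, Finset.smul_sum, add_comm,
    ← sub_eq_add_neg]
  refine congrArg _ (Finset.sum_congr rfl fun α _ => ?_)
  change modTotal (_ * hamVec g z α) = _
  rw [superPoly_comm (evo_mem_parityPart (hamVec_mem_parityPart g hx)
    (euler_mem_parityPart α hy)) (hamVec_mem_parityPart g hz α), map_smul]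

theorem polyBracket_jacobi {g : Matrix I I ℂ} (hg : g.IsSymm) {p q r : ZMod 2}
    {x y z : SuperPoly I} (hx : x ∈ parityPart I p) (hy : y ∈ parityPart I q)
    (hz : z ∈ parityPart I r) :
    modTotal (polyBracket g x (polyBracket g y z)) =
      modTotal (polyBracket g (polyBracket g x y) z) +
        koszul p q • modTotal (polyBracket g y (polyBracket g x z)) := by
  classical
  obtain ⟨sx, hsx⟩ := exists_finset_partialDer x
  obtain ⟨sy, hsy⟩ := exists_finset_partialDer y
  obtain ⟨sz, hsz⟩ := exists_finset_partialDer z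
  have h1 : ∀ j, j ∉ sx ∪ sy ∪ sz → partialDer j x = 0 := fun j hj => hsx j (by simp_all)
  have h2 : ∀ j, j ∉ sx ∪ sy ∪ sz → partialDer j y = 0 := fun j hj => hsy j (by simp_all)
  have h3 : ∀ j, j ∉ sx ∪ sy ∪ sz → partialDer j z = 0 := fun j hj => hsz j (by simp_all)
  -- Skew symmetry puts all three terms in the shape of `polyBracket_polyBracket`. The Hessians of
  -- `z` and `x` are then brought to a common order of arguments, and the signs are compared in the
  -- eight parity cases.
  rw [polyBracket_skew hg (polyBracket_mem_parityPart g hx hy) hz,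
    polyBracket_polyBracket hg hx hy hz h2 h3, polyBracket_polyBracket hg hz hx hy h1 h2,
    polyBracket_polyBracket hg hy hx hz h1 h3,
    hessSum_comm _ (hamVec_mem_parityPart g hy) (hamVec_mem_parityPart g hx),
    hessSum_comm _ (hamVec_mem_parityPart g hz) (hamVec_mem_parityPart g hy) x]
  rcases zmod_two_cases p with rfl | rfl <;> rcases zmod_two_cases q with rfl | rfl <;>
    rcases zmod_two_cases r with rfl | rfl <;>
    (simp [koszul, ZMod.val_one, CharTwo.add_self_eq_zero]; try abel)

end

/-! ### The differential -/

theorem deltaPoly_gen (a : Gen I) : deltaPoly (gen a) = deltaGen a := by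
  have h := deltaPoly_gen_mul a 1
  rwa [mul_one, mul_one, deltaPoly_one, mul_zero, smul_zero, add_zero] at h

theorem deltaMatrix_parity (x : SuperPoly I) : deltaMatrix x 0 0 = polyParity x := by
  induction x using SuperPoly.induction with
  | algebraMap r => rw [AlgHom.commutes, AlgHom.commutes]; simp [Matrix.algebraMap_eq_diagonal]
  | gen a => rw [deltaMatrix_gen, polyParity, liftGen_gen]; rfl
  | mul a b ha hb =>
    rw [map_mul, map_mul, Matrix.mul_apply, Fin.sum_univ_two, ha, hb, deltaMatrix_lower, mul_zero,
      add_zero]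
  | add a b ha hb => rw [map_add, map_add, Matrix.add_apply, ha, hb]

/-- The graded Leibniz rule. -/
theorem deltaPoly_mul (x y : SuperPoly I) :
    deltaPoly (x * y) = deltaPoly x * y + polyParity x * deltaPoly y := by
  change deltaMatrix (x * y) 0 1 = _
  rw [map_mul, Matrix.mul_apply, Fin.sum_univ_two, deltaMatrix_parity, deltaMatrix_diag, add_comm]
  rfl

theorem deltaPoly_mul_of_mem {p : ZMod 2} {x : SuperPoly I} (hx : x ∈ parityPart I p)
    (y : SuperPoly I) :
    deltaPoly (x * y) = deltaPoly x * y + ((-1 : ℂ) ^ p.val) • (x * deltaPoly y) := by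
  rw [deltaPoly_mul, polyParity_of_mem hx, smul_mul_assoc]

theorem deltaGen_mem_parityPart (a : Gen I) : deltaGen a ∈ parityPart I (a.parity + 1) := by
  rcases a with ⟨α, _ | k, m⟩ | ⟨α, k, m⟩
  · exact Submodule.zero_mem _
  · exact gen_mem_parityPart (.rho α k (m + 1))
  · exact Submodule.zero_mem _

theorem deltaPoly_mem_parityPart {p : ZMod 2} {x : SuperPoly I} (hx : x ∈ parityPart I p) :
    deltaPoly x ∈ parityPart I (p + 1) := by
  refine parityPart_induction hx ?_ ?_ ?_ ?_
  · rw [map_zero]; exact Submodule.zero_mem _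
  · intro x y hx hy; rw [map_add]; exact Submodule.add_mem _ hx hy
  · intro c x hx; rw [map_smul]; exact Submodule.smul_mem _ _ hx
  · rintro w rfl
    clear hx
    induction w with
    | nil => rw [monom_nil, deltaPoly_one]; exact Submodule.zero_mem _
    | cons a w ih =>
      rw [monom_cons, deltaPoly_gen_mul, List.map_cons, List.sum_cons]
      refine Submodule.add_mem _ ?_ (Submodule.smul_mem _ _ ?_)
      · rw [add_right_comm]
        exact mul_mem_parityPart (deltaGen_mem_parityPart a) (monom_mem_parityPart w)
      · rw [add_assoc]
        exact mul_mem_parityPart (gen_mem_parityPart a) ih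

theorem deltaPoly_totalDer (x : SuperPoly I) :
    deltaPoly (totalDer x) = totalDer (deltaPoly x) := by
  refine DFunLike.congr_fun (SuperPoly.linearMap_ext (f := deltaPoly ∘ₗ totalDer)
    (g := totalDer ∘ₗ deltaPoly) fun w => ?_) x
  simp only [LinearMap.comp_apply]
  induction w with
  | nil => rw [monom_nil, isDer_totalDer.map_one, deltaPoly_one, map_zero, map_zero]
  | cons a w ih =>
    have h : totalDer (deltaGen a) = deltaGen (totalGen a) := by
      rcases a with ⟨α, _ | k, m⟩ | ⟨α, k, m⟩
      · exact map_zero _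
      · exact totalDer_gen _
      · exact map_zero _
    rw [monom_cons, isDer_totalDer, totalDer_gen, map_add, deltaPoly_gen_mul, deltaPoly_gen_mul,
      deltaPoly_gen_mul, map_add, map_smul, isDer_totalDer, isDer_totalDer, h, totalDer_gen, ih,
      parity_totalGen, smul_add]
    abel

theorem deltaPoly_totalDer_pow (m : ℕ) (x : SuperPoly I) :
    deltaPoly ((totalDer ^ m) x) = (totalDer ^ m) (deltaPoly x) := by
  induction m with
  | zero => rfl
  | succ m ih => rw [← totalDer_pow_succ, deltaPoly_totalDer, ih, totalDer_pow_succ]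

/-- The values of `δ` on symbols are zero or some `ρ`, hence contain no `λ_0`, and `δ λ_0 = 0`; so
`δ` does not interact with the directions seen by the BV kernel. -/
theorem deltaPoly_partialDer (j : I × ℕ) (x : SuperPoly I) :
    deltaPoly (partialDer j x) = partialDer j (deltaPoly x) := by
  refine DFunLike.congr_fun (SuperPoly.linearMap_ext (f := deltaPoly ∘ₗ partialDer j)
    (g := partialDer j ∘ₗ deltaPoly) fun w => ?_) x
  simp only [LinearMap.comp_apply]
  induction w with
  | nil => rw [monom_nil, (isDer_partialDer j).map_one, deltaPoly_one, map_zero, map_zero]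
  | cons a w ih =>
    have h : partialDer j (deltaGen a) = 0 := by
      rcases a with ⟨α, _ | k, m⟩ | ⟨α, k, m⟩
      · exact map_zero _
      · rw [deltaGen, partialDer_gen, partialGen, if_neg (by simp)]
      · exact map_zero _
    have h2 : ∀ y, deltaPoly (partialGen j a * y) =
        (-1 : ℂ) ^ a.parity.val • (partialGen j a * deltaPoly y) := by
      intro y
      rw [partialGen]
      split_ifs with h
      · simp [h, Gen.parity]
      · simp
    rw [monom_cons, isDer_partialDer, partialDer_gen, map_add, deltaPoly_gen_mul,
      deltaPoly_gen_mul, map_add, map_smul, isDer_partialDer, isDer_partialDer, h,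
      partialDer_gen, ih, h2, smul_add, zero_mul, zero_add]
    abel

theorem deltaPoly_deltaPoly (x : SuperPoly I) : deltaPoly (deltaPoly x) = 0 := by
  refine DFunLike.congr_fun (SuperPoly.linearMap_ext (f := deltaPoly ∘ₗ deltaPoly)
    (g := 0) fun w => ?_) x
  simp only [LinearMap.comp_apply, LinearMap.zero_apply]
  induction w with
  | nil => rw [monom_nil, deltaPoly_one, map_zero]
  | cons a w ih =>
    have h : deltaPoly (deltaGen a) = 0 := by
      rcases a with ⟨α, _ | k, m⟩ | ⟨α, k, m⟩
      · exact map_zero _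
      · exact deltaPoly_gen _
      · exact map_zero _
    -- The two cross terms `δa · δw` carry the opposite signs `(-1)^{|a|+1}` and `(-1)^{|a|}`.
    rw [monom_cons, deltaPoly_gen_mul, map_add, map_smul, deltaPoly_gen_mul, ih, mul_zero,
      smul_zero, add_zero, deltaPoly_mul_of_mem (deltaGen_mem_parityPart a), h, zero_mul, zero_add,
      ← add_smul, neg_one_pow_val_add, ZMod.val_one]
    simp

theorem deltaPoly_euler (α : I) (x : SuperPoly I) :
    deltaPoly (euler α x) = euler α (deltaPoly x) := by
  obtain ⟨s, hs⟩ := exists_finset_partialDer x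
  rw [euler_eq_sum α hs, euler_eq_sum α (s := s) fun j hj => by
    rw [← deltaPoly_partialDer, hs j hj, map_zero], map_sum]
  refine Finset.sum_congr rfl fun j _ => ?_
  split_ifs
  · rw [neg_totalDer_pow, neg_totalDer_pow, map_smul, deltaPoly_totalDer_pow,
      deltaPoly_partialDer]
  · exact map_zero _

section

variable [Fintype I]

theorem deltaPoly_hamVec (g : Matrix I I ℂ) (x : SuperPoly I) (α : I) :
    deltaPoly (hamVec g x α) = hamVec g (deltaPoly x) α := by
  simp only [hamVec, hamOp, map_sum, map_smul, deltaPoly_totalDer, deltaPoly_euler]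

/-- An exact identity, not merely one modulo total derivatives: `δ` commutes with every operator in
the bracket, and the sign arises from passing the coefficient `∂_z^m X_x`, which has the parity of
`x`. -/
theorem deltaPoly_polyBracket (g : Matrix I I ℂ) {p : ZMod 2} {x : SuperPoly I}
    (hx : x ∈ parityPart I p) (y : SuperPoly I) :
    deltaPoly (polyBracket g x y) =
      polyBracket g (deltaPoly x) y + ((-1 : ℂ) ^ p.val) • polyBracket g x (deltaPoly y) := by
  obtain ⟨s, hs⟩ := exists_finset_partialDer y
  simp only [polyBracket_apply]
  rw [evo_eq_sum _ hs, evo_eq_sum _ hs, evo_eq_sum _ (s := s) fun j hj => by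
    rw [← deltaPoly_partialDer, hs j hj, map_zero], map_sum, Finset.smul_sum,
    ← Finset.sum_add_distrib]
  refine Finset.sum_congr rfl fun j _ => ?_
  rw [deltaPoly_mul_of_mem (totalDer_pow_mem_parityPart _ (hamVec_mem_parityPart g hx _)),
    deltaPoly_totalDer_pow, deltaPoly_hamVec, deltaPoly_partialDer]

end

end BCOV

/-! ### Analysis on the cylinder: integration by parts, cutoffs, Fourier coefficients. -/

namespace BCOV

open Complex MeasureTheory Filter Topology

/-! ### Calculus on the cylinder -/

theorem dirDeriv_apply (v : ℂ) (f : Smooth) (z : ℂ) :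
    (dirDeriv v f : ℂ → ℂ) z = fderiv ℝ (f : ℂ → ℂ) z v := rfl

theorem delz_apply (f : Smooth) (z : ℂ) : (delz f : ℂ → ℂ) z =
    (1 / 2 : ℂ) * (fderiv ℝ (f : ℂ → ℂ) z 1 - I * fderiv ℝ (f : ℂ → ℂ) z I) := rfl

theorem delzbar_apply (f : Smooth) (z : ℂ) : (delzbar f : ℂ → ℂ) z =
    (1 / 2 : ℂ) * (fderiv ℝ (f : ℂ → ℂ) z 1 + I * fderiv ℝ (f : ℂ → ℂ) z I) := rfl

/-- On holomorphic functions `∂_z` is thus the derivative along the circle, which is why total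
derivatives have no periods. -/
theorem delz_eq (f : Smooth) : delz f = dirDeriv 1 f - delzbar f := by
  simp only [delz, delzbar, LinearMap.smul_apply, LinearMap.sub_apply, LinearMap.add_apply]
  module

theorem smooth_ext {f g : Smooth} (h : ∀ z, (f : ℂ → ℂ) z = (g : ℂ → ℂ) z) : f = g :=
  Subtype.ext (funext h)

theorem dirDeriv_mul (v : ℂ) (f g : Smooth) :
    dirDeriv v (f * g) = dirDeriv v f * g + f * dirDeriv v g := by
  refine smooth_ext fun z => ?_
  change fderiv ℝ ((f : ℂ → ℂ) * (g : ℂ → ℂ)) z v = fderiv ℝ (f : ℂ → ℂ) z v * (g : ℂ → ℂ) z +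
    (f : ℂ → ℂ) z * fderiv ℝ (g : ℂ → ℂ) z v
  rw [fderiv_mul (differentiable_smooth f z) (differentiable_smooth g z)]
  simp only [add_apply, smul_apply, smul_eq_mul]
  ring

theorem delz_mul (f g : Smooth) : delz (f * g) = delz f * g + f * delz g := by
  simp only [delz, LinearMap.smul_apply, LinearMap.sub_apply, dirDeriv_mul, smul_mul_assoc,
    mul_smul_comm, sub_mul, mul_sub, smul_add, smul_sub]
  abel

theorem delzbar_mul (f g : Smooth) : delzbar (f * g) = delzbar f * g + f * delzbar g := by
  simp only [delzbar, LinearMap.smul_apply, LinearMap.add_apply, dirDeriv_mul, smul_mul_assoc,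
    mul_smul_comm, add_mul, mul_add, smul_add]
  abel

theorem dirDeriv_comm (v w : ℂ) (f : Smooth) :
    dirDeriv v (dirDeriv w f) = dirDeriv w (dirDeriv v f) := by
  refine smooth_ext fun z => ?_
  have hd : DifferentiableAt ℝ (fderiv ℝ (f : ℂ → ℂ)) z :=
    (f.2.1.fderiv_right (m := ∞) (by simp)).differentiable (by simp) z
  have h : ∀ u u' : ℂ, (dirDeriv u (dirDeriv u' f) : ℂ → ℂ) z =
      fderiv ℝ (fderiv ℝ (f : ℂ → ℂ)) z u u' := by
    intro u u'
    change fderiv ℝ (fun z => fderiv ℝ (f : ℂ → ℂ) z u') z u = _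
    rw [fderiv_clm_apply hd (differentiableAt_const _)]
    simp
  rw [h, h]
  refine (f.2.1.contDiffAt.isSymmSndFDerivAt ?_).eq v w
  rw [minSmoothness_of_isRCLikeNormedField]
  exact WithTop.coe_le_coe.2 le_top

theorem delzbar_delz (f : Smooth) : delzbar (delz f) = delz (delzbar f) := by
  simp only [delz, delzbar, LinearMap.smul_apply, LinearMap.add_apply, LinearMap.sub_apply,
    map_smul, map_add, map_sub, dirDeriv_comm I 1]
  module

theorem hasDerivAt_re (f : Smooth) (x y : ℝ) :
    HasDerivAt (fun x : ℝ => (f : ℂ → ℂ) (x + y * I)) (fderiv ℝ (f : ℂ → ℂ) (x + y * I) 1) x := by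
  have h : HasDerivAt (fun x : ℝ => (x : ℂ) + y * I) 1 x :=
    (Complex.ofRealCLM.hasDerivAt (x := x)).add_const _
  exact (differentiable_smooth f _).hasFDerivAt.comp_hasDerivAt x h

theorem hasDerivAt_im (f : Smooth) (x y : ℝ) :
    HasDerivAt (fun y : ℝ => (f : ℂ → ℂ) (x + y * I)) (fderiv ℝ (f : ℂ → ℂ) (x + y * I) I) y := by
  have h : HasDerivAt (fun y : ℝ => (x : ℂ) + y * I) I y := by
    simpa using ((Complex.ofRealCLM.hasDerivAt (x := y)).mul_const I).const_add (x : ℂ)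
  exact (differentiable_smooth f _).hasFDerivAt.comp_hasDerivAt y h

theorem continuous_smooth (f : Smooth) : Continuous (f : ℂ → ℂ) := f.2.1.continuous

theorem continuous_slice (f : Smooth) :
    Continuous fun p : ℝ × ℝ => (f : ℂ → ℂ) (p.1 + p.2 * I) :=
  (continuous_smooth f).comp (by fun_prop)

/-- The fundamental theorem of calculus; the boundary terms cancel by periodicity. -/
theorem integral_dirDeriv_one (f : Smooth) (y : ℝ) :
    ∫ x in (0 : ℝ)..1, (dirDeriv 1 f : ℂ → ℂ) (x + y * I) = 0 := by
  simp only [dirDeriv_apply]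
  rw [intervalIntegral.integral_eq_sub_of_hasDerivAt (f := fun x : ℝ => (f : ℂ → ℂ) (x + y * I))
    (fun x _ => hasDerivAt_re f x y)
    (((continuous_slice (dirDeriv 1 f)).comp (by fun_prop :
      Continuous fun x : ℝ => (x, y))).intervalIntegrable _ _)]
  have h := f.2.2 (y * I)
  rw [add_comm] at h
  simp only [ofReal_one, ofReal_zero, zero_add, h, sub_self]

theorem circleInt_dirDeriv_one (f : Smooth) : circleInt (dirDeriv 1 f) = 0 := by
  have h := integral_dirDeriv_one f 0
  simpa [circleInt] using h

/-! ### Integration of functions of compact support -/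

theorem suppIn_mono {R R' : ℝ} (h : R ≤ R') : suppIn R ≤ suppIn R' :=
  fun _ hf z hz => hf z (h.trans_lt hz)

theorem dirDeriv_mem_suppIn (v : ℂ) {R : ℝ} {f : Smooth} (hf : f ∈ suppIn R) :
    dirDeriv v f ∈ suppIn R := by
  intro z hz
  have h : (f : ℂ → ℂ) =ᶠ[𝓝 z] fun _ => 0 := by
    filter_upwards [(isOpen_lt continuous_const
      (continuous_abs.comp Complex.continuous_im)).mem_nhds hz] with w hw using hf w hw
  rw [dirDeriv_apply, h.fderiv_eq]
  simp

theorem delz_mem_suppIn {R : ℝ} {f : Smooth} (hf : f ∈ suppIn R) : delz f ∈ suppIn R :=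
  Submodule.smul_mem _ _ (Submodule.sub_mem _ (dirDeriv_mem_suppIn 1 hf)
    (Submodule.smul_mem _ _ (dirDeriv_mem_suppIn I hf)))

theorem mul_mem_suppIn {R : ℝ} {f : Smooth} (hf : f ∈ suppIn R) (g : Smooth) :
    f * g ∈ suppIn R := fun z hz => by
  change (f : ℂ → ℂ) z * (g : ℂ → ℂ) z = 0
  rw [hf z hz, zero_mul]

theorem slice_eq_zero {R : ℝ} {f : Smooth} (hf : f ∈ suppIn R) {y : ℝ} (hy : R < |y|) (x : ℝ) :
    (f : ℂ → ℂ) (x + y * I) = 0 := hf _ (by simpa using hy)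

theorem integrable_fiber {R : ℝ} {f : Smooth} (hf : f ∈ suppIn R) :
    Integrable fun y : ℝ => ∫ x in (0 : ℝ)..1, (f : ℂ → ℂ) (x + y * I) := by
  refine Continuous.integrable_of_hasCompactSupport ?_ ?_
  · exact intervalIntegral.continuous_parametric_intervalIntegral_of_continuous'
      (f := fun y x : ℝ => (f : ℂ → ℂ) (x + y * I))
      ((continuous_slice f).comp continuous_swap) 0 1
  · refine HasCompactSupport.of_support_subset_isCompact (isCompact_closedBall (0 : ℝ) R) ?_
    intro y hy
    rw [Metric.mem_closedBall, Real.dist_eq, sub_zero]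
    by_contra hne
    refine hy ?_
    simp only [slice_eq_zero hf (not_le.1 hne), intervalIntegral.integral_zero]

theorem cylinderInt_add {R : ℝ} {f g : Smooth} (hf : f ∈ suppIn R) (hg : g ∈ suppIn R) :
    cylinderInt (f + g) = cylinderInt f + cylinderInt g := by
  rw [cylinderInt, cylinderInt, cylinderInt, ← mul_add,
    ← integral_add (integrable_fiber hf) (integrable_fiber hg)]
  congr 2
  funext y
  exact intervalIntegral.integral_add
    (((continuous_slice f).comp (by fun_prop :
      Continuous fun x : ℝ => (x, y))).intervalIntegrable _ _)
    (((continuous_slice g).comp (by fun_prop :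
      Continuous fun x : ℝ => (x, y))).intervalIntegrable _ _)

theorem cylinderInt_smul (c : ℂ) (f : Smooth) : cylinderInt (c • f) = c * cylinderInt f := by
  have h : ∀ y : ℝ, ∫ x in (0 : ℝ)..1, ((c • f : Smooth) : ℂ → ℂ) (x + y * I) =
      c * ∫ x in (0 : ℝ)..1, (f : ℂ → ℂ) (x + y * I) := fun y =>
    intervalIntegral.integral_const_mul c _
  simp only [cylinderInt, h, integral_const_mul]
  ring

/-- Integration over the cylinder of functions with support in a fixed compact set. -/
def cylinderIntOn (R : ℝ) : suppIn R →ₗ[ℂ] ℂ where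
  toFun f := cylinderInt f
  map_add' f g := cylinderInt_add f.2 g.2
  map_smul' c f := cylinderInt_smul c f

/-- The function is continuous and vanishes off a compact rectangle. Integrability on the product is
needed for Fubini in `cylinderInt_dirDeriv_I`. -/
theorem integrable_slice {R : ℝ} {f : Smooth} (hf : f ∈ suppIn R) :
    Integrable (Function.uncurry fun x y : ℝ => (f : ℂ → ℂ) (x + y * I))
      ((volume.restrict (Set.uIoc (0 : ℝ) 1)).prod volume) := by
  have h : (volume.restrict (Set.uIoc (0 : ℝ) 1)).prod (volume : Measure ℝ) =
      (volume : Measure (ℝ × ℝ)).restrict (Set.uIoc (0 : ℝ) 1 ×ˢ Set.univ) := by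
    rw [Measure.volume_eq_prod, ← Measure.prod_restrict, Measure.restrict_univ]
  rw [h]
  have hK : IntegrableOn (Function.uncurry fun x y : ℝ => (f : ℂ → ℂ) (x + y * I))
      (Set.uIcc (0 : ℝ) 1 ×ˢ Metric.closedBall (0 : ℝ) R) volume :=
    (continuous_slice f).continuousOn.integrableOn_compact
      (isCompact_uIcc.prod (isCompact_closedBall _ _))
  refine hK.of_forall_sdiff_eq_zero (measurableSet_uIoc.prod MeasurableSet.univ) ?_
  rintro ⟨x, y⟩ ⟨⟨hx, -⟩, hne⟩
  refine slice_eq_zero hf ?_ x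
  by_contra hy
  exact hne ⟨Set.uIoc_subset_uIcc hx, by simpa using not_lt.1 hy⟩

theorem cylinderInt_dirDeriv_one (f : Smooth) : cylinderInt (dirDeriv 1 f) = 0 := by
  rw [cylinderInt]
  simp only [integral_dirDeriv_one, integral_zero, mul_zero]

/-- After exchanging the integrals, each vertical line carries the integral of the derivative of a
compactly supported function. -/
theorem cylinderInt_dirDeriv_I {R : ℝ} {f : Smooth} (hf : f ∈ suppIn R) :
    cylinderInt (dirDeriv I f) = 0 := by
  have hsupp : ∀ (g : Smooth), g ∈ suppIn R → ∀ x : ℝ,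
      Integrable fun y : ℝ => (g : ℂ → ℂ) (x + y * I) := by
    intro g hg x
    refine Continuous.integrable_of_hasCompactSupport
      ((continuous_slice g).comp (by fun_prop : Continuous fun y : ℝ => (x, y))) ?_
    refine HasCompactSupport.of_support_subset_isCompact (isCompact_closedBall (0 : ℝ) R) ?_
    intro y hy
    rw [Metric.mem_closedBall, Real.dist_eq, sub_zero]
    by_contra hne
    exact hy (slice_eq_zero hg (not_le.1 hne) x)
  rw [cylinderInt, ← intervalIntegral_integral_swap
    (integrable_slice (dirDeriv_mem_suppIn I hf))]
  have h : ∀ x : ℝ, ∫ y : ℝ, (dirDeriv I f : ℂ → ℂ) (x + y * I) = 0 := fun x =>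
    integral_eq_zero_of_hasDerivAt_of_integrable (fun y => hasDerivAt_im f x y)
      (hsupp _ (dirDeriv_mem_suppIn I hf) x) (hsupp f hf x)
  simp only [h, intervalIntegral.integral_zero, mul_zero]

theorem cylinderInt_delz {R : ℝ} {f : Smooth} (hf : f ∈ suppIn R) : cylinderInt (delz f) = 0 := by
  have h : delz f = (1 / 2 : ℂ) • (dirDeriv 1 f + (-I) • dirDeriv I f) := by
    simp only [delz, LinearMap.smul_apply, LinearMap.sub_apply]
    module
  rw [h, cylinderInt_smul, cylinderInt_add (dirDeriv_mem_suppIn 1 hf)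
    (Submodule.smul_mem _ _ (dirDeriv_mem_suppIn I hf)), cylinderInt_smul,
    cylinderInt_dirDeriv_one, cylinderInt_dirDeriv_I hf, mul_zero, add_zero, mul_zero]

/-! ### Cutoff functions -/

/-- The profile of the cutoff function. -/
def cutoffProfile (c : ℝ) : ContDiffBump c := ⟨1, 2, one_pos, one_lt_two⟩

/-- A function of compact support equal to one near the circle `Im z = c`. -/
def cutoff (c : ℝ) : Smooth :=
  ⟨fun z => (cutoffProfile c z.im : ℂ),
    Complex.ofRealCLM.contDiff.comp ((cutoffProfile c).contDiff.comp Complex.imCLM.contDiff),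
    fun z => by simp⟩

theorem cutoff_apply (c : ℝ) (z : ℂ) : (cutoff c : ℂ → ℂ) z = (cutoffProfile c z.im : ℂ) := rfl

theorem cutoff_mem_suppIn (c : ℝ) : cutoff c ∈ suppIn (|c| + 2) := by
  intro z hz
  rw [cutoff_apply, (cutoffProfile c).zero_of_le_dist, ofReal_zero]
  change 2 ≤ dist z.im c
  rw [Real.dist_eq]
  have h := abs_sub_abs_le_abs_sub z.im c
  linarith

theorem cutoff_eventually (z : ℂ) : (cutoff z.im : ℂ → ℂ) =ᶠ[𝓝 z] fun _ => 1 := by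
  have h := (cutoffProfile z.im).eventuallyEq_one
  filter_upwards [Complex.continuous_im.continuousAt.eventually h] with w hw
  rw [cutoff_apply, hw]
  simp

theorem delz_eventuallyEq {f g : Smooth} {z : ℂ} (h : (f : ℂ → ℂ) =ᶠ[𝓝 z] (g : ℂ → ℂ)) :
    (delz f : ℂ → ℂ) =ᶠ[𝓝 z] (delz g : ℂ → ℂ) := by
  filter_upwards [h.fderiv (𝕜 := ℝ)] with w hw
  rw [delz_apply, delz_apply, hw]

/-- Nondegeneracy of the integration pairing. -/
theorem eq_zero_of_cylinderInt_mul {g : Smooth}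
    (h : ∀ R, ∀ f ∈ suppIn R, cylinderInt (f * g) = 0) : g = 0 := by
  refine smooth_ext fun z₀ => ?_
  change (g : ℂ → ℂ) z₀ = 0
  have hconj : (fun z => starRingEnd ℂ ((g : ℂ → ℂ) z)) ∈ Smooth :=
    ⟨Complex.conjCLE.contDiff.comp g.2.1, fun z => by simp only [g.2.2]⟩
  set c := z₀.im with hc
  -- The test function is a cutoff times the conjugate of `g`, so that the integrand becomes the
  -- nonnegative function `χ |g|²`.
  have h1 := h _ _ (mul_mem_suppIn (cutoff_mem_suppIn c) ⟨_, hconj⟩)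
  set u : ℝ → ℝ → ℝ := fun y x => cutoffProfile c y * normSq ((g : ℂ → ℂ) (x + y * I)) with hu
  have hval : ∀ x y : ℝ, ((cutoff c * ⟨_, hconj⟩ * g : Smooth) : ℂ → ℂ) (x + y * I) =
      (u y x : ℂ) := by
    intro x y
    change (cutoff c : ℂ → ℂ) (x + y * I) * starRingEnd ℂ ((g : ℂ → ℂ) (x + y * I)) *
      (g : ℂ → ℂ) (x + y * I) = _
    rw [mul_assoc, ← Complex.normSq_eq_conj_mul_self, cutoff_apply]
    simp [hu]
  have hucont : Continuous (Function.uncurry u) :=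
    ((cutoffProfile c).continuous.comp continuous_fst).mul
      (Complex.continuous_normSq.comp ((continuous_slice g).comp continuous_swap))
  have hunn : ∀ y x, 0 ≤ u y x := fun y x =>
    mul_nonneg (cutoffProfile c).nonneg (normSq_nonneg _)
  have hGcont : Continuous fun y => ∫ x in (0 : ℝ)..1, u y x :=
    intervalIntegral.continuous_parametric_intervalIntegral_of_continuous' hucont 0 1
  have hGsupp : HasCompactSupport fun y => ∫ x in (0 : ℝ)..1, u y x := by
    refine HasCompactSupport.of_support_subset_isCompact (isCompact_closedBall c 2) ?_
    intro y hy
    by_contra hne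
    refine hy ?_
    have h0 : cutoffProfile c y = 0 :=
      (cutoffProfile c).zero_of_le_dist (le_of_lt (not_le.1 hne))
    simp [hu, h0]
  have hGnn : ∀ y, 0 ≤ ∫ x in (0 : ℝ)..1, u y x := fun y =>
    intervalIntegral.integral_nonneg zero_le_one fun x _ => hunn y x
  have hint : ∫ y : ℝ, ∫ x in (0 : ℝ)..1, u y x = 0 := by
    rw [cylinderInt] at h1
    simp only [hval, intervalIntegral.integral_ofReal, integral_complex_ofReal] at h1
    simpa using h1
  have hG0 : ∫ x in (0 : ℝ)..1, u c x = 0 := by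
    by_contra hne
    have := hGcont.integral_pos_of_hasCompactSupport_nonneg_nonzero (μ := volume) hGsupp
      hGnn hne
    exact this.ne' hint
  have hx : ∀ x ∈ Set.Icc (0 : ℝ) 1, u c x = 0 := by
    intro x hx
    by_contra hne
    have := intervalIntegral.integral_pos (a := 0) (b := 1) (f := u c) zero_lt_one
      (hucont.comp (by fun_prop : Continuous fun x : ℝ => (c, x))).continuousOn
      (fun x _ => hunn c x) ⟨x, hx, lt_of_le_of_ne (hunn c x) (Ne.symm hne)⟩
    exact this.ne' hG0
  have hper : Function.Periodic (g : ℂ → ℂ) 1 := g.2.2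
  -- Vanishing is known for real part in `[0, 1]`; periodicity transports it to `z₀`.
  have h2 := hx (Int.fract z₀.re) ⟨Int.fract_nonneg _, (Int.fract_lt_one _).le⟩
  have h3 : cutoffProfile c c = 1 := (cutoffProfile c).one_of_mem_closedBall
    (Metric.mem_closedBall_self zero_le_one)
  have h4 : ((Int.fract z₀.re : ℝ) : ℂ) + c * I = z₀ - (⌊z₀.re⌋ : ℂ) := by
    rw [hc, ← Int.self_sub_floor]
    apply Complex.ext <;> simp
  simp only [hu, h3, one_mul, h4, normSq_eq_zero] at h2
  have h5 := hper.sub_int_mul_eq (x := z₀) ⌊z₀.re⌋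
  rw [mul_one] at h5
  rwa [h5] at h2

/-! ### Holomorphic functions -/

theorem differentiable_of_delzbar {f : Smooth} (hf : delzbar f = 0) :
    Differentiable ℂ (f : ℂ → ℂ) := by
  intro z
  refine differentiableAt_complex_iff_differentiableAt_real.2 ⟨differentiable_smooth f z, ?_⟩
  have h : (delzbar f : ℂ → ℂ) z = 0 := by rw [hf]; rfl
  rw [delzbar_apply] at h
  have h2 : fderiv ℝ (f : ℂ → ℂ) z 1 + I * fderiv ℝ (f : ℂ → ℂ) z I = 0 := by
    simpa using h
  rw [smul_eq_mul]
  linear_combination (-I) * h2 + fderiv ℝ (f : ℂ → ℂ) z I * I_mul_I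

/-- The function `z ↦ e^{2πikz}`. -/
def expFun (k : ℤ) : Smooth :=
  ⟨fun z => exp (2 * Real.pi * I * k * z),
    ((Complex.contDiff_exp (𝕜 := ℂ)).comp (contDiff_const.mul contDiff_id)).restrict_scalars ℝ,
    fun z => by
      change exp (2 * Real.pi * I * k * (z + 1)) = exp (2 * Real.pi * I * k * z)
      rw [mul_add, mul_one, exp_add, mul_comm _ (k : ℂ), exp_int_mul_two_pi_mul_I, mul_one]⟩

theorem delzbar_expFun (k : ℤ) : delzbar (expFun k) = 0 := by
  refine smooth_ext fun z => ?_
  rw [delzbar_apply]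
  have h : DifferentiableAt ℂ (expFun k : ℂ → ℂ) z :=
    ((differentiable_id.const_mul (2 * Real.pi * I * k)).cexp z)
  have h2 := (differentiableAt_complex_iff_differentiableAt_real.1 h).2
  rw [h2, smul_eq_mul, ← mul_assoc, I_mul_I]
  simp

/-- The hypothesis says that all Fourier coefficients on the circle vanish, so `f` is zero on the
real line, and the identity theorem extends this to the plane. -/
theorem eq_zero_of_circleInt_expFun {f : Smooth} (hf : delzbar f = 0)
    (h : ∀ k, circleInt (expFun k * f) = 0) : f = 0 := by
  have : Fact (0 < (1 : ℝ)) := ⟨one_pos⟩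
  have hper : Function.Periodic (fun x : ℝ => (f : ℂ → ℂ) x) 1 := fun x => by
    have := f.2.2 x
    simpa using this
  let F : C(AddCircle (1 : ℝ), ℂ) :=
    ⟨hper.lift, continuous_coinduced_dom.2 ((continuous_smooth f).comp continuous_ofReal)⟩
  have hcoeff : ∀ n, fourierCoeff F n = 0 := by
    intro n
    rw [fourierCoeff_eq_intervalIntegral F n 0]
    have h1 := h (-n)
    have h2 : ∀ x : ℝ, (fourier (-n) (x : AddCircle (1 : ℝ))) • F (x : AddCircle (1 : ℝ)) =
        ((expFun (-n) * f : Smooth) : ℂ → ℂ) x := by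
      intro x
      rw [fourier_coe_apply]
      change exp _ * (f : ℂ → ℂ) x = exp _ * (f : ℂ → ℂ) x
      simp
    simp only [h2, zero_add]
    change (1 / 1 : ℝ) • circleInt (expFun (-n) * f) = 0
    rw [h1, smul_zero]
  have hreal : ∀ x : ℝ, (f : ℂ → ℂ) x = 0 := by
    intro x
    -- Zero coefficients are summable, so the Fourier series converges pointwise to the function.
    have hs : Summable (fourierCoeff F) := by
      rw [show fourierCoeff F = fun _ => 0 from funext hcoeff]
      exact summable_zero
    have h1 := has_pointwise_sum_fourier_series_of_summable hs (x : AddCircle (1 : ℝ))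
    simp only [hcoeff, zero_smul] at h1
    exact h1.unique hasSum_zero
  have han : AnalyticOnNhd ℂ (f : ℂ → ℂ) Set.univ :=
    (differentiable_of_delzbar hf).differentiableOn.analyticOnNhd isOpen_univ
  have hz : (f : ℂ → ℂ) = 0 := by
    refine han.eq_of_frequently_eq (z₀ := 0) (g := 0) (fun _ _ => analyticAt_const) ?_
    have ht : Tendsto (fun x : ℝ => (x : ℂ)) (𝓝[≠] 0) (𝓝[≠] 0) := by
      refine tendsto_nhdsWithin_iff.2 ⟨?_, ?_⟩
      · exact (continuous_ofReal.tendsto' 0 0 (by simp)).mono_left nhdsWithin_le_nhds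
      · filter_upwards [self_mem_nhdsWithin] with x hx
        simpa using hx
    exact ht.frequently (Eventually.of_forall hreal).frequently
  exact Subtype.ext hz

end BCOV

/-! ### Grassmann parameters and Dolbeault forms. -/

namespace BCOV

open Filter Topology

/-! ### Grassmann parameters -/

section Grassmann

variable {M : Type*} [AddCommGroup M] [Module ℂ M]

theorem exterior_left_induction {C : ExteriorAlgebra ℂ M → Prop}
    (algebraMap : ∀ r : ℂ, C (algebraMap ℂ _ r)) (add : ∀ x y, C x → C y → C (x + y))
    (ι_mul : ∀ x m, C x → C (ExteriorAlgebra.ι ℂ m * x)) (x : ExteriorAlgebra ℂ M) : C x := by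
  induction x using CliffordAlgebra.left_induction with
  | algebraMap r => exact algebraMap r
  | add x y hx hy => exact add x y hx hy
  | ι_mul x m hx => exact ι_mul x m hx

/-- Contraction with a linear form. -/
def contract (d : Module.Dual ℂ M) : ExteriorAlgebra ℂ M →ₗ[ℂ] ExteriorAlgebra ℂ M :=
  CliffordAlgebra.contractLeft (Q := (0 : QuadraticForm ℂ M)) d

theorem contract_algebraMap (d : Module.Dual ℂ M) (r : ℂ) :
    contract d (algebraMap ℂ _ r) = 0 := CliffordAlgebra.contractLeft_algebraMap _ _ _

theorem contract_ι_mul (d : Module.Dual ℂ M) (m : M) (x : ExteriorAlgebra ℂ M) :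
    contract d (ExteriorAlgebra.ι ℂ m * x) = d m • x - ExteriorAlgebra.ι ℂ m * contract d x :=
  CliffordAlgebra.contractLeft_ι_mul _ _ _

end Grassmann

/-- The odd parameter `θ_j`. -/
def theta (j : ℕ) : Param := ExteriorAlgebra.ι ℂ (Finsupp.single j 1)

theorem contract_finite (y : Param) :
    {j : ℕ | contract (Finsupp.lapply j : (ℕ →₀ ℂ) →ₗ[ℂ] ℂ) y ≠ 0}.Finite := by
  induction y using exterior_left_induction with
  | algebraMap r => simp [contract_algebraMap]
  | add x y hx hy =>
    refine (hx.union hy).subset fun j hj => ?_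
    by_contra hne
    simp only [Set.mem_union, Set.mem_ofPred_eq, not_or, not_not] at hne
    exact hj (by rw [map_add, hne.1, hne.2, add_zero])
  | ι_mul x m hx =>
    refine (hx.union m.support.finite_toSet).subset fun j hj => ?_
    by_contra hne
    simp only [Set.mem_union, Set.mem_ofPred_eq, not_or, not_not, Finset.mem_coe,
      Finsupp.mem_support_iff] at hne
    refine hj ?_
    rw [contract_ι_mul, hne.1, mul_zero, sub_zero, Finsupp.lapply_apply, hne.2, zero_smul]

/-- An element of the Grassmann algebra annihilated by all odd parameters is zero. -/
theorem eq_zero_of_theta_mul {y : Param} (h : ∀ j, theta j * y = 0) : y = 0 := by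
  -- For a `θ_j` whose contraction kills `y`, contracting `θ_j y` gives back `y`.
  obtain ⟨j, hj⟩ := (contract_finite y).exists_notMem
  have hj' : contract (Finsupp.lapply j : (ℕ →₀ ℂ) →ₗ[ℂ] ℂ) y = 0 := by simpa using hj
  have h2 := contract_ι_mul (Finsupp.lapply j) (Finsupp.single j 1) y
  have h3 : ExteriorAlgebra.ι ℂ (Finsupp.single j (1 : ℂ)) * y = 0 := h j
  rw [h3, map_zero, hj', mul_zero, sub_zero, Finsupp.lapply_apply, Finsupp.single_eq_same,
    one_smul] at h2
  exact h2.symm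

theorem theta_isHomog (j : ℕ) : (theta j).IsHomog 1 := by
  rw [Param.IsHomog, theta, ZMod.val_one, pow_one, neg_one_smul]
  exact CliffordAlgebra.involute_ι _

theorem one_isHomog : Param.IsHomog 0 1 := by
  rw [Param.IsHomog, map_one, ZMod.val_zero, pow_zero, one_smul]

/-- Parameters of parity `p` separate the elements of the Grassmann algebra. -/
theorem eq_zero_of_homog_mul (p : ZMod 2) {y : Param}
    (h : ∀ η : Param, η.IsHomog p → η * y = 0) : y = 0 := by
  rcases zmod_two_cases p with rfl | rfl
  · simpa using h 1 one_isHomog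
  · exact eq_zero_of_theta_mul fun j => h _ (theta_isHomog j)

theorem inclParam_ι (v : ℕ →₀ ℂ) :
    inclParam (ExteriorAlgebra.ι ℂ v) = ExteriorAlgebra.ι ℂ ((0 : ℂ), v) :=
  ExteriorAlgebra.map_apply_ι _ _

theorem functionPart_ι (v : ℂ × (ℕ →₀ ℂ)) :
    functionPart (ExteriorAlgebra.ι ℂ v) = ExteriorAlgebra.ι ℂ v.2 :=
  ExteriorAlgebra.map_apply_ι _ _

theorem functionPart_inclParam (y : Param) : functionPart (inclParam y) = y := by
  induction y using ExteriorAlgebra.induction with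
  | algebraMap r => rw [AlgHom.commutes, AlgHom.commutes]
  | ι v => rw [inclParam_ι, functionPart_ι]
  | mul x y hx hy => rw [map_mul, map_mul, hx, hy]
  | add x y hx hy => rw [map_add, map_add, hx, hy]

theorem formPart_ι_mul (v : ℂ × (ℕ →₀ ℂ)) (x : FormParam) :
    formPart (ExteriorAlgebra.ι ℂ v * x) =
      v.1 • functionPart x - ExteriorAlgebra.ι ℂ v.2 * formPart x := by
  change functionPart (contract (LinearMap.fst ℂ ℂ (ℕ →₀ ℂ)) _) = _
  rw [contract_ι_mul, map_sub, map_smul, map_mul, functionPart_ι]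
  rfl

theorem formPart_dzbar_mul (x : FormParam) : formPart (dzbar * x) = functionPart x := by
  rw [dzbar, formPart_ι_mul, map_zero, zero_mul, sub_zero, one_smul]

theorem ι_prod (v : ℂ × (ℕ →₀ ℂ)) :
    ExteriorAlgebra.ι ℂ v = v.1 • dzbar + inclParam (ExteriorAlgebra.ι ℂ v.2) := by
  rw [inclParam_ι, dzbar, ← map_smul, ← map_add]
  simp

theorem dzbar_mul_dzbar : dzbar * dzbar = 0 := ExteriorAlgebra.ι_sq_zero _

/-- The decomposition `F = F₀ + dz̄ F₁`. -/
theorem formParam_decomp (x : FormParam) :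
    x = inclParam (functionPart x) + dzbar * inclParam (formPart x) := by
  induction x using exterior_left_induction with
  | algebraMap r =>
    have h : formPart (algebraMap ℂ FormParam r) = 0 := by
      change functionPart (contract (LinearMap.fst ℂ ℂ (ℕ →₀ ℂ)) _) = 0
      rw [contract_algebraMap, map_zero]
    rw [h, map_zero, mul_zero, add_zero, AlgHom.commutes, AlgHom.commutes]
  | add x y hx hy =>
    rw [map_add, map_add, map_add, map_add, mul_add, add_add_add_comm, ← hx, ← hy]
  | ι_mul x v hx =>
    have hc : inclParam (ExteriorAlgebra.ι ℂ v.2) * dzbar =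
        -(dzbar * inclParam (ExteriorAlgebra.ι ℂ v.2)) := by
      rw [inclParam_ι, dzbar]
      exact eq_neg_of_add_eq_zero_left (ExteriorAlgebra.ι_add_mul_swap _ _)
    rw [formPart_ι_mul, map_mul, functionPart_ι, map_mul, map_sub, map_smul, map_mul]
    conv_lhs => rw [hx, ι_prod v]
    rw [add_mul, mul_add, mul_add, ← mul_assoc (inclParam _) dzbar, hc, smul_mul_assoc,
      smul_mul_assoc, ← mul_assoc dzbar dzbar, dzbar_mul_dzbar, zero_mul, smul_zero, mul_sub,
      mul_smul_comm, neg_mul, mul_assoc]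
    abel

/-- The `dz̄`-coefficient is seen directly, the rest after multiplication by `dz̄`. The factor `θ_j`
keeps the multiplier even, as required of a variation of `λ`. -/
theorem formParam_eq_zero {x : FormParam} (h : formPart x = 0)
    (h' : ∀ j, formPart (dzbar * inclParam (theta j) * x) = 0) : x = 0 := by
  have h2 : functionPart x = 0 := eq_zero_of_theta_mul fun j => by
    have := h' j
    rwa [mul_assoc, formPart_dzbar_mul, map_mul, functionPart_inclParam] at this
  rw [formParam_decomp x, h, h2, map_zero, mul_zero, add_zero]

theorem involute_inclParam (y : Param) :
    CliffordAlgebra.involute (Q := (0 : QuadraticForm ℂ (ℂ × (ℕ →₀ ℂ)))) (inclParam y) =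
      inclParam (CliffordAlgebra.involute (Q := (0 : QuadraticForm ℂ (ℕ →₀ ℂ))) y) := by
  have hι : ∀ {M : Type} [AddCommGroup M] [Module ℂ M] (v : M),
      CliffordAlgebra.involute (Q := (0 : QuadraticForm ℂ M)) (ExteriorAlgebra.ι ℂ v) =
        -ExteriorAlgebra.ι ℂ v := fun v => CliffordAlgebra.involute_ι v
  induction y using ExteriorAlgebra.induction with
  | algebraMap r => simp only [AlgHom.commutes]
  | ι v => rw [inclParam_ι, hι, hι, map_neg, inclParam_ι]
  | mul x y hx hy => rw [map_mul, map_mul, map_mul, map_mul, hx, hy]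
  | add x y hx hy => rw [map_add, map_add, map_add, map_add, hx, hy]

theorem functionPart_involute (x : FormParam) :
    functionPart (CliffordAlgebra.involute (Q := (0 : QuadraticForm ℂ (ℂ × (ℕ →₀ ℂ)))) x) =
      CliffordAlgebra.involute (Q := (0 : QuadraticForm ℂ (ℕ →₀ ℂ))) (functionPart x) := by
  have hι : ∀ {M : Type} [AddCommGroup M] [Module ℂ M] (v : M),
      CliffordAlgebra.involute (Q := (0 : QuadraticForm ℂ M)) (ExteriorAlgebra.ι ℂ v) =
        -ExteriorAlgebra.ι ℂ v := fun v => CliffordAlgebra.involute_ι v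
  induction x using ExteriorAlgebra.induction with
  | algebraMap r => simp only [AlgHom.commutes]
  | ι v => rw [hι, map_neg, functionPart_ι, hι]
  | mul x y hx hy => rw [map_mul, map_mul, map_mul, map_mul, hx, hy]
  | add x y hx hy => rw [map_add, map_add, map_add, map_add, hx, hy]

/-! ### Forms -/

section Slice

variable {M : Type*} [AddCommGroup M] [Module ℂ M]

/-- Application of a linear form on the coefficients. -/
def slice (l : M →ₗ[ℂ] ℂ) : Smooth ⊗[ℂ] M →ₗ[ℂ] Smooth :=
  (TensorProduct.rid ℂ Smooth).toLinearMap ∘ₗ TensorProduct.map LinearMap.id l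

theorem slice_tmul (l : M →ₗ[ℂ] ℂ) (f : Smooth) (m : M) : slice l (f ⊗ₜ[ℂ] m) = l m • f := by
  change TensorProduct.rid ℂ Smooth (f ⊗ₜ[ℂ] l m) = _
  rw [TensorProduct.rid_tmul]

theorem eq_zero_of_slice {G : Smooth ⊗[ℂ] M} (h : ∀ l, slice l G = 0) : G = 0 := by
  classical
  let b := Module.Basis.ofVectorSpace ℂ M
  let e : Smooth ⊗[ℂ] M ≃ₗ[ℂ] _ →₀ Smooth := TensorProduct.equivFinsuppOfBasisRight b
  refine (LinearEquiv.map_eq_zero_iff e).1 (Finsupp.ext fun i => ?_)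
  rw [Finsupp.zero_apply, ← h (b.coord i)]
  clear h
  induction G using TensorProduct.induction_on with
  | zero => rw [LinearEquiv.map_zero, LinearMap.map_zero, Finsupp.zero_apply]
  | add x y hx hy => rw [LinearEquiv.map_add, LinearMap.map_add, Finsupp.add_apply, hx, hy]
  | tmul f m => rw [slice_tmul]; exact TensorProduct.equivFinsuppOfBasisRight_apply_tmul_apply _ _ _ _

theorem slice_rTensor (l : M →ₗ[ℂ] ℂ) (d : Smooth →ₗ[ℂ] Smooth) (G : Smooth ⊗[ℂ] M) :
    slice l (LinearMap.rTensor M d G) = d (slice l G) := by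
  induction G using TensorProduct.induction_on with
  | zero => simp only [map_zero]
  | add x y hx hy => simp only [map_add, hx, hy]
  | tmul f m => rw [LinearMap.rTensor_tmul, slice_tmul, slice_tmul, map_smul]

end Slice

section RTensor

variable {B : Type*} [Ring B] [Algebra ℂ B]

theorem rTensor_mul {d : Smooth →ₗ[ℂ] Smooth} (hd : ∀ f g, d (f * g) = d f * g + f * d g)
    (F G : Smooth ⊗[ℂ] B) :
    LinearMap.rTensor B d (F * G) = LinearMap.rTensor B d F * G + F * LinearMap.rTensor B d G := by
  induction F using TensorProduct.induction_on with
  | zero => simp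
  | add x y hx hy => rw [add_mul, map_add, hx, hy, map_add, add_mul, add_mul]; abel
  | tmul f m =>
    induction G using TensorProduct.induction_on with
    | zero => simp
    | add x y hx hy => rw [mul_add, map_add, hx, hy, map_add, mul_add, mul_add]; abel
    | tmul g n =>
      simp only [Algebra.TensorProduct.tmul_mul_tmul, LinearMap.rTensor_tmul, hd,
        TensorProduct.add_tmul]

theorem slice_mul_tmul (l : B →ₗ[ℂ] ℂ) (f : Smooth) (w : B) (G : Smooth ⊗[ℂ] B) :
    slice l (f ⊗ₜ[ℂ] w * G) = f * slice (l ∘ₗ LinearMap.mulLeft ℂ w) G := by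
  induction G using TensorProduct.induction_on with
  | zero => simp
  | add x y hx hy => rw [mul_add, map_add, hx, hy, map_add, mul_add]
  | tmul g n =>
    rw [Algebra.TensorProduct.tmul_mul_tmul, slice_tmul, slice_tmul, mul_smul_comm]
    rfl

end RTensor

theorem formDelz_mul (F G : Form) : formDelz (F * G) = formDelz F * G + F * formDelz G :=
  rTensor_mul delz_mul F G

theorem formDelz_tmul (f : Smooth) (w : FormParam) :
    formDelz (f ⊗ₜ[ℂ] w) = delz f ⊗ₜ[ℂ] w := rfl

theorem formDelz_iterate_add (m : ℕ) (F G : Form) :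
    formDelz^[m] (F + G) = formDelz^[m] F + formDelz^[m] G := iterate_map_add formDelz m F G

theorem formDelz_iterate_smul (m : ℕ) (c : ℂ) (F : Form) :
    formDelz^[m] (c • F) = c • formDelz^[m] F := by
  induction m generalizing F with
  | zero => rfl
  | succ m ih => rw [Function.iterate_succ_apply, map_smul, ih, Function.iterate_succ_apply]

theorem formDelz_iterate_tmul (m : ℕ) (f : Smooth) (w : FormParam) :
    formDelz^[m] (f ⊗ₜ[ℂ] w) = delz^[m] f ⊗ₜ[ℂ] w := by
  induction m generalizing f with
  | zero => rfl
  | succ m ih => rw [Function.iterate_succ_apply, formDelz_tmul, ih, Function.iterate_succ_apply]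

theorem delz_one : delz 1 = 0 := by
  have h := delz_mul 1 1
  rw [mul_one, mul_one, one_mul] at h
  exact left_eq_add.1 h

theorem delzbar_one : delzbar 1 = 0 := by
  have h := delzbar_mul 1 1
  rw [mul_one, mul_one, one_mul] at h
  exact left_eq_add.1 h

/-- Setting `dz̄ = 0` in a form. -/
def bodyPart : Form →ₐ[ℂ] Smooth ⊗[ℂ] Param :=
  Algebra.TensorProduct.map (AlgHom.id ℂ Smooth) functionPart

theorem bodyPart_tmul (f : Smooth) (w : FormParam) :
    bodyPart (f ⊗ₜ[ℂ] w) = f ⊗ₜ[ℂ] functionPart w := rfl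

theorem apply_formCircleInt (l : Param →ₗ[ℂ] ℂ) (F : Form) :
    l (formCircleInt F) = circleInt (slice l (bodyPart F)) := by
  induction F using TensorProduct.induction_on with
  | zero => simp only [map_zero]
  | add x y hx hy => simp only [map_add, hx, hy]
  | tmul f w =>
    rw [bodyPart_tmul, slice_tmul, map_smul]
    change l (circleInt f • functionPart w) = _
    rw [map_smul, smul_eq_mul, smul_eq_mul, mul_comm]

theorem bodyPart_formDelz (F : Form) :
    bodyPart (formDelz F) = LinearMap.rTensor Param delz (bodyPart F) := by
  induction F using TensorProduct.induction_on with
  | zero => simp only [map_zero]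
  | add x y hx hy => simp only [map_add, hx, hy]
  | tmul f w => rfl

/-- The coefficient of `dz̄` in `∂̄ F`, modulo `dz̄`. -/
def dbarBody : Form →ₗ[ℂ] Smooth ⊗[ℂ] Param :=
  LinearMap.rTensor Param delzbar ∘ₗ bodyPart.toLinearMap

theorem dbarBody_apply (F : Form) :
    dbarBody F = LinearMap.rTensor Param delzbar (bodyPart F) := rfl

theorem dbarBody_mul (F G : Form) :
    dbarBody (F * G) = dbarBody F * bodyPart G + bodyPart F * dbarBody G := by
  rw [dbarBody_apply, map_mul, rTensor_mul delzbar_mul]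
  rfl

theorem dbarBody_formDelz (F : Form) :
    dbarBody (formDelz F) = LinearMap.rTensor Param delz (dbarBody F) := by
  induction F using TensorProduct.induction_on with
  | zero => simp only [map_zero]
  | add x y hx hy => simp only [map_add, hx, hy]
  | tmul f w =>
    change delzbar (delz f) ⊗ₜ[ℂ] functionPart w = delz (delzbar f) ⊗ₜ[ℂ] functionPart w
    rw [delzbar_delz]

theorem dbarBody_formDelz_iterate {F : Form} (hF : dbarBody F = 0) (m : ℕ) :
    dbarBody (formDelz^[m] F) = 0 := by
  induction m generalizing F with
  | zero => exact hF
  | succ m ih =>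
    rw [Function.iterate_succ_apply]
    exact ih (by rw [dbarBody_formDelz, hF, map_zero])

theorem formDelbar_tmul (f : Smooth) (w : FormParam) :
    formDelbar (f ⊗ₜ[ℂ] w) = delzbar f ⊗ₜ[ℂ] (dzbar * w) := by
  change (1 : Smooth) ⊗ₜ[ℂ] dzbar * delzbar f ⊗ₜ[ℂ] w = _
  rw [Algebra.TensorProduct.tmul_mul_tmul, one_mul]

/-- Since `dz̄² = 0`, the equation `∂̄F = 0` constrains only the part of `F` free of `dz̄`, the part
that the circle integral sees. -/
theorem formDelbar_eq_zero_iff (F : Form) : formDelbar F = 0 ↔ dbarBody F = 0 := by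
  constructor
  · intro h
    have h2 : LinearMap.lTensor Smooth formPart (formDelbar F) = dbarBody F := by
      clear h
      induction F using TensorProduct.induction_on with
      | zero => simp only [map_zero]
      | add x y hx hy => simp only [map_add, hx, hy]
      | tmul f w =>
        rw [formDelbar_tmul, LinearMap.lTensor_tmul, formPart_dzbar_mul]
        rfl
    rw [← h2, h, map_zero]
  · intro h
    have h2 : LinearMap.lTensor Smooth (LinearMap.mulLeft ℂ dzbar ∘ₗ inclParam.toLinearMap)
        (dbarBody F) = formDelbar F := by
      clear h
      induction F using TensorProduct.induction_on with
      | zero => simp only [map_zero]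
      | add x y hx hy => simp only [map_add, hx, hy]
      | tmul f w =>
        rw [formDelbar_tmul]
        change delzbar f ⊗ₜ[ℂ] (dzbar * inclParam (functionPart w)) = _
        conv_rhs => rw [formParam_decomp w]
        rw [mul_add, ← mul_assoc dzbar dzbar, dzbar_mul_dzbar, zero_mul, add_zero]
    rw [← h2, h, map_zero]

/-- The reason why currents ignore total derivatives: in the scalar slices `∂_z` may be replaced by
`∂_x`, whose period is zero. -/
theorem formCircleInt_formDelz {F : Form} (hF : dbarBody F = 0) :
    formCircleInt (formDelz F) = 0 := by
  rw [← Module.forall_dual_apply_eq_zero_iff ℂ]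
  intro l
  rw [apply_formCircleInt, bodyPart_formDelz, slice_rTensor, delz_eq, ← slice_rTensor l delzbar]
  rw [← dbarBody_apply, hF, map_zero, sub_zero, circleInt_dirDeriv_one]

theorem formCircleInt_constForm_mul (η : Param) (F : Form) :
    formCircleInt (constForm η * F) = η * formCircleInt F := by
  induction F using TensorProduct.induction_on with
  | zero => simp only [map_zero, mul_zero]
  | add x y hx hy => simp only [map_add, mul_add, hx, hy]
  | tmul f w =>
    rw [constForm, Algebra.TensorProduct.tmul_mul_tmul, one_mul]
    change circleInt f • functionPart (inclParam η * w) = η * (circleInt f • functionPart w)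
    rw [map_mul, functionPart_inclParam, mul_smul_comm]

theorem dbarBody_constForm (η : Param) : dbarBody (constForm η) = 0 := by
  change delzbar 1 ⊗ₜ[ℂ] functionPart (inclParam η) = 0
  rw [delzbar_one, TensorProduct.zero_tmul]

theorem formDelz_constForm_mul (η : Param) (F : Form) :
    formDelz (constForm η * F) = constForm η * formDelz F := by
  have h : formDelz (constForm η) = 0 := by
    rw [constForm, formDelz_tmul, delz_one, TensorProduct.zero_tmul]
  rw [formDelz_mul, h, zero_mul, zero_add]

theorem formDelz_iterate_constForm_mul (η : Param) (m : ℕ) (F : Form) :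
    formDelz^[m] (constForm η * F) = constForm η * formDelz^[m] F := by
  induction m generalizing F with
  | zero => rfl
  | succ m ih => rw [Function.iterate_succ_apply, formDelz_constForm_mul, ih,
      Function.iterate_succ_apply]

theorem formParity_constForm {p : ZMod 2} {η : Param} (hη : η.IsHomog p) :
    formParity (constForm η) = (-1 : ℂ) ^ p.val • constForm η := by
  change (1 : Smooth) ⊗ₜ[ℂ] CliffordAlgebra.involute
    (Q := (0 : QuadraticForm ℂ (ℂ × (ℕ →₀ ℂ)))) (inclParam η) = _
  rw [involute_inclParam, hη, map_smul, TensorProduct.tmul_smul]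
  rfl

theorem involute_formCircleInt (F : Form) :
    CliffordAlgebra.involute (Q := (0 : QuadraticForm ℂ (ℕ →₀ ℂ))) (formCircleInt F) =
      formCircleInt (formParity F) := by
  induction F using TensorProduct.induction_on with
  | zero => simp only [map_zero]
  | add x y hx hy => simp only [map_add, hx, hy]
  | tmul f w =>
    change CliffordAlgebra.involute (Q := (0 : QuadraticForm ℂ (ℕ →₀ ℂ)))
      (circleInt f • functionPart w) = circleInt f • functionPart (CliffordAlgebra.involute
        (Q := (0 : QuadraticForm ℂ (ℂ × (ℕ →₀ ℂ)))) w)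
    rw [map_smul, functionPart_involute]

/-! ### Forms of compact support -/

theorem formSuppIn_mono {R R' : ℝ} (h : R ≤ R') : formSuppIn R ≤ formSuppIn R' := by
  rintro _ ⟨F, rfl⟩
  refine ⟨LinearMap.rTensor FormParam (Submodule.inclusion (suppIn_mono h)) F, ?_⟩
  rw [← LinearMap.comp_apply, ← LinearMap.rTensor_comp]
  rfl

@[elab_as_elim]
theorem formSuppIn_induction {R : ℝ} {C : Form → Prop} {F : Form} (hF : F ∈ formSuppIn R)
    (zero : C 0) (add : ∀ F G, C F → C G → C (F + G))
    (tmul : ∀ f ∈ suppIn R, ∀ w, C (f ⊗ₜ[ℂ] w)) : C F := by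
  obtain ⟨F, rfl⟩ := hF
  induction F using TensorProduct.induction_on with
  | zero => rwa [map_zero]
  | add x y hx hy => rw [map_add]; exact add _ _ hx hy
  | tmul f w => exact tmul f f.2 w

theorem tmul_mem_formSuppIn {R : ℝ} {f : Smooth} (hf : f ∈ suppIn R) (w : FormParam) :
    f ⊗ₜ[ℂ] w ∈ formSuppIn R := ⟨(⟨f, hf⟩ : suppIn R) ⊗ₜ[ℂ] w, rfl⟩

theorem mul_mem_formSuppIn {R : ℝ} {F : Form} (hF : F ∈ formSuppIn R) (G : Form) :
    F * G ∈ formSuppIn R := by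
  refine formSuppIn_induction hF ?_ ?_ ?_
  · rw [zero_mul]; exact Submodule.zero_mem _
  · intro F F' h h'; rw [add_mul]; exact Submodule.add_mem _ h h'
  · intro f hf w
    induction G using TensorProduct.induction_on with
    | zero => rw [mul_zero]; exact Submodule.zero_mem _
    | add x y hx hy => rw [mul_add]; exact Submodule.add_mem _ hx hy
    | tmul g v =>
      rw [Algebra.TensorProduct.tmul_mul_tmul]
      exact tmul_mem_formSuppIn (mul_mem_suppIn hf g) _

theorem formDelz_mem_formSuppIn {R : ℝ} {F : Form} (hF : F ∈ formSuppIn R) :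
    formDelz F ∈ formSuppIn R := by
  refine formSuppIn_induction hF ?_ ?_ ?_
  · rw [map_zero]; exact Submodule.zero_mem _
  · intro F F' h h'; rw [map_add]; exact Submodule.add_mem _ h h'
  · intro f hf w
    exact tmul_mem_formSuppIn (delz_mem_suppIn hf) w

theorem formDelz_iterate_mem_formSuppIn {R : ℝ} {F : Form} (hF : F ∈ formSuppIn R) (m : ℕ) :
    formDelz^[m] F ∈ formSuppIn R := by
  induction m generalizing F with
  | zero => exact hF
  | succ m ih => exact ih (formDelz_mem_formSuppIn hF)

theorem slice_mem_suppIn (l : FormParam →ₗ[ℂ] ℂ) {R : ℝ} {F : Form} (hF : F ∈ formSuppIn R) :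
    slice l F ∈ suppIn R := by
  refine formSuppIn_induction hF ?_ ?_ ?_
  · rw [map_zero]; exact Submodule.zero_mem _
  · intro F F' h h'; rw [map_add]; exact Submodule.add_mem _ h h'
  · intro f hf w
    rw [slice_tmul]
    exact Submodule.smul_mem _ _ hf

theorem formCylinderInt_eq (F : Form) (l : Param →ₗ[ℂ] ℂ) :
    formCylinderInt F l = cylinderInt (slice (l ∘ₗ formPart) F) := rfl

/-- Integration over the cylinder extends to a linear form on all forms. -/
theorem exists_linear_formCylinderInt (R : ℝ) (l : Param →ₗ[ℂ] ℂ) :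
    ∃ T : Form →ₗ[ℂ] ℂ, ∀ F ∈ formSuppIn R, T F = formCylinderInt F l := by
  -- The integral is known to be additive only on a fixed support strip. An arbitrary linear
  -- extension of it lets the purely algebraic variation formulas apply.
  obtain ⟨T, hT⟩ := (cylinderIntOn R ∘ₗ ((slice (l ∘ₗ formPart)).restrict
    fun F (hF : F ∈ formSuppIn R) => slice_mem_suppIn _ hF)).exists_extend
  exact ⟨T, fun F hF => DFunLike.congr_fun hT ⟨F, hF⟩⟩

theorem formCylinderInt_formDelz {R : ℝ} {F : Form} (hF : F ∈ formSuppIn R)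
    (l : Param →ₗ[ℂ] ℂ) : formCylinderInt (formDelz F) l = 0 := by
  rw [formCylinderInt_eq, formDelz, slice_rTensor, cylinderInt_delz (slice_mem_suppIn _ hF)]

/-! ### Evaluation at points of the cylinder -/

/-- Evaluation of forms at a point. -/
def evalAt (z : ℂ) : Form →ₐ[ℂ] FormParam :=
  (Algebra.TensorProduct.lid ℂ FormParam).toAlgHom.comp
    (Algebra.TensorProduct.map ((Pi.evalAlgHom ℂ (fun _ : ℂ => ℂ) z).comp Smooth.val)
      (AlgHom.id ℂ FormParam))

theorem evalAt_tmul (z : ℂ) (f : Smooth) (w : FormParam) :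
    evalAt z (f ⊗ₜ[ℂ] w) = (f : ℂ → ℂ) z • w := rfl

theorem slice_apply (l : FormParam →ₗ[ℂ] ℂ) (F : Form) (z : ℂ) :
    (slice l F : ℂ → ℂ) z = l (evalAt z F) := by
  induction F using TensorProduct.induction_on with
  | zero => rw [map_zero, map_zero, map_zero]; rfl
  | add x y hx hy => rw [map_add, map_add, map_add, ← hx, ← hy]; rfl
  | tmul f w =>
    rw [slice_tmul, evalAt_tmul, map_smul, smul_eq_mul, mul_comm]
    rfl

theorem eq_zero_of_evalAt {F : Form} (h : ∀ z, evalAt z F = 0) : F = 0 :=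
  eq_zero_of_slice fun l => smooth_ext fun z => by rw [slice_apply, h, map_zero]; rfl

/-- The two families of test forms are even, hence admissible variations of `λ`, and between them
detect both components of `G` at every point. -/
theorem eq_zero_of_formCylinderInt_mul {G : Form}
    (h : ∀ R, ∀ f ∈ suppIn R, ∀ l, formCylinderInt (f ⊗ₜ[ℂ] 1 * G) l = 0)
    (h' : ∀ R, ∀ f ∈ suppIn R, ∀ j l,
      formCylinderInt (f ⊗ₜ[ℂ] (dzbar * inclParam (theta j)) * G) l = 0) : G = 0 := by
  have key : ∀ w : FormParam, (∀ R, ∀ f ∈ suppIn R, ∀ l,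
      formCylinderInt (f ⊗ₜ[ℂ] w * G) l = 0) → ∀ z, formPart (w * evalAt z G) = 0 := by
    intro w hw z
    rw [← Module.forall_dual_apply_eq_zero_iff ℂ]
    intro l
    have h1 : slice ((l ∘ₗ formPart) ∘ₗ LinearMap.mulLeft ℂ w) G = 0 := by
      refine eq_zero_of_cylinderInt_mul fun R f hf => ?_
      rw [← slice_mul_tmul]
      exact hw R f hf l
    have h2 := slice_apply ((l ∘ₗ formPart) ∘ₗ LinearMap.mulLeft ℂ w) G z
    rw [h1] at h2
    exact h2.symm
  refine eq_zero_of_evalAt fun z => formParam_eq_zero ?_ fun j => ?_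
  · simpa using key 1 h z
  · exact key _ (fun R f hf => h' R f hf j) z

/-- Derivatives at `z` depend only on the germ at `z`, where the cutoff is one. -/
theorem evalAt_formDelz_iterate_cutoff (z : ℂ) (m : ℕ) (F : Form) :
    evalAt z (formDelz^[m] (cutoff z.im ⊗ₜ[ℂ] 1 * F)) = evalAt z (formDelz^[m] F) := by
  have hd : ∀ (m : ℕ) (f g : Smooth), (f : ℂ → ℂ) =ᶠ[𝓝 z] (g : ℂ → ℂ) →
      (delz^[m] f : ℂ → ℂ) =ᶠ[𝓝 z] (delz^[m] g : ℂ → ℂ) := by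
    intro m
    induction m with
    | zero => exact fun f g h => h
    | succ m ih => exact fun f g h => ih _ _ (delz_eventuallyEq h)
  induction F using TensorProduct.induction_on with
  | zero => rw [mul_zero]
  | add x y hx hy =>
    rw [mul_add, formDelz_iterate_add, formDelz_iterate_add, map_add, map_add, hx, hy]
  | tmul f w =>
    rw [Algebra.TensorProduct.tmul_mul_tmul, one_mul, formDelz_iterate_tmul,
      formDelz_iterate_tmul, evalAt_tmul, evalAt_tmul, (hd m (cutoff z.im * f) f ?_).eq_of_nhds]
    filter_upwards [cutoff_eventually z] with w hw
    change (cutoff z.im : ℂ → ℂ) w * (f : ℂ → ℂ) w = (f : ℂ → ℂ) w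
    rw [hw, one_mul]

end BCOV

/-! ### First variations, and the kernel of the current map. -/

namespace BCOV

variable {I : Type*}

/-! ### Evaluation of polynomials on fields -/

theorem evalField_gen (μ : SuperField I) (a : Gen I) : evalField μ (gen a) = symbolValue μ a :=
  liftGen_gen _ _ a

theorem evalField_congr {B : Type*} [Ring B] [Algebra ℂ B] (e : Form →ₐ[ℂ] B)
    {μ ν : SuperField I} (h : ∀ a, e (symbolValue μ a) = e (symbolValue ν a)) (x : SuperPoly I) :
    e (evalField μ x) = e (evalField ν x) :=
  DFunLike.congr_fun (SuperPoly.algHom_ext (f := e.comp (evalField μ)) (g := e.comp (evalField ν))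
    fun a => by simpa only [AlgHom.comp_apply, evalField_gen] using h a) x

theorem formDelz_symbolValue (μ : SuperField I) (a : Gen I) :
    formDelz (symbolValue μ a) = symbolValue μ (totalGen a) := by
  cases a <;> exact (Function.iterate_succ_apply' _ _ _).symm

theorem formDelz_algebraMap (r : ℂ) : formDelz (algebraMap ℂ Form r) = 0 := by
  rw [Algebra.algebraMap_eq_smul_one, map_smul, Algebra.TensorProduct.one_def, formDelz_tmul,
    delz_one, TensorProduct.zero_tmul, smul_zero]

theorem evalField_totalDer (μ : SuperField I) (x : SuperPoly I) :
    evalField μ (totalDer x) = formDelz (evalField μ x) := by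
  induction x using SuperPoly.induction with
  | algebraMap r =>
    rw [AlgHom.commutes, formDelz_algebraMap, Algebra.algebraMap_eq_smul_one, map_smul,
      isDer_totalDer.map_one, smul_zero, map_zero]
  | gen a => rw [totalDer_gen, evalField_gen, evalField_gen, formDelz_symbolValue]
  | mul x y hx hy => rw [isDer_totalDer, map_add, map_mul, map_mul, map_mul, formDelz_mul, hx, hy]
  | add x y hx hy => rw [map_add, map_add, map_add, map_add, hx, hy]

theorem evalField_totalDer_pow (μ : SuperField I) (m : ℕ) (x : SuperPoly I) :
    evalField μ ((totalDer ^ m) x) = formDelz^[m] (evalField μ x) := by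
  induction m with
  | zero => rfl
  | succ m ih =>
    rw [← totalDer_pow_succ, evalField_totalDer, ih, Function.iterate_succ_apply']

theorem formParity_symbolValue (μ : SuperField I) (a : Gen I) :
    formParity (symbolValue μ a) = (-1 : ℂ) ^ a.parity.val • symbolValue μ a := by
  rcases a with ⟨α, k, m⟩ | ⟨α, k, m⟩
  · simp only [symbolValue, Gen.parity, ZMod.val_zero, pow_zero, one_smul]
    rw [formParity_iterate, μ.2.1]
  · simp only [symbolValue, Gen.parity, ZMod.val_one, pow_one, neg_one_smul]
    rw [formParity_iterate, μ.2.2, formDelz_iterate_neg]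

theorem formParity_evalField (μ : SuperField I) (x : SuperPoly I) :
    formParity (evalField μ x) = evalField μ (polyParity x) :=
  DFunLike.congr_fun (SuperPoly.algHom_ext (f := formParity.comp (evalField μ))
    (g := (evalField μ).comp polyParity) fun a => by
      rw [AlgHom.comp_apply, AlgHom.comp_apply, evalField_gen, formParity_symbolValue, polyParity,
        liftGen_gen, map_smul, evalField_gen]) x

theorem formParity_evalField_of_mem (μ : SuperField I) {p : ZMod 2} {x : SuperPoly I}
    (hx : x ∈ parityPart I p) :
    formParity (evalField μ x) = (-1 : ℂ) ^ p.val • evalField μ x := by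
  rw [formParity_evalField, polyParity_of_mem hx, map_smul]

/-- Graded commutativity of homogeneous forms. -/
theorem form_mul_comm {p q : ZMod 2} {F G : Form} (hF : formParity F = (-1 : ℂ) ^ p.val • F)
    (hG : formParity G = (-1 : ℂ) ^ q.val • G) : F * G = koszul p q • (G * F) := by
  rcases zmod_two_cases p with rfl | rfl
  · rw [ZMod.val_zero, pow_zero, one_smul] at hF
    rw [koszul_zero_left, one_smul, form_comm_of_even hF]
  · rcases zmod_two_cases q with rfl | rfl
    · rw [ZMod.val_zero, pow_zero, one_smul] at hG
      rw [koszul_zero_right, one_smul, form_comm_of_even hG]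
    · rw [ZMod.val_one, pow_one, neg_one_smul] at hF hG
      have h : koszul 1 1 = -1 := by simp [koszul, ZMod.val_one]
      rw [h, neg_one_smul, form_anticomm_of_odd hG hF]

theorem symbolValue_mul_comm (μ ν : SuperField I) (a b : Gen I) :
    symbolValue μ a * symbolValue ν b =
      koszul a.parity b.parity • (symbolValue ν b * symbolValue μ a) :=
  form_mul_comm (formParity_symbolValue μ a) (formParity_symbolValue ν b)

/-! ### Variations -/

theorem polynomial_linear_mul {A : Type*} [Ring A] (a b c d : A) :
    (Polynomial.C a + Polynomial.X * Polynomial.C b) *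
      (Polynomial.C c + Polynomial.X * Polynomial.C d) =
    Polynomial.C (a * c) + Polynomial.X * Polynomial.C (a * d + b * c) +
      Polynomial.X * (Polynomial.X * Polynomial.C (b * d)) := by
  have h : ∀ e f : A, Polynomial.C e * (Polynomial.X * Polynomial.C f) =
      Polynomial.X * Polynomial.C (e * f) := fun e f => by
    rw [← mul_assoc, ← Polynomial.X_mul_C, mul_assoc, ← Polynomial.C_mul]
  simp only [add_mul, mul_add, h, mul_assoc, map_add, ← Polynomial.C_mul]
  abel

/-- The polynomial `s ↦ x(μ + s ν)`. -/
def evalLine (μ ν : SuperField I) : SuperPoly I →ₐ[ℂ] Polynomial Form :=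
  liftGen (fun a => Polynomial.C (symbolValue μ a) + Polynomial.X * Polynomial.C (symbolValue ν a))
    fun a b => by
      rw [polynomial_linear_mul, polynomial_linear_mul, symbolValue_mul_comm μ μ a b,
        symbolValue_mul_comm ν ν a b, symbolValue_mul_comm μ ν a b, symbolValue_mul_comm ν μ a b,
        ← smul_add, ← Polynomial.smul_C, ← Polynomial.smul_C, ← Polynomial.smul_C]
      simp only [mul_smul_comm, smul_add]
      rw [add_comm (symbolValue ν b * symbolValue μ a)]

theorem evalLine_gen (μ ν : SuperField I) (a : Gen I) : evalLine μ ν (gen a) =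
    Polynomial.C (symbolValue μ a) + Polynomial.X * Polynomial.C (symbolValue ν a) :=
  liftGen_gen _ _ a

theorem symbolValue_add_smul (μ ν : SuperField I) (s : ℂ) (a : Gen I) :
    symbolValue (μ + s • ν) a = symbolValue μ a + s • symbolValue ν a := by
  rcases a with ⟨α, k, m⟩ | ⟨α, k, m⟩
  · change formDelz^[m] (μ.1.1 α k + s • ν.1.1 α k) = _
    rw [formDelz_iterate_add, formDelz_iterate_smul]; rfl
  · change formDelz^[m] (μ.1.2 α k + s • ν.1.2 α k) = _
    rw [formDelz_iterate_add, formDelz_iterate_smul]; rfl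

theorem evalField_add_smul (μ ν : SuperField I) (s : ℂ) (x : SuperPoly I) :
    evalField (μ + s • ν) x = (evalLine μ ν x).sum fun k F => s ^ k • F := by
  -- Evaluation at `s` is multiplicative over the noncommutative ring of forms because scalars are
  -- central.
  have h : evalField (μ + s • ν) x = Polynomial.eval₂RingHom' (RingHom.id Form)
      (algebraMap ℂ Form s) (fun a => (Algebra.commutes s a).symm) (evalLine μ ν x) := by
    induction x using SuperPoly.induction with
    | algebraMap r =>
      rw [AlgHom.commutes, AlgHom.commutes]
      exact (Polynomial.eval₂_C (RingHom.id Form) (algebraMap ℂ Form s)).symm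
    | gen a =>
      rw [evalField_gen, evalLine_gen, map_add, map_mul, symbolValue_add_smul]
      change _ = Polynomial.eval₂ (RingHom.id Form) (algebraMap ℂ Form s) _ +
        Polynomial.eval₂ (RingHom.id Form) (algebraMap ℂ Form s) _ *
          Polynomial.eval₂ (RingHom.id Form) (algebraMap ℂ Form s) _
      rw [Polynomial.eval₂_C, Polynomial.eval₂_C, Polynomial.eval₂_X, Algebra.smul_def]
      rfl
    | mul x y hx hy => rw [map_mul, map_mul, map_mul, hx, hy]
    | add x y hx hy => rw [map_add, map_add, map_add, hx, hy]
  rw [h]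
  change Polynomial.eval₂ _ _ _ = _
  rw [Polynomial.eval₂_eq_sum]
  refine Finset.sum_congr rfl fun k _ => ?_
  change _ * algebraMap ℂ Form s ^ k = _
  rw [← map_pow, ← Algebra.commutes, ← Algebra.smul_def]
  rfl

/-- The first variation of a polynomial at `μ` in the direction `ν`. -/
def variation (μ ν : SuperField I) : SuperPoly I →ₗ[ℂ] Form where
  toFun x := (evalLine μ ν x).coeff 1
  map_add' x y := by rw [map_add, Polynomial.coeff_add]
  map_smul' c x := by rw [map_smul, Polynomial.coeff_smul, RingHom.id_apply]

theorem evalLine_coeff_zero (μ ν : SuperField I) (x : SuperPoly I) :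
    (evalLine μ ν x).coeff 0 = evalField μ x := by
  induction x using SuperPoly.induction with
  | algebraMap r =>
    rw [AlgHom.commutes, AlgHom.commutes]
    exact Polynomial.coeff_C_zero
  | gen a => rw [evalLine_gen, evalField_gen]; simp
  | mul x y hx hy => rw [map_mul, map_mul, Polynomial.mul_coeff_zero, hx, hy]
  | add x y hx hy => rw [map_add, map_add, Polynomial.coeff_add, hx, hy]

theorem variation_gen (μ ν : SuperField I) (a : Gen I) :
    variation μ ν (gen a) = symbolValue ν a := by
  change (evalLine μ ν (gen a)).coeff 1 = _
  rw [evalLine_gen, Polynomial.coeff_add, Polynomial.coeff_X_mul, Polynomial.coeff_C_zero,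
    Polynomial.coeff_C_succ, zero_add]

theorem variation_mul (μ ν : SuperField I) (x y : SuperPoly I) : variation μ ν (x * y) =
    variation μ ν x * evalField μ y + evalField μ x * variation μ ν y := by
  change (evalLine μ ν (x * y)).coeff 1 = _
  rw [map_mul, Polynomial.mul_coeff_one, evalLine_coeff_zero, evalLine_coeff_zero, add_comm]
  rfl

theorem variation_one (μ ν : SuperField I) : variation μ ν 1 = 0 := by
  have h := variation_mul μ ν 1 1
  rw [mul_one, map_one (evalField μ), mul_one, one_mul] at h
  exact left_eq_add.1 h

/-- Along a line of fields, `T` of the value is an ordinary polynomial in `s`, and its derivative at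
zero is its linear coefficient. -/
theorem hasDerivAt_evalField (T : Form →ₗ[ℂ] ℂ) (μ ν : SuperField I) (x : SuperPoly I) :
    HasDerivAt (fun s : ℂ => T (evalField (μ + s • ν) x)) (T (variation μ ν x)) 0 := by
  let q : Polynomial ℂ :=
    ∑ k ∈ (evalLine μ ν x).support, Polynomial.monomial k (T ((evalLine μ ν x).coeff k))
  have h1 : (fun s : ℂ => T (evalField (μ + s • ν) x)) = fun s => q.eval s := by
    funext s
    rw [evalField_add_smul, Polynomial.sum, map_sum, Polynomial.eval_finsetSum]
    refine Finset.sum_congr rfl fun k _ => ?_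
    rw [map_smul, Polynomial.eval_monomial, smul_eq_mul, mul_comm]
  have h2 : T (variation μ ν x) = q.derivative.eval 0 := by
    rw [← Polynomial.coeff_zero_eq_eval_zero, Polynomial.coeff_derivative,
      Polynomial.finsetSum_coeff]
    simp only [Polynomial.coeff_monomial, Nat.cast_zero, zero_add, mul_one,
      Finset.sum_ite_eq', zero_add]
    split_ifs with h
    · rfl
    · change T ((evalLine μ ν x).coeff 1) = 0
      rw [Polynomial.notMem_support_iff.1 h, map_zero]
  rw [h1, h2]
  exact q.hasDerivAt 0

/-- The field with `λ^α_0 = u α` and all other components zero. -/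
def lamField (u : I → Form) (hu : ∀ α, formParity (u α) = u α) : SuperField I :=
  ⟨(fun α k => if k = 0 then u α else 0, 0), fun α k => by
    change formParity (if k = 0 then u α else 0) = if k = 0 then u α else 0
    split_ifs
    · exact hu α
    · exact map_zero _, fun α k => by
    change formParity 0 = -0
    rw [map_zero, neg_zero]⟩

theorem form_iterate_zero (m : ℕ) : formDelz^[m] 0 = 0 := iterate_map_zero formDelz m

/-- The chain rule for a direction moving only `λ_0`. Such a direction is even, hence central, and
can be collected on the left. -/
theorem variation_eq_sum (μ : SuperField I) {ν : SuperField I}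
    (h1 : ∀ α k, 0 < k → ν.1.1 α k = 0) (h2 : ∀ α k, ν.1.2 α k = 0) {x : SuperPoly I}
    {s : Finset (I × ℕ)} (hs : ∀ j, j ∉ s → partialDer j x = 0) :
    variation μ ν x =
      ∑ j ∈ s, formDelz^[j.2] (ν.1.1 j.1 0) * evalField μ (partialDer j x) := by
  classical
  have hl : ∀ {x : SuperPoly I} {s : Finset (I × ℕ)}, (∀ j, j ∉ s → partialDer j x = 0) →
      Finsupp.lsum ℂ (fun j : I × ℕ => LinearMap.mulLeft ℂ (formDelz^[j.2] (ν.1.1 j.1 0)) ∘ₗ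
        (evalField μ).toLinearMap) (gradient x) =
      ∑ j ∈ s, formDelz^[j.2] (ν.1.1 j.1 0) * evalField μ (partialDer j x) :=
    fun hs => lsum_gradient _ hs
  rw [← hl hs]
  clear hs s
  induction x using SuperPoly.induction with
  | algebraMap r =>
    rw [hl (s := ∅), Algebra.algebraMap_eq_smul_one, map_smul, variation_one, smul_zero,
      Finset.sum_empty]
    intro j _
    rw [Algebra.algebraMap_eq_smul_one, map_smul, (isDer_partialDer j).map_one, smul_zero]
  | gen a =>
    rw [variation_gen]
    rcases a with ⟨α, _ | k, m⟩ | ⟨α, k, m⟩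
    · rw [hl (s := {(α, m)}), Finset.sum_singleton, partialDer_gen, partialGen, if_pos rfl,
        map_one, mul_one]
      · rfl
      · intro j hj
        rw [partialDer_gen, partialGen, if_neg]
        intro h
        injection h with h1 h2 h3
        exact hj (Finset.mem_singleton.2 (Prod.ext h1.symm h3.symm))
    · rw [hl (s := ∅), symbolValue, h1 α (k + 1) (Nat.succ_pos k), form_iterate_zero,
        Finset.sum_empty]
      intro j _
      rw [partialDer_gen, partialGen, if_neg (by simp)]
    · rw [hl (s := ∅), symbolValue, h2, form_iterate_zero, Finset.sum_empty]
      intro j _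
      rw [partialDer_gen, partialGen, if_neg (by simp)]
  | mul x y hx hy =>
    obtain ⟨s, hs⟩ := exists_finset_partialDer x
    obtain ⟨t, ht⟩ := exists_finset_partialDer y
    have hs' : ∀ j, j ∉ s ∪ t → partialDer j x = 0 := fun j hj => hs j (by simp_all)
    have ht' : ∀ j, j ∉ s ∪ t → partialDer j y = 0 := fun j hj => ht j (by simp_all)
    rw [variation_mul, hx, hy, hl hs', hl ht', hl (s := s ∪ t), Finset.sum_mul, Finset.mul_sum,
      ← Finset.sum_add_distrib]
    · refine Finset.sum_congr rfl fun j _ => ?_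
      have he : formParity (formDelz^[j.2] (ν.1.1 j.1 0)) = formDelz^[j.2] (ν.1.1 j.1 0) := by
        rw [formParity_iterate, ν.2.1]
      rw [isDer_partialDer, map_add, map_mul, map_mul, mul_add, mul_assoc,
        ← mul_assoc (evalField μ x), form_comm_of_even he, mul_assoc]
    · intro j hj
      rw [isDer_partialDer, hs' j hj, ht' j hj, zero_mul, mul_zero, add_zero]
  | add x y hx hy => rw [map_add, map_add, map_add, hx, hy]

/-! ### Integration by parts -/

/-- Stated for an abstract functional `T` so as to serve twice: for the circle integral on forms
with `dbarBody F = 0`, and for the cylinder integral with one factor of compact support. -/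
theorem formDelz_iterate_parts {V : Type*} [AddCommGroup V] [Module ℂ V] {T : Form →ₗ[ℂ] V}
    {S S' : Set Form} (hS : ∀ F ∈ S, formDelz F ∈ S) (hS' : ∀ F ∈ S', formDelz F ∈ S')
    (hT : ∀ F ∈ S, ∀ G ∈ S', T (formDelz (F * G)) = 0) (m : ℕ) {F G : Form} (hF : F ∈ S)
    (hG : G ∈ S') :
    T (formDelz^[m] F * G) = (-1 : ℂ) ^ m • T (F * formDelz^[m] G) := by
  induction m generalizing F with
  | zero => simp
  | succ m ih =>
    have hG' : ∀ m, formDelz^[m] G ∈ S' := by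
      intro m
      induction m with
      | zero => exact hG
      | succ m ih => rw [Function.iterate_succ_apply']; exact hS' _ ih
    rw [Function.iterate_succ_apply, ih (hS F hF), Function.iterate_succ_apply']
    have h := hT F hF _ (hG' m)
    rw [formDelz_mul, map_add] at h
    rw [eq_neg_of_add_eq_zero_left h, pow_succ]
    module

theorem variation_parts [Fintype I] {V : Type*} [AddCommGroup V] [Module ℂ V]
    {T : Form →ₗ[ℂ] V} {S S' : Set Form} (hS : ∀ F ∈ S, formDelz F ∈ S)
    (hS' : ∀ F ∈ S', formDelz F ∈ S') (hT : ∀ F ∈ S, ∀ G ∈ S', T (formDelz (F * G)) = 0)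
    (μ : SuperField I) {ν : SuperField I} (h1 : ∀ α k, 0 < k → ν.1.1 α k = 0)
    (h2 : ∀ α k, ν.1.2 α k = 0) (h3 : ∀ α, ν.1.1 α 0 ∈ S) (h4 : ∀ x, evalField μ x ∈ S')
    (x : SuperPoly I) :
    T (variation μ ν x) = T (∑ α, ν.1.1 α 0 * evalField μ (euler α x)) := by
  classical
  obtain ⟨s, hs⟩ := exists_finset_partialDer x
  rw [variation_eq_sum μ h1 h2 hs]
  simp only [euler_eq_sum _ hs, map_sum, Finset.mul_sum]
  rw [Finset.sum_comm]
  refine Finset.sum_congr rfl fun j _ => ?_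
  rw [formDelz_iterate_parts hS hS' hT j.2 (h3 j.1) (h4 _), Finset.sum_eq_single j.1]
  · rw [if_pos rfl, neg_totalDer_pow, map_smul, mul_smul_comm, map_smul, evalField_totalDer_pow]
  · intro α _ h
    rw [if_neg h.symm, map_zero, mul_zero, map_zero]
  · exact fun h => absurd (Finset.mem_univ _) h

/-! ### Polynomials with vanishing current observable -/

theorem dbarBody_mul_eq_zero {F G : Form} (hF : dbarBody F = 0) (hG : dbarBody G = 0) :
    dbarBody (F * G) = 0 := by
  rw [dbarBody_mul, hF, hG, zero_mul, mul_zero, add_zero]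

theorem dbarBody_symbolValue {μ : SuperField I} (hμ : IsOnShell μ) (a : Gen I) :
    dbarBody (symbolValue μ a) = 0 := by
  rcases a with ⟨α, k, m⟩ | ⟨α, k, m⟩
  · exact dbarBody_formDelz_iterate ((formDelbar_eq_zero_iff _).1 (hμ.1 α k)) m
  · exact dbarBody_formDelz_iterate ((formDelbar_eq_zero_iff _).1 (hμ.2 α k)) m

theorem dbarBody_evalField {μ : SuperField I} (hμ : IsOnShell μ) (x : SuperPoly I) :
    dbarBody (evalField μ x) = 0 := by
  induction x using SuperPoly.induction with
  | algebraMap r =>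
    rw [AlgHom.commutes, Algebra.algebraMap_eq_smul_one, map_smul]
    change r • (delzbar 1 ⊗ₜ[ℂ] functionPart 1) = 0
    rw [delzbar_one, TensorProduct.zero_tmul, smul_zero]
  | gen a => rw [evalField_gen]; exact dbarBody_symbolValue hμ a
  | mul x y hx hy => rw [map_mul]; exact dbarBody_mul_eq_zero hx hy
  | add x y hx hy => rw [map_add, map_add, hx, hy, add_zero]

theorem IsOnShell.add_smul {μ ν : SuperField I} (hμ : IsOnShell μ) (hν : IsOnShell ν) (s : ℂ) :
    IsOnShell (μ + s • ν) := by
  refine ⟨fun α k => ?_, fun α k => ?_⟩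
  · change formDelbar (μ.1.1 α k + s • ν.1.1 α k) = 0
    rw [map_add, map_smul, hμ.1, hν.1, smul_zero, add_zero]
  · change formDelbar (μ.1.2 α k + s • ν.1.2 α k) = 0
    rw [map_add, map_smul, hμ.2, hν.2, smul_zero, add_zero]

theorem isOnShell_lamField {u : I → Form} (hu : ∀ α, formParity (u α) = u α)
    (h : ∀ α, dbarBody (u α) = 0) : IsOnShell (lamField u hu) := by
  refine ⟨fun α k => ?_, fun α k => map_zero _⟩
  change formDelbar (if k = 0 then u α else 0) = 0
  split_ifs
  · exact (formDelbar_eq_zero_iff _).2 (h α)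
  · exact map_zero _

/-- The polynomials whose current observable vanishes on the fields annihilated by `∂̄`. -/
def currentKernel (I : Type*) : Submodule ℂ (SuperPoly I) where
  carrier := {x | ∀ μ : SuperField I, IsOnShell μ → formCircleInt (evalField μ x) = 0}
  add_mem' := fun {x y} hx hy μ hμ => by rw [map_add, map_add, hx μ hμ, hy μ hμ, add_zero]
  zero_mem' := fun μ _ => by rw [map_zero, map_zero]
  smul_mem' := fun c x hx μ hμ => by rw [map_smul, map_smul, hx μ hμ, smul_zero]

theorem totalDer_mem_currentKernel (x : SuperPoly I) : totalDer x ∈ currentKernel I :=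
  fun μ hμ => by
    rw [evalField_totalDer, formCircleInt_formDelz (dbarBody_evalField hμ x)]

theorem mem_currentKernel_of_modTotal {x : SuperPoly I} (h : modTotal x = 0) :
    x ∈ currentKernel I := by
  obtain ⟨y, rfl⟩ := (Submodule.Quotient.mk_eq_zero _).1 h
  exact totalDer_mem_currentKernel y

/-- The fields annihilated by `∂̄` form a linear space, so the whole line `μ + s ν` lies in it and
the differentiated function is identically zero. -/
theorem formCircleInt_variation {x : SuperPoly I} (hx : x ∈ currentKernel I)
    {μ ν : SuperField I} (hμ : IsOnShell μ) (hν : IsOnShell ν) :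
    formCircleInt (variation μ ν x) = 0 := by
  rw [← Module.forall_dual_apply_eq_zero_iff ℂ]
  intro l
  have h := hasDerivAt_evalField (l ∘ₗ formCircleInt) μ ν x
  have h2 : (fun s : ℂ => (l ∘ₗ formCircleInt) (evalField (μ + s • ν) x)) = fun _ => 0 := by
    funext s
    rw [LinearMap.comp_apply, hx _ (hμ.add_smul hν s), map_zero]
  rw [h2] at h
  exact h.unique (hasDerivAt_const _ _)

theorem formParity_constForm_mul {p : ZMod 2} {η : Param} (hη : η.IsHomog p) {F : Form}
    (hF : formParity F = (-1 : ℂ) ^ p.val • F) :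
    formParity (constForm η * F) = constForm η * F := by
  rw [map_mul, formParity_constForm hη, hF, smul_mul_smul_comm, ← mul_pow, neg_one_mul, neg_neg,
    one_pow, one_smul]

/-- The odd variation `λ^α_k ↦ λ^α_k + η ∂_z ρ^α_{k-1}`. -/
def deltaField (η : Param) (hη : η.IsHomog 1) (μ : SuperField I) : SuperField I :=
  ⟨(fun α k => if k = 0 then 0 else constForm η * formDelz (μ.1.2 α (k - 1)), 0),
    fun α k => by
      change formParity (if k = 0 then 0 else _) = if k = 0 then 0 else _
      split_ifs
      · exact map_zero _
      · refine formParity_constForm_mul hη ?_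
        rw [formParity_formDelz, μ.2.2, map_neg, ZMod.val_one, pow_one, neg_one_smul],
    fun α k => by
      change formParity 0 = -0
      rw [map_zero, neg_zero]⟩

theorem isOnShell_deltaField {η : Param} (hη : η.IsHomog 1) {μ : SuperField I}
    (hμ : IsOnShell μ) : IsOnShell (deltaField η hη μ) := by
  refine ⟨fun α k => ?_, fun α k => map_zero _⟩
  change formDelbar (if k = 0 then 0 else constForm η * formDelz (μ.1.2 α (k - 1))) = 0
  split_ifs
  · exact map_zero _
  · rw [formDelbar_eq_zero_iff]
    exact dbarBody_mul_eq_zero (dbarBody_constForm η)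
      (dbarBody_symbolValue hμ (.rho α (k - 1) 1))

/-- Exhibits `δ` as an infinitesimal symmetry of the space of fields; moving `η` past a symbol
reproduces the sign of the graded Leibniz rule. -/
theorem variation_deltaField {η : Param} (hη : η.IsHomog 1) (μ : SuperField I)
    (x : SuperPoly I) :
    variation μ (deltaField η hη μ) x = constForm η * evalField μ (deltaPoly x) := by
  refine DFunLike.congr_fun (SuperPoly.linearMap_ext (f := variation μ (deltaField η hη μ))
    (g := LinearMap.mulLeft ℂ (constForm η) ∘ₗ (evalField μ).toLinearMap ∘ₗ deltaPoly)
    fun w => ?_) x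
  change variation μ (deltaField η hη μ) (monom w) =
    constForm η * evalField μ (deltaPoly (monom w))
  induction w with
  | nil => rw [monom_nil, variation_one, deltaPoly_one, map_zero, mul_zero]
  | cons a w ih =>
    have h : symbolValue (deltaField η hη μ) a = constForm η * evalField μ (deltaGen a) := by
      rcases a with ⟨α, _ | k, m⟩ | ⟨α, k, m⟩
      · rw [deltaGen, map_zero, mul_zero]
        exact form_iterate_zero m
      · rw [deltaGen, evalField_gen]
        change formDelz^[m] (constForm η * formDelz (μ.1.2 α k)) = _
        rw [formDelz_iterate_constForm_mul]
        rfl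
      · rw [deltaGen, map_zero, mul_zero]
        exact form_iterate_zero m
    have h2 : koszul a.parity 1 = (-1) ^ a.parity.val := by rw [koszul, ZMod.val_one, mul_one]
    rw [monom_cons, variation_mul, deltaPoly_gen_mul, variation_gen, evalField_gen, ih, h,
      map_add, map_mul, map_smul, map_mul, mul_add, mul_assoc, ← mul_assoc (symbolValue μ a),
      form_mul_comm (formParity_symbolValue μ a) (formParity_constForm hη), evalField_gen, h2,
      smul_mul_assoc, mul_smul_comm, mul_assoc]

theorem deltaPoly_mem_currentKernel {x : SuperPoly I} (hx : x ∈ currentKernel I) :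
    deltaPoly x ∈ currentKernel I := fun μ hμ => eq_zero_of_homog_mul 1 fun η hη => by
  rw [← formCircleInt_constForm_mul, ← variation_deltaField hη]
  exact formCircleInt_variation hx hμ (isOnShell_deltaField hη hμ)

section

variable [Fintype I] (g : Matrix I I ℂ)

theorem formParity_constForm_mul_hamVec {p : ZMod 2} {η : Param} (hη : η.IsHomog p)
    {x : SuperPoly I} (hx : x ∈ parityPart I p) (μ : SuperField I) (α : I) :
    formParity (constForm η * evalField μ (hamVec g x α)) =
      constForm η * evalField μ (hamVec g x α) :=
  formParity_constForm_mul hη (formParity_evalField_of_mem μ (hamVec_mem_parityPart g hx α))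

/-- `η` is constant, so `∂_z` passes it and it factors out on the left. This links the bracket on
polynomials to derivatives of functions of fields. -/
theorem variation_hamVec (η : Param) (x : SuperPoly I) (μ : SuperField I) {ν : SuperField I}
    (h1 : ∀ α k, ν.1.1 α k = if k = 0 then constForm η * evalField μ (hamVec g x α) else 0)
    (h2 : ∀ α k, ν.1.2 α k = 0) (y : SuperPoly I) :
    variation μ ν y = constForm η * evalField μ (polyBracket g x y) := by
  obtain ⟨s, hs⟩ := exists_finset_partialDer y
  rw [polyBracket_apply, evo_eq_sum _ hs,
    variation_eq_sum μ (fun α k hk => by rw [h1, if_neg hk.ne']) h2 hs, map_sum, Finset.mul_sum]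
  refine Finset.sum_congr rfl fun j _ => ?_
  rw [h1, if_pos rfl, formDelz_iterate_constForm_mul, map_mul, evalField_totalDer_pow, mul_assoc]

/-- For homogeneous `x`, `η` times the bracket is a first variation of `y` along a direction
annihilated by `∂̄`; such `η` separate the values. -/
theorem polyBracket_mem_currentKernel_right (x : SuperPoly I) {y : SuperPoly I}
    (hy : y ∈ currentKernel I) : polyBracket g x y ∈ currentKernel I := by
  rw [← sum_parityProj x, map_sum, LinearMap.sum_apply]
  refine Submodule.sum_mem _ fun p _ μ hμ => eq_zero_of_homog_mul p fun η hη => ?_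
  have hu := formParity_constForm_mul_hamVec g hη (parityProj_mem p x) μ
  rw [← formCircleInt_constForm_mul, ← variation_hamVec g η (parityProj p x) μ
    (ν := lamField _ hu) (fun α k => rfl) (fun α k => rfl) y]
  exact formCircleInt_variation hy hμ (isOnShell_lamField hu fun α =>
    dbarBody_mul_eq_zero (dbarBody_constForm η) (dbarBody_evalField hμ _))

/-- The direction `λ^α_0 ↦ e^{2πikz}` is annihilated by `∂̄`, so after integration by parts every
Fourier coefficient of the holomorphic body of the Euler derivative vanishes. -/
theorem bodyPart_euler {x : SuperPoly I} (hx : x ∈ currentKernel I) {μ : SuperField I}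
    (hμ : IsOnShell μ) (α : I) : bodyPart (evalField μ (euler α x)) = 0 := by
  classical
  have hF := dbarBody_evalField hμ (euler α x)
  refine eq_zero_of_slice fun l => eq_zero_of_circleInt_expFun ?_ fun k => ?_
  · rw [← slice_rTensor, ← dbarBody_apply, hF, map_zero]
  · have hu : ∀ β, formParity (if β = α then expFun k ⊗ₜ[ℂ] 1 else 0 : Form) =
        if β = α then expFun k ⊗ₜ[ℂ] 1 else 0 := by
      intro β
      split_ifs
      · change expFun k ⊗ₜ[ℂ] CliffordAlgebra.involute
          (Q := (0 : QuadraticForm ℂ (ℂ × (ℕ →₀ ℂ)))) 1 = _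
        rw [map_one]
      · exact map_zero _
    have hd : ∀ β, dbarBody (if β = α then expFun k ⊗ₜ[ℂ] 1 else 0 : Form) = 0 := by
      intro β
      split_ifs
      · change delzbar (expFun k) ⊗ₜ[ℂ] functionPart 1 = 0
        rw [delzbar_expFun, TensorProduct.zero_tmul]
      · exact map_zero _
    have h := formCircleInt_variation hx hμ (isOnShell_lamField hu hd)
    rw [variation_parts (T := formCircleInt) (S := {F | dbarBody F = 0})
      (S' := {F | dbarBody F = 0}) (fun F hF => dbarBody_formDelz_iterate hF 1)
      (fun F hF => dbarBody_formDelz_iterate hF 1)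
      (fun F hF G hG => formCircleInt_formDelz (dbarBody_mul_eq_zero hF hG)) μ
      (ν := lamField _ hu)
      (fun β k hk => if_neg hk.ne') (fun β k => rfl) hd (dbarBody_evalField hμ) x,
      Finset.sum_eq_single α] at h
    · have h2 := apply_formCircleInt l (expFun k ⊗ₜ[ℂ] 1 * evalField μ (euler α x))
      have h3 : (lamField _ hu).1.1 α 0 = expFun k ⊗ₜ[ℂ] 1 := if_pos rfl
      rw [h3] at h
      rw [h, map_zero, map_mul, bodyPart_tmul, slice_mul_tmul, map_one] at h2
      rw [h2]
      congr 3
      ext y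
      simp
    · intro β _ hβ
      have h3 : (lamField _ hu).1.1 β 0 = 0 := if_neg hβ
      rw [h3, zero_mul]
    · exact fun h => absurd (Finset.mem_univ _) h

/-- By `bodyPart_euler` the Hamiltonian vector field and its `∂_z`-derivatives vanish modulo `dz̄`,
and the circle integral sees nothing else. -/
theorem polyBracket_mem_currentKernel_left {x : SuperPoly I} (hx : x ∈ currentKernel I)
    (y : SuperPoly I) : polyBracket g x y ∈ currentKernel I := by
  intro μ hμ
  have h : bodyPart (evalField μ (polyBracket g x y)) = 0 := by
    obtain ⟨s, hs⟩ := exists_finset_partialDer y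
    rw [polyBracket_apply, evo_eq_sum _ hs, map_sum, map_sum]
    refine Finset.sum_eq_zero fun j _ => ?_
    have h0 : bodyPart (evalField μ (hamVec g x j.1)) = 0 := by
      simp only [hamVec, hamOp, map_sum, map_smul, evalField_totalDer, bodyPart_formDelz,
        bodyPart_euler hx hμ, map_zero, smul_zero, Finset.sum_const_zero]
    have h1 : ∀ m, bodyPart (evalField μ ((totalDer ^ m) (hamVec g x j.1))) = 0 := by
      intro m
      induction m with
      | zero => exact h0
      | succ m ih =>
        rw [← totalDer_pow_succ, evalField_totalDer, bodyPart_formDelz, ih, map_zero]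
    rw [map_mul, map_mul, h1, zero_mul]
  rw [← Module.forall_dual_apply_eq_zero_iff ℂ]
  intro l
  rw [apply_formCircleInt, h, map_zero, map_zero]

end

end BCOV

/-! ### The BV bracket on series, and descent to current observables. -/

namespace BCOV

open Finset.HasAntidiagonal

variable {I : Type*}

/-! ### The variational derivative -/

/-- The variational derivative of a series. -/
def eulerSeries (L : SuperSeries I) (α : I) : SuperSeries I :=
  ⟨fun n => euler α ((L : ℕ → SuperPoly I) (n + 1)), fun n => euler_mem_homog α (L.2 (n + 1))⟩

theorem eulerSeries_apply (L : SuperSeries I) (α : I) (n : ℕ) :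
    (eulerSeries L α : ℕ → SuperPoly I) n = euler α ((L : ℕ → SuperPoly I) (n + 1)) := rfl

/-- Positive degree matters: a monomial then has a factor of compact support, whereas a constant has
none. -/
theorem evalField_mem_formSuppIn {μ : SuperField I} {R : ℝ}
    (hμ : (∀ α k, μ.1.1 α k ∈ formSuppIn R) ∧ ∀ α k, μ.1.2 α k ∈ formSuppIn R) {d : ℕ}
    {x : SuperPoly I} (hx : x ∈ homog I (d + 1)) : evalField μ x ∈ formSuppIn R := by
  refine homog_induction (C := fun x => evalField μ x ∈ formSuppIn R) hx ?_ ?_ ?_ ?_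
  · rw [map_zero]; exact Submodule.zero_mem _
  · intro x y hx hy; rw [map_add]; exact Submodule.add_mem _ hx hy
  · intro c x hx; rw [map_smul]; exact Submodule.smul_mem _ _ hx
  · intro w hw
    cases w with
    | nil => simp at hw
    | cons a w =>
      rw [monom_cons, map_mul, evalField_gen]
      refine mul_mem_formSuppIn ?_ _
      rcases a with ⟨α, k, m⟩ | ⟨α, k, m⟩
      · exact formDelz_iterate_mem_formSuppIn (hμ.1 α k) m
      · exact formDelz_iterate_mem_formSuppIn (hμ.2 α k) m

theorem isVariationalDerivative_eulerSeries [Fintype I] (L : SuperSeries I) :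
    IsVariationalDerivative L (eulerSeries L) := by
  rintro n μ ν ⟨R₁, hμ⟩ ⟨R₂, hν⟩ h1 h2 l
  have hμ' : (∀ α k, μ.1.1 α k ∈ formSuppIn (max R₁ R₂)) ∧
      ∀ α k, μ.1.2 α k ∈ formSuppIn (max R₁ R₂) :=
    ⟨fun α k => formSuppIn_mono (le_max_left _ _) (hμ.1 α k),
      fun α k => formSuppIn_mono (le_max_left _ _) (hμ.2 α k)⟩
  have hν' : (∀ α k, ν.1.1 α k ∈ formSuppIn (max R₁ R₂)) ∧
      ∀ α k, ν.1.2 α k ∈ formSuppIn (max R₁ R₂) :=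
    ⟨fun α k => formSuppIn_mono (le_max_right _ _) (hν.1 α k),
      fun α k => formSuppIn_mono (le_max_right _ _) (hν.2 α k)⟩
  obtain ⟨T, hT⟩ := exists_linear_formCylinderInt (max R₁ R₂) l
  have h := hasDerivAt_evalField T μ ν ((L : ℕ → SuperPoly I) (n + 1))
  rw [variation_parts (S := formSuppIn (max R₁ R₂)) (S' := Set.univ)
    (fun F hF => formDelz_mem_formSuppIn hF) (fun F _ => Set.mem_univ _)
    (fun F hF G _ => by
      have hFG := mul_mem_formSuppIn hF G
      rw [hT _ (formDelz_mem_formSuppIn hFG), formCylinderInt_formDelz hFG])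
    μ h1 h2 (fun α => hν'.1 α 0) (fun x => Set.mem_univ _),
    hT _ (Submodule.sum_mem _ fun α _ => mul_mem_formSuppIn (hν'.1 α 0) _)] at h
  have hfun : (fun s : ℂ => localFunctional L (n + 1) (μ + s • ν) l) =
      fun s : ℂ => T (evalField (μ + s • ν) ((L : ℕ → SuperPoly I) (n + 1))) := by
    funext s
    rw [hT _ (evalField_mem_formSuppIn ⟨fun α k => ?_, fun α k => ?_⟩ (L.2 (n + 1)))]
    · rfl
    · exact Submodule.add_mem _ (hμ'.1 α k) (Submodule.smul_mem _ s (hν'.1 α k))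
    · exact Submodule.add_mem _ (hμ'.2 α k) (Submodule.smul_mem _ s (hν'.2 α k))
  rw [hfun]
  exact h

theorem formParity_tmul_one (f : Smooth) :
    formParity (f ⊗ₜ[ℂ] 1) = f ⊗ₜ[ℂ] (1 : FormParam) := by
  change f ⊗ₜ[ℂ] CliffordAlgebra.involute (Q := (0 : QuadraticForm ℂ (ℂ × (ℕ →₀ ℂ)))) 1 = _
  rw [map_one]

theorem formParity_tmul_dzbar_theta (f : Smooth) (j : ℕ) :
    formParity (f ⊗ₜ[ℂ] (dzbar * inclParam (theta j))) =
      f ⊗ₜ[ℂ] (dzbar * inclParam (theta j)) := by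
  change f ⊗ₜ[ℂ] CliffordAlgebra.involute (Q := (0 : QuadraticForm ℂ (ℂ × (ℕ →₀ ℂ))))
    (dzbar * inclParam (theta j)) = _
  have h1 : CliffordAlgebra.involute (Q := (0 : QuadraticForm ℂ (ℂ × (ℕ →₀ ℂ)))) dzbar =
      -dzbar := CliffordAlgebra.involute_ι _
  have h2 : CliffordAlgebra.involute (Q := (0 : QuadraticForm ℂ (ℕ →₀ ℂ))) (theta j) =
      -theta j := CliffordAlgebra.involute_ι _
  rw [map_mul, involute_inclParam, h1, h2, map_neg, neg_mul_neg]

/-- Both candidates compute the same derivative, so their difference at `α` pairs to zero with every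
even test form placed in the component `α`. -/
theorem IsVariationalDerivative.evalField_eq_of_compact [Fintype I] {L : SuperSeries I}
    {P P' : I → SuperSeries I} (hP : IsVariationalDerivative L P)
    (hP' : IsVariationalDerivative L P') (n : ℕ) {μ : SuperField I}
    (hμ : IsCompactlySupported μ) (α : I) :
    evalField μ ((P α : ℕ → SuperPoly I) n) = evalField μ ((P' α : ℕ → SuperPoly I) n) := by
  classical
  rw [← sub_eq_zero]
  have key : ∀ R, ∀ f ∈ suppIn R, ∀ w : FormParam, formParity (f ⊗ₜ[ℂ] w) = f ⊗ₜ[ℂ] w →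
      ∀ l, formCylinderInt (f ⊗ₜ[ℂ] w * (evalField μ ((P α : ℕ → SuperPoly I) n) -
        evalField μ ((P' α : ℕ → SuperPoly I) n))) l = 0 := by
    intro R f hf w hw l
    have hu : ∀ β, formParity (if β = α then f ⊗ₜ[ℂ] w else 0 : Form) =
        if β = α then f ⊗ₜ[ℂ] w else 0 := by
      intro β
      split_ifs
      · exact hw
      · exact map_zero _
    have hfw := tmul_mem_formSuppIn hf w
    have hν : IsCompactlySupported (lamField _ hu) := by
      refine ⟨R, fun β k => ?_, fun β k => Submodule.zero_mem _⟩
      change (if k = 0 then if β = α then f ⊗ₜ[ℂ] w else 0 else 0 : Form) ∈ formSuppIn R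
      split_ifs
      · exact hfw
      · exact Submodule.zero_mem _
      · exact Submodule.zero_mem _
    have hsum : ∀ Q : I → SuperSeries I,
        ∑ β, (lamField _ hu).1.1 β 0 * evalField μ ((Q β : ℕ → SuperPoly I) n) =
          f ⊗ₜ[ℂ] w * evalField μ ((Q α : ℕ → SuperPoly I) n) := by
      intro Q
      rw [Finset.sum_eq_single α]
      · have h3 : (lamField _ hu).1.1 α 0 = f ⊗ₜ[ℂ] w := if_pos rfl
        rw [h3]
      · intro β _ hβ
        have h3 : (lamField _ hu).1.1 β 0 = 0 := if_neg hβ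
        rw [h3, zero_mul]
      · exact fun h => absurd (Finset.mem_univ _) h
    have h := (hP n μ _ hμ hν (fun β k hk => if_neg hk.ne') (fun β k => rfl) l).unique
      (hP' n μ _ hμ hν (fun β k hk => if_neg hk.ne') (fun β k => rfl) l)
    rw [hsum, hsum] at h
    obtain ⟨T, hT⟩ := exists_linear_formCylinderInt R l
    rw [← hT _ (mul_mem_formSuppIn hfw _), ← hT _ (mul_mem_formSuppIn hfw _)] at h
    rw [← hT _ (mul_mem_formSuppIn hfw _), mul_sub, map_sub, h, sub_self]
  exact eq_zero_of_formCylinderInt_mul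
    (fun R f hf l => key R f hf 1 (formParity_tmul_one f) l)
    (fun R f hf j l => key R f hf _ (formParity_tmul_dzbar_theta f j) l)

/-- A field multiplied by a cutoff function. -/
def cutoffField (c : ℝ) (μ : SuperField I) : SuperField I :=
  ⟨(fun α k => cutoff c ⊗ₜ[ℂ] 1 * μ.1.1 α k, fun α k => cutoff c ⊗ₜ[ℂ] 1 * μ.1.2 α k),
    fun α k => by
      change formParity (cutoff c ⊗ₜ[ℂ] 1 * μ.1.1 α k) = cutoff c ⊗ₜ[ℂ] 1 * μ.1.1 α k
      rw [map_mul, formParity_tmul_one, μ.2.1],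
    fun α k => by
      change formParity (cutoff c ⊗ₜ[ℂ] 1 * μ.1.2 α k) = -(cutoff c ⊗ₜ[ℂ] 1 * μ.1.2 α k)
      rw [map_mul, formParity_tmul_one, μ.2.2, mul_neg]⟩

theorem isCompactlySupported_cutoffField (c : ℝ) (μ : SuperField I) :
    IsCompactlySupported (cutoffField c μ) :=
  ⟨|c| + 2, fun _ _ => mul_mem_formSuppIn (tmul_mem_formSuppIn (cutoff_mem_suppIn c) 1) _,
    fun _ _ => mul_mem_formSuppIn (tmul_mem_formSuppIn (cutoff_mem_suppIn c) 1) _⟩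

theorem evalAt_cutoffField (z : ℂ) (μ : SuperField I) (x : SuperPoly I) :
    evalAt z (evalField (cutoffField z.im μ) x) = evalAt z (evalField μ x) :=
  evalField_congr (evalAt z) (fun a => by
    rcases a with ⟨α, k, m⟩ | ⟨α, k, m⟩
    · exact evalAt_formDelz_iterate_cutoff z m (μ.1.1 α k)
    · exact evalAt_formDelz_iterate_cutoff z m (μ.1.2 α k)) x

/-- The variational derivative is unique. -/
theorem IsVariationalDerivative.evalField_eq [Fintype I] {L : SuperSeries I}
    {P P' : I → SuperSeries I} (hP : IsVariationalDerivative L P)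
    (hP' : IsVariationalDerivative L P') (n : ℕ) (μ : SuperField I) (α : I) :
    evalField μ ((P α : ℕ → SuperPoly I) n) = evalField μ ((P' α : ℕ → SuperPoly I) n) := by
  rw [← sub_eq_zero]
  refine eq_zero_of_evalAt fun z => ?_
  -- At `z` the field may be replaced by a compactly supported one that agrees with it nearby.
  rw [map_sub, ← evalAt_cutoffField z μ ((P α : ℕ → SuperPoly I) n),
    ← evalAt_cutoffField z μ ((P' α : ℕ → SuperPoly I) n),
    hP.evalField_eq_of_compact hP' n (isCompactlySupported_cutoffField _ _) α, sub_self]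

/-! ### Derivations along vector fields -/

theorem HasDirDeriv.unique {O : SuperField I → Param} {μ ν : SuperField I} {y y' : Param}
    (h : HasDirDeriv O μ ν y) (h' : HasDirDeriv O μ ν y') : y = y' := by
  rw [← sub_eq_zero, ← Module.forall_dual_apply_eq_zero_iff ℂ]
  intro l
  rw [map_sub, (h l).unique (h' l), sub_self]

/-- The directions are fixed by their components and the derivatives by uniqueness of limits, so `η
O'` is determined for all `η` of parity `p`, and these separate. -/
theorem IsDerivationAlong.unique {p : ZMod 2} {X : ℕ → SuperField I → I → Form}
    {O O₁ O₂ : Obs I} (h₁ : IsDerivationAlong p X O O₁) (h₂ : IsDerivationAlong p X O O₂) :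
    O₁ = O₂ := by
  funext n μ
  rw [← sub_eq_zero]
  refine eq_zero_of_homog_mul p fun η hη => ?_
  obtain ⟨ν, y, a1, a2, a3, a4⟩ := h₁ n μ η hη
  obtain ⟨ν', y', b1, b2, b3, b4⟩ := h₂ n μ η hη
  have hν : ν = ν' := by
    funext e
    refine Subtype.ext (Prod.ext ?_ ?_)
    · funext α k
      exact (a1 e α k).trans (b1 e α k).symm
    · funext α k
      exact (a2 e α k).trans (b2 e α k).symm
  subst hν
  rw [mul_sub, a4, b4, sub_eq_zero]
  exact Finset.sum_congr rfl fun x hx => (a3 x hx).unique (b3 x hx)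

/-! ### The parity and the differential on series -/

theorem delta_mem_seriesParity {p : ZMod 2} {L : SuperSeries I} (hL : L ∈ seriesParity I p) :
    delta L ∈ seriesParity I (p + 1) := fun n => deltaPoly_mem_parityPart (hL n)

theorem delta_delta (L : SuperSeries I) : delta (delta L) = 0 :=
  Subtype.ext (funext fun _ => deltaPoly_deltaPoly _)

/-- The part of parity `p` of a series. -/
def seriesProj (p : ZMod 2) (L : SuperSeries I) : SuperSeries I :=
  ⟨fun n => parityProj p ((L : ℕ → SuperPoly I) n), fun n => parityProj_mem_homog p (L.2 n)⟩

theorem seriesProj_mem (p : ZMod 2) (L : SuperSeries I) : seriesProj p L ∈ seriesParity I p :=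
  fun _ => parityProj_mem p _

theorem sum_seriesProj (L : SuperSeries I) : ∑ p, seriesProj p L = L := by
  rw [sum_zmod_two]
  refine Subtype.ext (funext fun n => ?_)
  have h := sum_parityProj ((L : ℕ → SuperPoly I) n)
  rwa [sum_zmod_two] at h

theorem seriesProj_sum {Lp : ZMod 2 → SuperSeries I} (h : ∀ p, Lp p ∈ seriesParity I p)
    (p : ZMod 2) : seriesProj p (∑ q, Lp q) = Lp p := by
  refine Subtype.ext (funext fun n => ?_)
  rw [sum_zmod_two]
  change parityProj p ((Lp 0 : ℕ → SuperPoly I) n + (Lp 1 : ℕ → SuperPoly I) n) = _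
  rw [map_add]
  rcases zmod_two_cases p with rfl | rfl
  · rw [parityProj_of_mem (h 0 n), parityProj_of_mem_ne (by decide) (h 1 n), add_zero]
  · rw [parityProj_of_mem_ne (by decide) (h 0 n), parityProj_of_mem (h 1 n), zero_add]

/-! ### The bracket on series -/

section

variable [Fintype I]

/-- The bracket on series. -/
def seriesBracket (g : Matrix I I ℂ) :
    SuperSeries I →ₗ[ℂ] SuperSeries I →ₗ[ℂ] SuperSeries I :=
  LinearMap.mk₂ ℂ
    -- The shift by two compensates the two degrees lost in `polyBracket`.
    (fun L M => ⟨fun n => ∑ x ∈ antidiagonal (n + 2),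
      polyBracket g ((L : ℕ → SuperPoly I) x.1) ((M : ℕ → SuperPoly I) x.2),
      fun n => Submodule.sum_mem _ fun x hx =>
        polyBracket_mem_homog g (mem_antidiagonal.1 hx) (L.2 x.1) (M.2 x.2)⟩)
    (fun L L' M => Subtype.ext (funext fun n => by
      change ∑ x ∈ antidiagonal (n + 2), polyBracket g ((L : ℕ → SuperPoly I) x.1 +
        (L' : ℕ → SuperPoly I) x.1) ((M : ℕ → SuperPoly I) x.2) = _
      simp only [map_add, LinearMap.add_apply, Finset.sum_add_distrib]
      rfl))
    (fun c L M => Subtype.ext (funext fun n => by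
      change ∑ x ∈ antidiagonal (n + 2), polyBracket g (c • (L : ℕ → SuperPoly I) x.1)
        ((M : ℕ → SuperPoly I) x.2) = _
      simp only [map_smul, LinearMap.smul_apply, ← Finset.smul_sum]
      rfl))
    (fun L M M' => Subtype.ext (funext fun n => by
      change ∑ x ∈ antidiagonal (n + 2), polyBracket g ((L : ℕ → SuperPoly I) x.1)
        ((M : ℕ → SuperPoly I) x.2 + (M' : ℕ → SuperPoly I) x.2) = _
      simp only [map_add, Finset.sum_add_distrib]
      rfl))
    (fun c L M => Subtype.ext (funext fun n => by
      change ∑ x ∈ antidiagonal (n + 2), polyBracket g ((L : ℕ → SuperPoly I) x.1)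
        (c • (M : ℕ → SuperPoly I) x.2) = _
      simp only [map_smul, ← Finset.smul_sum]
      rfl))

theorem seriesBracket_apply (g : Matrix I I ℂ) (L M : SuperSeries I) (n : ℕ) :
    (seriesBracket g L M : ℕ → SuperPoly I) n = ∑ x ∈ antidiagonal (n + 2),
      polyBracket g ((L : ℕ → SuperPoly I) x.1) ((M : ℕ → SuperPoly I) x.2) := rfl

theorem seriesBracket_mem_seriesParity (g : Matrix I I ℂ) {p q : ZMod 2} {L M : SuperSeries I}
    (hL : L ∈ seriesParity I p) (hM : M ∈ seriesParity I q) :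
    seriesBracket g L M ∈ seriesParity I (p + q) := fun n => by
  rw [seriesBracket_apply]
  exact Submodule.sum_mem _ fun x _ => polyBracket_mem_parityPart g (hL x.1) (hM x.2)

theorem delta_seriesBracket (g : Matrix I I ℂ) {p : ZMod 2} {L : SuperSeries I}
    (hL : L ∈ seriesParity I p) (M : SuperSeries I) :
    delta (seriesBracket g L M) =
      seriesBracket g (delta L) M + ((-1 : ℂ) ^ p.val) • seriesBracket g L (delta M) := by
  refine Subtype.ext (funext fun n => ?_)
  change deltaPoly (∑ x ∈ antidiagonal (n + 2), polyBracket g _ _) =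
    ∑ x ∈ antidiagonal (n + 2), polyBracket g (deltaPoly _) _ +
      ((-1 : ℂ) ^ p.val) • ∑ x ∈ antidiagonal (n + 2), polyBracket g _ (deltaPoly _)
  rw [map_sum, Finset.smul_sum, ← Finset.sum_add_distrib]
  exact Finset.sum_congr rfl fun x _ => deltaPoly_polyBracket g (hL x.1) _

/-! ### The BV bracket -/

variable [DecidableEq I]

theorem hamiltonianField_eulerSeries (g : Matrix I I ℂ) (L : SuperSeries I) (n : ℕ)
    (μ : SuperField I) (α : I) : hamiltonianField g (eulerSeries L) n μ α =
      evalField μ (hamVec g⁻¹ ((L : ℕ → SuperPoly I) (n + 1)) α) := by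
  simp only [hamiltonianField, hamVec, hamOp, map_sum, map_smul, evalField_totalDer,
    eulerSeries_apply, ← Finset.sum_neg_distrib, neg_smul]

theorem isDerivationAlong_seriesBracket (g : Matrix I I ℂ) {p : ZMod 2} {L : SuperSeries I}
    (hL : L ∈ seriesParity I p) (M : SuperSeries I) :
    IsDerivationAlong p (hamiltonianField g (eulerSeries L)) (currentObs M)
      (currentObs (seriesBracket g⁻¹ L M)) := by
  intro n μ η hη
  have hu : ∀ e α, formParity (constForm η * hamiltonianField g (eulerSeries L) e μ α) =
      constForm η * hamiltonianField g (eulerSeries L) e μ α := fun e α => by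
    rw [hamiltonianField_eulerSeries]
    exact formParity_constForm_mul_hamVec g⁻¹ hη (hL (e + 1)) μ α
  refine ⟨fun e => lamField _ (hu e), fun x => formCircleInt (constForm η * evalField μ
    (polyBracket g⁻¹ ((L : ℕ → SuperPoly I) (x.2 + 1)) ((M : ℕ → SuperPoly I) x.1))),
    fun e α k => rfl, fun e α k => rfl, fun x _ l => ?_, ?_⟩
  · have hv := variation_hamVec g⁻¹ η ((L : ℕ → SuperPoly I) (x.2 + 1)) μ
      (ν := lamField _ (hu x.2)) (fun α k => by rw [← hamiltonianField_eulerSeries]; rfl)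
      (fun α k => rfl) ((M : ℕ → SuperPoly I) x.1)
    change HasDerivAt _ (l (formCircleInt (constForm η * evalField μ (polyBracket g⁻¹ _ _)))) 0
    rw [← hv]
    exact hasDerivAt_evalField (l ∘ₗ formCircleInt) μ _ _
  · change η * formCircleInt (evalField μ ((seriesBracket g⁻¹ L M : ℕ → SuperPoly I) n)) = _
    -- The degree-zero part of `L` contributes nothing. Dropping it turns the total degree `n + 2`
    -- into `n + 1`, since degree `e` of the vector field comes from degree `e + 1` of `L`.
    rw [seriesBracket_apply, Finset.Nat.sum_antidiagonal_succ,
      polyBracket_homog_zero_left g⁻¹ (L.2 0), zero_add, map_sum, map_sum, Finset.mul_sum,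
      ← Finset.Nat.sum_antidiagonal_swap]
    exact Finset.sum_congr rfl fun x _ => (formCircleInt_constForm_mul _ _).symm

theorem isBVBracket_seriesBracket (g : Matrix I I ℂ) (L M : SuperSeries I) :
    IsBVBracket g L (currentObs M) (currentObs (seriesBracket g⁻¹ L M)) := by
  refine ⟨fun p => seriesProj p L, fun p => eulerSeries (seriesProj p L),
    fun p => currentObs (seriesBracket g⁻¹ (seriesProj p L) M), fun p => seriesProj_mem p L,
    (sum_seriesProj L).symm, fun p => isVariationalDerivative_eulerSeries _,
    fun p => isDerivationAlong_seriesBracket g (seriesProj_mem p L) M, ?_⟩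
  rw [← map_sum, ← LinearMap.sum_apply, ← map_sum, sum_seriesProj]

/-- Each choice in the definition is forced: the parity parts of `L`, the values of the variational
derivative, hence the vector field and the derivation along it. -/
theorem IsBVBracket.unique {g : Matrix I I ℂ} {L : SuperSeries I} {O O₁ O₂ : Obs I}
    (h₁ : IsBVBracket g L O O₁) (h₂ : IsBVBracket g L O O₂) : O₁ = O₂ := by
  obtain ⟨Lp, P, Op, a1, a2, a3, a4, rfl⟩ := h₁
  obtain ⟨Lp', P', Op', b1, b2, b3, b4, rfl⟩ := h₂
  refine Finset.sum_congr rfl fun p _ => ?_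
  have hLp : Lp p = Lp' p := by rw [← seriesProj_sum a1, ← a2, b2, seriesProj_sum b1]
  have hX : hamiltonianField g (P p) = hamiltonianField g (P' p) := by
    funext n μ α
    have b := b3 p
    rw [← hLp] at b
    simp only [hamiltonianField, (a3 p).evalField_eq b]
  have b := b4 p
  rw [← hX] at b
  exact (a4 p).unique b

end

/-! ### Lie algebras induced along a surjection -/

section

variable {S V : Type*} [AddCommGroup S] [Module ℂ S] [AddCommGroup V] [Module ℂ V]
  {c : S →ₗ[ℂ] V} {par : ZMod 2 → Submodule ℂ S} {par' : ZMod 2 → Submodule ℂ V}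

theorem isInternal_of_surjective (hc : Function.Surjective c)
    (hpar : ∀ p u, u ∈ par' p ↔ ∃ L ∈ par p, c L = u)
    (hsum : ∀ L, ∃ L₀ ∈ par 0, ∃ L₁ ∈ par 1, L₀ + L₁ = L)
    (hdisj : ∀ L ∈ par 0, ∀ M ∈ par 1, c M = c L → c L = 0) :
    DirectSum.IsInternal par' := by
  refine (DirectSum.isInternal_submodule_iff_isCompl par' (i := 0) (j := 1)
    (by decide) ?_).2 ⟨?_, ?_⟩
  · ext p
    rcases zmod_two_cases p with rfl | rfl <;> simp
  · rw [Submodule.disjoint_def]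
    intro u hu₀ hu₁
    obtain ⟨L, hL, rfl⟩ := (hpar 0 u).1 hu₀
    obtain ⟨M, hM, hLM⟩ := (hpar 1 _).1 hu₁
    exact hdisj L hL M hM hLM
  · rw [codisjoint_iff, Submodule.eq_top_iff']
    intro u
    obtain ⟨L, rfl⟩ := hc u
    obtain ⟨L₀, h₀, L₁, h₁, rfl⟩ := hsum L
    rw [map_add]
    exact Submodule.add_mem_sup ((hpar 0 _).2 ⟨L₀, h₀, rfl⟩) ((hpar 1 _).2 ⟨L₁, h₁, rfl⟩)

/-- The operations upstairs need satisfy skew symmetry and Jacobi only after applying `c`; the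
series themselves do not form a Lie algebra on the nose. -/
theorem isDGLieSuperalgebra_of_surjective (hc : Function.Surjective c)
    (hpar : ∀ p u, u ∈ par' p ↔ ∃ L ∈ par p, c L = u) (hint : DirectSum.IsInternal par')
    {δ : S →ₗ[ℂ] S} {b : S →ₗ[ℂ] S →ₗ[ℂ] S} {D : V → V} {br : V → V → V}
    (hD : ∀ L, D (c L) = c (δ L)) (hb : ∀ L M, br (c L) (c M) = c (b L M))
    (δ_mem : ∀ {p L}, L ∈ par p → δ L ∈ par (p + 1))
    (b_mem : ∀ {p q L M}, L ∈ par p → M ∈ par q → b L M ∈ par (p + q))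
    (δ_δ : ∀ L, δ (δ L) = 0)
    (skew : ∀ {p q L M}, L ∈ par p → M ∈ par q → c (b L M) = c (-(koszul p q • b M L)))
    (jacobi : ∀ {p q L M}, L ∈ par p → M ∈ par q → ∀ N,
      c (b L (b M N)) = c (b (b L M) N + koszul p q • b M (b L N)))
    (leibniz : ∀ {p L}, L ∈ par p → ∀ M,
      δ (b L M) = b (δ L) M + ((-1 : ℂ) ^ p.val) • b L (δ M)) :
    IsDGLieSuperalgebra par' D br where
  isInternal := hint
  isLinearMap_D := ⟨hc.forall₂.2 fun L M => by simp only [← map_add, hD],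
    fun a => hc.forall.2 fun L => by simp only [← map_smul, hD]⟩
  isLinearMap_left := hc.forall.2 fun N =>
    ⟨hc.forall₂.2 fun L M => by rw [← map_add, hb, hb, hb, map_add, LinearMap.add_apply, map_add],
    fun a => hc.forall.2 fun L => by
      rw [← map_smul, hb, hb, map_smul, LinearMap.smul_apply, map_smul]⟩
  isLinearMap_right := hc.forall.2 fun N =>
    ⟨hc.forall₂.2 fun L M => by rw [← map_add, hb, hb, hb, map_add, map_add],
    fun a => hc.forall.2 fun L => by rw [← map_smul, hb, hb, map_smul, map_smul]⟩
  D_mem := by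
    intro p u hu
    obtain ⟨L, hL, rfl⟩ := (hpar p u).1 hu
    exact (hpar _ _).2 ⟨δ L, δ_mem hL, (hD L).symm⟩
  br_mem := by
    intro p q u hu v hv
    obtain ⟨L, hL, rfl⟩ := (hpar p u).1 hu
    obtain ⟨M, hM, rfl⟩ := (hpar q v).1 hv
    exact (hpar _ _).2 ⟨_, b_mem hL hM, (hb L M).symm⟩
  D_D := hc.forall.2 fun L => by rw [hD, hD, δ_δ, map_zero]
  skew := by
    intro p q u hu v hv
    obtain ⟨L, hL, rfl⟩ := (hpar p u).1 hu
    obtain ⟨M, hM, rfl⟩ := (hpar q v).1 hv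
    rw [hb, hb, skew hL hM, map_neg, map_smul]
  jacobi := by
    intro p q u hu v hv w
    obtain ⟨L, hL, rfl⟩ := (hpar p u).1 hu
    obtain ⟨M, hM, rfl⟩ := (hpar q v).1 hv
    obtain ⟨N, rfl⟩ := hc w
    rw [hb, hb, hb, hb, hb, hb, jacobi hL hM, map_add, map_smul]
  leibniz := by
    intro p u hu v
    obtain ⟨L, hL, rfl⟩ := (hpar p u).1 hu
    obtain ⟨M, rfl⟩ := hc v
    rw [hb, hD, hD, hD, hb, hb, leibniz hL, map_add, map_smul]

end

/-! ### The Lie algebra of current observables -/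

theorem current_surjective : Function.Surjective (current (I := I)) :=
  LinearMap.surjective_rangeRestrict _

theorem current_eq_zero_iff (L : SuperSeries I) :
    current L = 0 ↔ ∀ n, (L : ℕ → SuperPoly I) n ∈ currentKernel I := by
  constructor
  · intro h n μ hμ
    exact congrFun (congrFun (congrArg Subtype.val h) n) ⟨μ, hμ⟩
  · intro h
    exact Subtype.ext (funext fun n => funext fun μ => h n μ.1 μ.2)

theorem current_eq_iff {L M : SuperSeries I} :
    current L = current M ↔ ∀ n, (L : ℕ → SuperPoly I) n - (M : ℕ → SuperPoly I) n ∈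
      currentKernel I := by
  constructor
  · intro h n μ hμ
    have h1 : formCircleInt (evalField μ ((L : ℕ → SuperPoly I) n)) =
        formCircleInt (evalField μ ((M : ℕ → SuperPoly I) n)) :=
      congrFun (congrFun (congrArg Subtype.val h) n) ⟨μ, hμ⟩
    rw [map_sub, map_sub, h1, sub_self]
  · intro h
    refine Subtype.ext (funext fun n => funext fun μ => ?_)
    have h1 := h n μ.1 μ.2
    rw [map_sub, map_sub] at h1
    exact sub_eq_zero.1 h1

theorem current_eq_of_modTotal {L M : SuperSeries I}
    (h : ∀ n, modTotal ((L : ℕ → SuperPoly I) n) = modTotal ((M : ℕ → SuperPoly I) n)) :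
    current L = current M :=
  current_eq_iff.2 fun n => mem_currentKernel_of_modTotal (by rw [map_sub, h, sub_self])

theorem current_delta_congr {L M : SuperSeries I} (h : current L = current M) :
    current (delta L) = current (delta M) :=
  current_eq_iff.2 fun n => by
    have h1 := deltaPoly_mem_currentKernel (current_eq_iff.1 h n)
    rwa [map_sub] at h1

theorem existsUnique_inducedDifferential :
    ∃! D : CurrentSpace I → CurrentSpace I, IsInducedDifferential D := by
  refine ⟨fun u => current (delta (Function.surjInv current_surjective u)), fun L => ?_,
    fun D hD => funext fun u => ?_⟩
  · exact current_delta_congr (Function.surjInv_eq current_surjective _)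
  · conv_lhs => rw [← Function.surjInv_eq current_surjective u]
    exact hD _

theorem mem_currentParity (p : ZMod 2) (u : CurrentSpace I) :
    u ∈ currentParity I p ↔ ∃ L ∈ seriesParity I p, current L = u := Iff.rfl

/-- A current of parity `p` takes Grassmann values of parity `p`, so one that is both even and odd
equals its own negative. -/
theorem isInternal_currentParity : DirectSum.IsInternal (currentParity I) := by
  refine isInternal_of_surjective (S := SuperSeries I) (V := CurrentSpace I)
    (c := current) (par := seriesParity I)
    current_surjective mem_currentParity (fun L => ?_) fun L hL M hM hLM => ?_
  · exact ⟨_, seriesProj_mem 0 L, _, seriesProj_mem 1 L,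
      (sum_zmod_two fun p => seriesProj p L).symm.trans (sum_seriesProj L)⟩
  · rw [current_eq_zero_iff]
    intro n μ hμ
    have h : formCircleInt (evalField μ ((M : ℕ → SuperPoly I) n)) =
        formCircleInt (evalField μ ((L : ℕ → SuperPoly I) n)) :=
      congrFun (congrFun (congrArg Subtype.val hLM) n) ⟨μ, hμ⟩
    have h0 := involute_formCircleInt (evalField μ ((L : ℕ → SuperPoly I) n))
    have h1 := involute_formCircleInt (evalField μ ((M : ℕ → SuperPoly I) n))
    rw [formParity_evalField_of_mem μ (hL n), ZMod.val_zero, pow_zero, one_smul] at h0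
    rw [formParity_evalField_of_mem μ (hM n), ZMod.val_one, pow_one, neg_one_smul, map_neg, h,
      h0] at h1
    have h2 : (2 : ℂ) • formCircleInt (evalField μ ((L : ℕ → SuperPoly I) n)) = 0 := by
      rw [two_smul]
      exact add_eq_zero_iff_eq_neg.2 h1
    exact (smul_eq_zero.1 h2).resolve_left two_ne_zero

theorem sum_antidiagonal_assoc {V : Type*} [AddCommMonoid V] (h : ℕ → ℕ → ℕ → V) (n : ℕ) :
    ∑ p ∈ antidiagonal n, ∑ q ∈ antidiagonal p.2, h p.1 q.1 q.2 =
      ∑ p ∈ antidiagonal n, ∑ q ∈ antidiagonal p.1, h q.1 q.2 p.2 := by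
  rw [Finset.sum_sigma', Finset.sum_sigma']
  refine Finset.sum_nbij' (fun x => ⟨(x.1.1 + x.2.1, x.2.2), (x.1.1, x.2.1)⟩)
    (fun x => ⟨(x.2.1, x.2.2 + x.1.2), (x.2.2, x.1.2)⟩) ?_ ?_ ?_ ?_ ?_
  · rintro ⟨⟨i, s⟩, j, k⟩ hx
    simp only [Finset.mem_sigma, mem_antidiagonal] at hx ⊢
    exact ⟨by omega, trivial⟩
  · rintro ⟨⟨s, k⟩, i, j⟩ hx
    simp only [Finset.mem_sigma, mem_antidiagonal] at hx ⊢
    exact ⟨by omega, trivial⟩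
  · rintro ⟨⟨i, s⟩, j, k⟩ hx
    simp only [Finset.mem_sigma, mem_antidiagonal] at hx
    obtain rfl := hx.2
    rfl
  · rintro ⟨⟨s, k⟩, i, j⟩ hx
    simp only [Finset.mem_sigma, mem_antidiagonal] at hx
    obtain rfl := hx.2
    rfl
  · rintro ⟨⟨i, s⟩, j, k⟩ _
    rfl

/-- After reassociation the first two indices form the inner pair, and their exchange is the swap
symmetry of that sum. -/
theorem sum_antidiagonal_left_comm {V : Type*} [AddCommMonoid V] (h : ℕ → ℕ → ℕ → V) (n : ℕ) :
    ∑ p ∈ antidiagonal n, ∑ q ∈ antidiagonal p.2, h p.1 q.1 q.2 =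
      ∑ p ∈ antidiagonal n, ∑ q ∈ antidiagonal p.2, h q.1 p.1 q.2 := by
  have hsw : ∀ s k, ∑ q ∈ antidiagonal s, h q.1 q.2 k = ∑ q ∈ antidiagonal s, h q.2 q.1 k :=
    fun s k => (Finset.Nat.sum_antidiagonal_swap (f := fun q : ℕ × ℕ => h q.2 q.1 k)).symm ▸ rfl
  rw [sum_antidiagonal_assoc h, sum_antidiagonal_assoc fun i j k => h j i k]
  exact Finset.sum_congr rfl fun p _ => hsw _ _

section

variable [Fintype I]

theorem current_seriesBracket_congr (g : Matrix I I ℂ) {L L' M M' : SuperSeries I}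
    (h : current L = current L') (h' : current M = current M') :
    current (seriesBracket g L M) = current (seriesBracket g L' M') := by
  have h1 : current (seriesBracket g L M) = current (seriesBracket g L' M) :=
    current_eq_iff.2 fun n => by
      rw [seriesBracket_apply, seriesBracket_apply, ← Finset.sum_sub_distrib]
      refine Submodule.sum_mem _ fun x _ => ?_
      have h2 := polyBracket_mem_currentKernel_left g (current_eq_iff.1 h x.1)
        ((M : ℕ → SuperPoly I) x.2)
      rwa [map_sub, LinearMap.sub_apply] at h2
  refine h1.trans (current_eq_iff.2 fun n => ?_)
  rw [seriesBracket_apply, seriesBracket_apply, ← Finset.sum_sub_distrib]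
  refine Submodule.sum_mem _ fun x _ => ?_
  have h2 := polyBracket_mem_currentKernel_right g ((L' : ℕ → SuperPoly I) x.1)
    (current_eq_iff.1 h' x.2)
  rwa [map_sub] at h2

theorem current_seriesBracket_skew {g : Matrix I I ℂ} (hg : g.IsSymm) {p q : ZMod 2}
    {L M : SuperSeries I} (hL : L ∈ seriesParity I p) (hM : M ∈ seriesParity I q) :
    current (seriesBracket g L M) =
      current (-(koszul p q • seriesBracket g M L)) := by
  refine current_eq_of_modTotal fun n => ?_
  change modTotal ((seriesBracket g L M : ℕ → SuperPoly I) n) =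
    modTotal (-(koszul p q • (seriesBracket g M L : ℕ → SuperPoly I) n))
  rw [map_neg, map_smul, seriesBracket_apply, seriesBracket_apply, map_sum, map_sum,
    ← Finset.Nat.sum_antidiagonal_swap, Finset.smul_sum, ← Finset.sum_neg_distrib]
  exact Finset.sum_congr rfl fun x _ => polyBracket_skew hg (hL x.2) (hM x.1)

/-- Rewrites the double bracket as a sum over all triples of degrees with total `n + 4`. The added
terms, where the inner degrees sum to 0 or 1, vanish because one inner factor has degree zero. -/
theorem seriesBracket_seriesBracket (g : Matrix I I ℂ) (L M N : SuperSeries I) (n : ℕ) :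
    (seriesBracket g L (seriesBracket g M N) : ℕ → SuperPoly I) n =
      ∑ p ∈ antidiagonal (n + 4), ∑ q ∈ antidiagonal p.2,
        polyBracket g ((L : ℕ → SuperPoly I) p.1)
          (polyBracket g ((M : ℕ → SuperPoly I) q.1) ((N : ℕ → SuperPoly I) q.2)) := by
  rw [Finset.Nat.sum_antidiagonal_succ', Finset.Nat.sum_antidiagonal_succ']
  simp only [zero_add, Finset.Nat.sum_antidiagonal_succ (n := 0), Finset.Nat.antidiagonal_zero,
    Finset.sum_singleton, polyBracket_homog_zero_left g (M.2 0),
    polyBracket_homog_zero_right g _ (N.2 0), map_zero, add_zero]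
  simp only [seriesBracket_apply, map_sum]

theorem seriesBracket_seriesBracket' (g : Matrix I I ℂ) (L M N : SuperSeries I) (n : ℕ) :
    (seriesBracket g (seriesBracket g L M) N : ℕ → SuperPoly I) n =
      ∑ p ∈ antidiagonal (n + 4), ∑ q ∈ antidiagonal p.1,
        polyBracket g (polyBracket g ((L : ℕ → SuperPoly I) q.1) ((M : ℕ → SuperPoly I) q.2))
          ((N : ℕ → SuperPoly I) p.2) := by
  rw [Finset.Nat.sum_antidiagonal_succ, Finset.Nat.sum_antidiagonal_succ]
  simp only [zero_add, Finset.Nat.sum_antidiagonal_succ (n := 0), Finset.Nat.antidiagonal_zero,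
    Finset.sum_singleton, polyBracket_homog_zero_left g (L.2 0),
    polyBracket_homog_zero_right g _ (M.2 0), map_zero, add_zero, LinearMap.zero_apply]
  simp only [seriesBracket_apply, map_sum, LinearMap.sum_apply]

theorem polyBracket_jacobi_right {g : Matrix I I ℂ} (hg : g.IsSymm) {p q : ZMod 2}
    {x y : SuperPoly I} (hx : x ∈ parityPart I p) (hy : y ∈ parityPart I q) (z : SuperPoly I) :
    modTotal (polyBracket g x (polyBracket g y z)) =
      modTotal (polyBracket g (polyBracket g x y) z) +
        koszul p q • modTotal (polyBracket g y (polyBracket g x z)) := by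
  rw [← sum_parityProj z]
  simp only [map_sum, Finset.smul_sum, ← Finset.sum_add_distrib]
  exact Finset.sum_congr rfl fun r _ => polyBracket_jacobi hg hx hy (parityProj_mem r z)

theorem current_seriesBracket_jacobi {g : Matrix I I ℂ} (hg : g.IsSymm) {p q : ZMod 2}
    {L M : SuperSeries I} (hL : L ∈ seriesParity I p) (hM : M ∈ seriesParity I q)
    (N : SuperSeries I) :
    current (seriesBracket g L (seriesBracket g M N)) =
      current (seriesBracket g (seriesBracket g L M) N +
        koszul p q • seriesBracket g M (seriesBracket g L N)) := by
  refine current_eq_of_modTotal fun n => ?_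
  change modTotal ((seriesBracket g L (seriesBracket g M N) : ℕ → SuperPoly I) n) =
    modTotal ((seriesBracket g (seriesBracket g L M) N : ℕ → SuperPoly I) n +
      koszul p q • (seriesBracket g M (seriesBracket g L N) : ℕ → SuperPoly I) n)
  rw [map_add, map_smul, seriesBracket_seriesBracket, seriesBracket_seriesBracket',
    seriesBracket_seriesBracket,
    sum_antidiagonal_left_comm (fun i j k => polyBracket g ((M : ℕ → SuperPoly I) i)
      (polyBracket g ((L : ℕ → SuperPoly I) j) ((N : ℕ → SuperPoly I) k))),
    ← sum_antidiagonal_assoc (fun i j k => polyBracket g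
      (polyBracket g ((L : ℕ → SuperPoly I) i) ((M : ℕ → SuperPoly I) j))
        ((N : ℕ → SuperPoly I) k))]
  simp only [map_sum, Finset.smul_sum, ← Finset.sum_add_distrib]
  exact Finset.sum_congr rfl fun x _ => Finset.sum_congr rfl fun y _ =>
    polyBracket_jacobi_right hg (hL x.1) (hM y.1) _

variable [DecidableEq I]

theorem isInducedBracket_iff (g : Matrix I I ℂ)
    (br : CurrentSpace I → CurrentSpace I → CurrentSpace I) :
    IsInducedBracket g br ↔
      ∀ L M, br (current L) (current M) = current (seriesBracket g⁻¹ L M) := by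
  constructor
  · intro h L M
    obtain ⟨O, hO, hbr⟩ := h L M
    rw [hO.unique (isBVBracket_seriesBracket g L M)] at hbr
    exact Subtype.ext hbr
  · intro h L M
    exact ⟨_, isBVBracket_seriesBracket g L M, congrArg Subtype.val (h L M)⟩

theorem existsUnique_inducedBracket (g : Matrix I I ℂ) :
    ∃! br : CurrentSpace I → CurrentSpace I → CurrentSpace I, IsInducedBracket g br := by
  refine ⟨fun u v => current (seriesBracket g⁻¹ (Function.surjInv current_surjective u)
    (Function.surjInv current_surjective v)), (isInducedBracket_iff g _).2 fun L M => ?_,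
    fun br hbr => funext fun u => funext fun v => ?_⟩
  · exact current_seriesBracket_congr g⁻¹ (Function.surjInv_eq current_surjective _)
      (Function.surjInv_eq current_surjective _)
  -- Uniqueness: every current observable is the current of some series, and on those the bracket is
  -- prescribed.
  · conv_lhs => rw [← Function.surjInv_eq current_surjective u,
      ← Function.surjInv_eq current_surjective v]
    exact (isInducedBracket_iff g br).1 hbr _ _

theorem isDGLieSuperalgebra_current {g : Matrix I I ℂ} (hg : g.IsSymm)
    {D : CurrentSpace I → CurrentSpace I}
    {br : CurrentSpace I → CurrentSpace I → CurrentSpace I} (hD : IsInducedDifferential D)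
    (hbr : IsInducedBracket g br) : IsDGLieSuperalgebra (currentParity I) D br := by
  have hg' : g⁻¹.IsSymm := by rw [Matrix.IsSymm, Matrix.transpose_nonsing_inv, hg.eq]
  exact isDGLieSuperalgebra_of_surjective (S := SuperSeries I) (V := CurrentSpace I)
    (c := current) (par := seriesParity I)
    (δ := delta) (b := seriesBracket g⁻¹) (D := D) (br := br) current_surjective
    mem_currentParity isInternal_currentParity (fun L => hD L)
    ((isInducedBracket_iff g br).1 hbr) delta_mem_seriesParity (seriesBracket_mem_seriesParity g⁻¹)
    delta_delta (current_seriesBracket_skew hg') (current_seriesBracket_jacobi hg')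
    (delta_seriesBracket g⁻¹)

end

end BCOV

theorem mainTheorem8 {I : Type*} [Fintype I] [DecidableEq I] (g : Matrix I I ℂ)
    (hsymm : g.IsSymm) (hdet : IsUnit g.det) :
    (∃! D : BCOV.CurrentSpace I → BCOV.CurrentSpace I, BCOV.IsInducedDifferential D) ∧
    (∃! br : BCOV.CurrentSpace I → BCOV.CurrentSpace I → BCOV.CurrentSpace I,
      BCOV.IsInducedBracket g br) ∧
    ∀ (D : BCOV.CurrentSpace I → BCOV.CurrentSpace I)
      (br : BCOV.CurrentSpace I → BCOV.CurrentSpace I → BCOV.CurrentSpace I),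
      BCOV.IsInducedDifferential D → BCOV.IsInducedBracket g br →
        BCOV.IsDGLieSuperalgebra (BCOV.currentParity I) D br :=
  ⟨BCOV.existsUnique_inducedDifferential, BCOV.existsUnique_inducedBracket g,
    fun _ _ hD hbr => BCOV.isDGLieSuperalgebra_current hsymm hD hbr⟩
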